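/- **Setting.** Let $d\ge 2$, let $D\subset\mathbb R^d$ be a bounded domain with Lipschitz boundary, $T>0$, $Q_T=(0,T)\times D$, $2\le p<\infty$ and $p'=\frac p{p-1}$. Let $W_0^{1,p}(D)$ be the closure of $C_c^\infty(D)$ in $W^{1,p}(D)$, $W^{-1,p'}(D)$ its dual, and $$\mathcal W=\{v\in L^p(0,T;W_0^{1,p}(D)) : \partial_t v\in L^{p'}(0,T;W^{-1,p'}(D))\},\qquad \|v\|_{\mathcal W}^p=\|v\|_{L^p(0,T;W_0^{1,p}(D))}^p+\|\partial_t v\|_{L^{p'}(0,T;W^{-1,p'}(D))}^p,$$ with dual $\mathcal W'$. Let $(\Omega,\mathcal F,\mathbb P)$ be a probability space with a complete, right-continuous filtration $(\mathcal F_t)_{t\ge0}$, $(W_t)_{t\ge 0}$ an $L^2(D)$-valued cylindrical Wiener process for it, and $\Phi\in L^2(\Omega\times(0,T);HS(L^2(D)))$ progressively measurable with values in the Hilbert–Schmidt operators; $\int_0^\cdot\Phi\,dW$ is the Itô integral (continuous in $L^2(D)$). Let $f:\mathbb R\to\mathbb R$ be Lipschitz continuous with Lipschitz constant $L_f\ge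 0$ and $f(0)=0$. Let $a:D\times\mathbb R\times\mathbb R^d\to\mathbb R^d$ be a Carathéodory function such that for a.e. $x\in D$ and all $\lambda,\lambda_1,\lambda_2\in\mathbb R$, $\xi,\zeta\in\mathbb R^d$: * (A1) $(a(x,\lambda,\xi)-a(x,\lambda,\zeta))\cdot(\xi-\zeta)\ge0$; * (A2) $a(x,\lambda,\xi)\cdot\xi\ge\kappa(x)+C_1|\xi|^p$ and $|a(x,\lambda,\xi)|\le C_2|\xi|^{p-1}+C_3|\lambda|^{p-1}+g(x)$, for some $\kappa\in L^1(D)$, $C_1>0$, $C_2,C_3\ge0$, $0\le g\in L^{p'}(D)$; * (A3) $|a(x,\lambda_1,\xi)-a(x,\lambda_2,\xi)|\le(C_4|\xi|^{p-1}+h(x))|\lambda_1-\lambda_2|$, for some $C_4\ge0$, $0\le h\in L^{p'}(D)$. **Capacity.** For open $U\subset Q_T$ let $\operatorname{cap}_p(U)=\inf\{\|v\|_{\mathcal W}: v\in\mathcal W,\ v\ge 1_U\text{ a.e. in }Q_T\}$ ($\inf\emptyset=\infty$), and for $B\subset Q_T$ let $\operatorname{cap}_p(B)=\inf\{\operatorname{cap}_p(U):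 U\supset B,\ U\subset Q_T\text{ open}\}$. *Quasi everywhere* (q.e.) means outside a set of capacity $0$. A function $g$ on $Q_T$ is *quasi continuous* if for each $\varepsilon>0$ it is continuous on $Q_T\setminus U$ for some open $U\subset Q_T$ with $\operatorname{cap}_p(U)\le\varepsilon$. A *q.e. defined representative* of $u\in L^p(0,T;W_0^{1,p}(D))$ is a function equal to $u$ a.e. in $Q_T$ which is the q.e. limit of quasi continuous functions whose classes converge to $u$ in $L^p(0,T;W_0^{1,p}(D))$. **Solutions.** Let $u_0\in L^2(\Omega\times D)$ be $\mathcal F_0$-measurable and nonnegative a.e. A solution with initial value $u_0$ of $$du-\operatorname{div}a(\cdot,u,\nabla u)\,dt+f(u)\,dt=\Phi\,dW+d\eta,\qquad u\ge0,\ \eta\ge0,\ \eta(u)=0,\tag{P}$$ is a pair $(u,\eta)$ such that 1. $u\ge0$ a.e. in $\Omega\times Q_T$ and $u\in L^2_w(\Omega;L^\infty(0,T;L^2(D)))\cap L^p(\Omega;L^p(0,T;W_0^{1,p}(D)))$, where $L^2_w$ refers to weak-$*$ measurable functions; 2. $u$ has a representative that is right-continuous in time on $[0,T)$ with values in $L^2(D)$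 and has the value $u_0$ at $t=0$ (below, $u(t)$ is the value of this representative); 3. $\eta\in L^{p'}(\Omega;\mathcal W')$ is also a nonnegative random Radon measure on $Q_T$ (i.e. $\langle\eta,\varphi\rangle=\int_{Q_T}\varphi\,d\eta$ for $\varphi\in C_c^\infty(Q_T)$) that is weak-$*$ adapted (i.e. $\int_{(0,t]\times D}\psi\,d\eta$ is $\mathcal F_t$-measurable for all $\psi\in C_c(Q_T)$, $t\in(0,T)$), and $\mathbb P$-a.s. $\partial_t\big[u-\int_0^\cdot\Phi\,dW\big]-\operatorname{div}a(\cdot,u,\nabla u)+f(u)=\eta$ in $\mathcal W'$, where $\partial_t z\in\mathcal W'$ means a functional with $\langle\partial_t z,\varphi\rangle=-\int_{Q_T}z\,\partial_t\varphi\,dx\,dt$ for $\varphi\in C_c^\infty(Q_T)$; 4. $\mathbb P$-a.s. $\eta(u)=0$, that is: $u$ has a q.e. defined representative, nonnegative q.e., with $\int_{Q_T}u\,d\eta=0$; for $\eta\in L^{p'}(0,T;W^{-1,p'}(D))$ it is also sufficient that $\int_0^T\langle\eta(t),u(t)\rangle\,dt=0$. **Theorem.** Suppose that $a=a(x,\xi)$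 does not depend on its second variable. Let $(u,\eta)$ and $(v,\nu)$ be two solutions of (P) with initial values $u_0$ and $v_0$ (for the same data $a,f,\Phi,W$), and suppose that $\mathbb P$-a.s. $\eta,\nu\in L^{p'}(0,T;W^{-1,p'}(D))$, i.e. the functionals $\eta,\nu\in\mathcal W'$ are of the form $w\mapsto\int_0^T\langle\zeta(t),w(t)\rangle\,dt$ with $\zeta\in L^{p'}(0,T;W^{-1,p'}(D))$. Then, $\mathbb P$-a.s., $u-v$ extends from $[0,T)$ to a continuous function $[0,T]\to L^2(D)$ and $$\sup_{t\in[0,T]}\|u(t)-v(t)\|_{L^2(D)}\le C\,\|u_0-v_0\|_{L^2(D)},\qquad C=e^{TL_f},$$ where at $t=T$ the value of the continuous extension is meant. In particular $C$ depends only on $T$ and $f$. -/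

import Mathlib

open MeasureTheory ProbabilityTheory Set Filter Topology TopologicalSpace
open scoped ENNReal NNReal Distributions

noncomputable section

namespace ObstacleProblem

/-- The Euclidean space `ℝ^d`. -/
abbrev Eu (d : ℕ) : Type := EuclideanSpace ℝ (Fin d)

variable {d : ℕ}

/-- A bounded domain (nonempty connected open set) of `ℝ^d` with Lipschitz boundary: around each
boundary point, and for a suitable unit vector `n`, the set is the strict subgraph in direction `n`
of a Lipschitz function of the component orthogonal to `n`. -/
structure IsBoundedLipschitzDomain (D : Opens (Eu d)) : Prop where
  bounded : Bornology.IsBounded (D : Set (Eu d))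
  connected : IsConnected (D : Set (Eu d))
  lipschitz_boundary : ∀ z ∈ frontier (D : Set (Eu d)),
    ∃ (n : Eu d) (r : ℝ) (K : ℝ≥0) (γ : Eu d → ℝ), ‖n‖ = 1 ∧ 0 < r ∧ LipschitzWith K γ ∧
      ∀ y ∈ Metric.ball z r, y ∈ D ↔ inner ℝ n y < γ (y - (inner ℝ n y) • n)

/-! ### Function spaces -/

/-- Lebesgue measure on `D`. -/
abbrev volD (D : Opens (Eu d)) : Measure (Eu d) := volume.restrict (D : Set (Eu d))

/-- Lebesgue measure on `(0,T)`. -/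
abbrev volT (T : ℝ) : Measure ℝ := volume.restrict (Ioo 0 T)

/-- The space `L²(D)`. -/
abbrev L2 (D : Opens (Eu d)) : Type := Lp ℝ 2 (volD D)

lemma memLp_test (D : Opens (Eu d)) (p : ℝ≥0∞) (φ : 𝓓(D, ℝ)) :
    MemLp (fun x => φ x) p (volD D) :=
  φ.continuous.memLp_of_hasCompactSupport φ.hasCompactSupport

lemma memLp_gradient_test (D : Opens (Eu d)) (p : ℝ≥0∞) (φ : 𝓓(D, ℝ)) :
    MemLp (gradient φ) p (volD D) := by
  have hc : Continuous (gradient φ) :=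
    (InnerProductSpace.toDual ℝ (Eu d)).symm.continuous.comp
      (φ.contDiff.continuous_fderiv (by simp))
  have hs : HasCompactSupport (gradient φ) :=
    (φ.hasCompactSupport.fderiv (𝕜 := ℝ)).comp_left
      (g := fun l => (InnerProductSpace.toDual ℝ (Eu d)).symm l) (by simp)
  exact hc.memLp_of_hasCompactSupport hs

/-- The pair `(φ, ∇φ) ∈ L^p(D) × L^p(D)^d` of a test function `φ ∈ C_c^∞(D)`. -/
def testPair (D : Opens (Eu d)) (p : ℝ≥0∞) (φ : 𝓓(D, ℝ)) :
    WithLp p (Lp ℝ p (volD D) × Lp (Eu d) p (volD D)) :=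
  WithLp.toLp p ((memLp_test D p φ).toLp _, (memLp_gradient_test D p φ).toLp _)

/-- The Sobolev space `W_0^{1,p}(D)`, the closure of `C_c^∞(D)` in the norm
`(‖w‖_{L^p}^p + ‖∇w‖_{L^p}^p)^{1/p}` of `W^{1,p}(D)`. An element is stored as the pair `(w, ∇w)`;
as the weak gradient is a closed operator, the second component of a pair in the closure is the weak
gradient of the first one. -/
def W0Sub (D : Opens (Eu d)) (p : ℝ≥0∞) [Fact (1 ≤ p)] :
    Submodule ℝ (WithLp p (Lp ℝ p (volD D) × Lp (Eu d) p (volD D))) :=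
  (Submodule.span ℝ (range (testPair D p))).topologicalClosure

/-- The normed space `W_0^{1,p}(D)`. -/
def W0 (D : Opens (Eu d)) (p : ℝ≥0∞) [Fact (1 ≤ p)] : Type := ↥(W0Sub D p)

instance (D : Opens (Eu d)) (p : ℝ≥0∞) [Fact (1 ≤ p)] : NormedAddCommGroup (W0 D p) :=
  inferInstanceAs (NormedAddCommGroup ↥(W0Sub D p))

instance (D : Opens (Eu d)) (p : ℝ≥0∞) [Fact (1 ≤ p)] : NormedSpace ℝ (W0 D p) :=
  inferInstanceAs (NormedSpace ℝ ↥(W0Sub D p))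

section spaces

variable (D : Opens (Eu d)) (p q : ℝ≥0∞) [Fact (1 ≤ p)] [Fact (1 ≤ q)] (T : ℝ)

variable {D p} in
/-- The values of `w ∈ W_0^{1,p}(D)`. -/
def val (w : W0 D p) : Eu d → ℝ := fun x => w.1.fst x

variable {D p} in
/-- The weak gradient of `w ∈ W_0^{1,p}(D)`. -/
def grad (w : W0 D p) : Eu d → Eu d := fun x => w.1.snd x

/-- A test function as an element of `W_0^{1,p}(D)`. -/
def ofTest (φ : 𝓓(D, ℝ)) : W0 D p :=
  ⟨testPair D p φ, Submodule.le_topologicalClosure _ (Submodule.subset_span ⟨φ, rfl⟩)⟩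

/-- The space `L^p(0,T; W_0^{1,p}(D))`. -/
abbrev LpW0 : Type := Lp (W0 D p) p (volT T)

/-- The space `L^q(0,T; W^{-1,q}(D))`, where `W^{-1,q}(D)` is the dual of `W_0^{1,p}(D)`
(`p` and `q` conjugate exponents). -/
abbrev LqDual : Type := Lp (StrongDual ℝ (W0 D p)) q (volT T)

variable {D p q T} in
/-- `ζ = ∂_t v` in the sense of distributions on `(0,T)` with values in `W^{-1,q}(D)`:
for all `θ ∈ C_c^∞(0,T)` and `ψ ∈ C_c^∞(D)`,
`∫_0^T θ'(t) (v(t), ψ)_{L²(D)} dt = - ∫_0^T θ(t) ⟨ζ(t), ψ⟩ dt`. -/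
def IsWeakTimeDeriv (v : LpW0 D p T) (ζ : LqDual D p q T) : Prop :=
  ∀ (θ : 𝓓((⟨Ioo 0 T, isOpen_Ioo⟩ : Opens ℝ), ℝ)) (ψ : 𝓓(D, ℝ)),
    ∫ t in Ioo 0 T, deriv θ t * (∫ x in (D : Set (Eu d)), val (v t) x * ψ x)
      = - ∫ t in Ioo 0 T, θ t * ζ t (ofTest D p ψ)

/-- Integration over `D` against a test function is a continuous linear functional on
`W_0^{1,p}(D)`. -/
lemma exists_clm_test [p.HolderConjugate q] (ψ : 𝓓(D, ℝ)) :
    ∃ L : W0 D p →L[ℝ] ℝ, ∀ w : W0 D p, L w = ∫ x in (D : Set (Eu d)), val w x * ψ x := by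
  let ψ' : Lp ℝ q (volD D) := (memLp_test D q ψ).toLp _
  let B := ((ContinuousLinearMap.mul ℝ ℝ).lpPairing (volD D) p q).flip ψ'
  refine ⟨B ∘L (ContinuousLinearMap.fst ℝ (Lp ℝ p (volD D)) (Lp (Eu d) p (volD D))) ∘L
    (WithLp.prodContinuousLinearEquiv p ℝ _ _).toContinuousLinearMap ∘L (W0Sub D p).subtypeL,
    fun w => ?_⟩
  change (ContinuousLinearMap.mul ℝ ℝ).lpPairing (volD D) p q w.1.fst ψ' = _
  rw [ContinuousLinearMap.lpPairing_eq_integral]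
  refine integral_congr_ae ?_
  filter_upwards [(memLp_test D q ψ).coeFn_toLp] with x hx
  simp [val, ψ', hx]

lemma integrable_left [p.HolderConjugate q] (θ : 𝓓((⟨Ioo 0 T, isOpen_Ioo⟩ : Opens ℝ), ℝ))
    (ψ : 𝓓(D, ℝ)) (v : LpW0 D p T) :
    Integrable (fun t => deriv θ t * (∫ x in (D : Set (Eu d)), val (v t) x * ψ x)) (volT T) := by
  obtain ⟨L, hL⟩ := exists_clm_test D p q ψ
  simp_rw [← hL]
  have hv : Integrable (fun t => v t) (volT T) := (Lp.memLp v).integrable Fact.out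
  have hc : Continuous (deriv θ) := θ.contDiff.continuous_deriv (by simp)
  have hs : HasCompactSupport (deriv θ) := θ.hasCompactSupport.deriv
  obtain ⟨C, hC⟩ := hc.bounded_above_of_compact_support hs
  exact (L.integrable_comp hv).bdd_mul (c := C) hc.aestronglyMeasurable (Eventually.of_forall hC)

lemma integrable_right (θ : 𝓓((⟨Ioo 0 T, isOpen_Ioo⟩ : Opens ℝ), ℝ))
    (ψ : 𝓓(D, ℝ)) (ζ : LqDual D p q T) :
    Integrable (fun t => θ t * ζ t (ofTest D p ψ)) (volT T) := by
  have hv : Integrable (fun t => ζ t) (volT T) := (Lp.memLp ζ).integrable Fact.out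
  obtain ⟨C, hC⟩ := θ.continuous.bounded_above_of_compact_support θ.hasCompactSupport
  have h1 := ((ContinuousLinearMap.apply ℝ ℝ (ofTest D p ψ)).integrable_comp hv)
  exact h1.bdd_mul (c := C) θ.continuous.aestronglyMeasurable (Eventually.of_forall hC)

/-- The space `𝒲` of all `v ∈ L^p(0,T; W_0^{1,p}(D))` with `∂_t v ∈ L^q(0,T; W^{-1,q}(D))`, with the
norm `(‖v‖^p + ‖∂_t v‖^p)^{1/p}`; an element is stored as the pair `(v, ∂_t v)`. -/
def SpaceWSub [p.HolderConjugate q] : Submodule ℝ (WithLp p (LpW0 D p T × LqDual D p q T)) where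
  carrier := {w | IsWeakTimeDeriv w.fst w.snd}
  zero_mem' := by
    intro θ ψ
    obtain ⟨L, hL⟩ := exists_clm_test D p q ψ
    have h1 : (fun t => deriv θ t * (∫ x in (D : Set (Eu d)),
        val ((0 : LpW0 D p T) t) x * ψ x)) =ᵐ[volT T] fun _ => 0 := by
      filter_upwards [Lp.coeFn_zero (W0 D p) p (volT T)] with t ht
      rw [ht, ← hL]; simp
    have h2 : (fun t => θ t * (0 : LqDual D p q T) t (ofTest D p ψ)) =ᵐ[volT T] fun _ => 0 := by
      filter_upwards [Lp.coeFn_zero (StrongDual ℝ (W0 D p)) q (volT T)] with t ht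
      rw [ht]; simp
    rw [WithLp.zero_fst, WithLp.zero_snd, integral_congr_ae h1, integral_congr_ae h2]
    simp
  add_mem' := by
    intro a b ha hb θ ψ
    obtain ⟨L, hL⟩ := exists_clm_test D p q ψ
    have h1 : (fun t => deriv θ t * (∫ x in (D : Set (Eu d)), val ((a.fst + b.fst) t) x * ψ x))
        =ᵐ[volT T] fun t => deriv θ t * (∫ x in (D : Set (Eu d)), val (a.fst t) x * ψ x)
          + deriv θ t * (∫ x in (D : Set (Eu d)), val (b.fst t) x * ψ x) := by
      filter_upwards [Lp.coeFn_add a.fst b.fst] with t ht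
      rw [ht, ← hL, ← hL, ← hL, Pi.add_apply, map_add, mul_add]
    have h2 : (fun t => θ t * (a.snd + b.snd) t (ofTest D p ψ)) =ᵐ[volT T]
        fun t => θ t * a.snd t (ofTest D p ψ) + θ t * b.snd t (ofTest D p ψ) := by
      filter_upwards [Lp.coeFn_add a.snd b.snd] with t ht
      rw [ht, Pi.add_apply, _root_.add_apply, mul_add]
    rw [WithLp.add_fst, WithLp.add_snd, integral_congr_ae h1, integral_congr_ae h2,
      integral_add (integrable_left D p q T θ ψ _) (integrable_left D p q T θ ψ _),
      integral_add (integrable_right D p q T θ ψ _) (integrable_right D p q T θ ψ _),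
      ha θ ψ, hb θ ψ]
    ring
  smul_mem' := by
    intro c a ha θ ψ
    obtain ⟨L, hL⟩ := exists_clm_test D p q ψ
    have h1 : (fun t => deriv θ t * (∫ x in (D : Set (Eu d)), val ((c • a.fst) t) x * ψ x))
        =ᵐ[volT T] fun t => c * (deriv θ t *
          (∫ x in (D : Set (Eu d)), val (a.fst t) x * ψ x)) := by
      filter_upwards [Lp.coeFn_smul c a.fst] with t ht
      rw [ht, ← hL, ← hL, Pi.smul_apply, map_smul, smul_eq_mul]
      ring
    have h2 : (fun t => θ t * (c • a.snd) t (ofTest D p ψ)) =ᵐ[volT T]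
        fun t => c * (θ t * a.snd t (ofTest D p ψ)) := by
      filter_upwards [Lp.coeFn_smul c a.snd] with t ht
      rw [ht, Pi.smul_apply, _root_.smul_apply, smul_eq_mul]
      ring
    rw [WithLp.smul_fst, WithLp.smul_snd, integral_congr_ae h1, integral_congr_ae h2,
      integral_const_mul, integral_const_mul, ha θ ψ]
    ring

/-- The normed space `𝒲`. -/
def SpaceW [p.HolderConjugate q] : Type := ↥(SpaceWSub D p q T)

instance [p.HolderConjugate q] : NormedAddCommGroup (SpaceW D p q T) :=
  inferInstanceAs (NormedAddCommGroup ↥(SpaceWSub D p q T))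

instance [p.HolderConjugate q] : NormedSpace ℝ (SpaceW D p q T) :=
  inferInstanceAs (NormedSpace ℝ ↥(SpaceWSub D p q T))

variable {D p q T} in
/-- An element of `𝒲` as an element of `L^p(0,T; W_0^{1,p}(D))`. -/
def SpaceW.fn [p.HolderConjugate q] (w : SpaceW D p q T) : LpW0 D p T := w.1.fst

variable {D p T} in
/-- `g` is a representative of `v` on the cylinder, i.e. `v = g` a.e. in `(0,T) × D`. -/
def IsRepr (v : LpW0 D p T) (g : ℝ × Eu d → ℝ) : Prop :=
  ∀ᵐ t ∂volT T, ∀ᵐ x ∂volD D, val (v t) x = g (t, x)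

/-- The cylinder `Q_T = (0,T) × D`. -/
def cyl : Opens (ℝ × Eu d) := ⟨Ioo 0 T ×ˢ (D : Set (Eu d)), isOpen_Ioo.prod D.isOpen⟩

end spaces

/-! ### Parabolic capacity -/

section capacity

variable (D : Opens (Eu d)) (p q : ℝ≥0∞) [Fact (1 ≤ p)] [Fact (1 ≤ q)] [p.HolderConjugate q] (T : ℝ)

/-- The parabolic `p`-capacity of an open set `U ⊆ Q_T`:
`inf {‖v‖_𝒲 | v ∈ 𝒲, v ≥ 1_U a.e. in Q_T}`, with `inf ∅ = ∞`. -/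
def capOpen (U : Set (ℝ × Eu d)) : ℝ≥0∞ :=
  ⨅ (v : SpaceW D p q T) (_ : ∀ᵐ t ∂volT T, ∀ᵐ x ∂volD D,
    U.indicator (fun _ => (1 : ℝ)) (t, x) ≤ val (v.fn t) x), ‖v‖ₑ

/-- The parabolic `p`-capacity of a subset of `Q_T`. -/
def cap (B : Set (ℝ × Eu d)) : ℝ≥0∞ :=
  ⨅ (U : Set (ℝ × Eu d)) (_ : IsOpen U ∧ U ⊆ cyl D T ∧ B ⊆ U), capOpen D p q T U

/-- `P` holds quasi everywhere in `Q_T`, i.e. outside a set of capacity zero. -/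
def QuasiEverywhere (P : ℝ × Eu d → Prop) : Prop :=
  cap D p q T {z | z ∈ cyl D T ∧ ¬ P z} = 0

/-- `cap_p`-quasi continuity of a function on `Q_T`. -/
def QuasiContinuous (g : ℝ × Eu d → ℝ) : Prop :=
  ∀ ε : ℝ≥0∞, 0 < ε → ∃ U : Set (ℝ × Eu d), IsOpen U ∧ U ⊆ cyl D T ∧ cap D p q T U ≤ ε ∧
    ContinuousOn g ((cyl D T : Set (ℝ × Eu d)) \ U)

variable {D p T} in
/-- `g` is a quasi everywhere defined representative of `v ∈ L^p(0,T; W_0^{1,p}(D))`: it is a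
representative of `v` and the limit, quasi everywhere in `Q_T`, of quasi continuous functions whose
classes converge to `v` in `L^p(0,T; W_0^{1,p}(D))`. In particular every quasi continuous
representative of `v` is one (take a constant sequence). -/
def IsQERepr (v : LpW0 D p T) (g : ℝ × Eu d → ℝ) : Prop :=
  IsRepr v g ∧ ∃ (gn : ℕ → ℝ × Eu d → ℝ) (vn : ℕ → LpW0 D p T),
    (∀ n, QuasiContinuous D p q T (gn n) ∧ IsRepr (vn n) (gn n)) ∧
    Tendsto vn atTop (𝓝 v) ∧
    QuasiEverywhere D p q T (fun z => Tendsto (fun n => gn n z) atTop (𝓝 (g z)))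

variable {D p q T} in
/-- The functional `η ∈ 𝒲'` is given by `ζ ∈ L^q(0,T; W^{-1,q}(D))`:
`⟨η, w⟩ = ∫_0^T ⟨ζ(t), w(t)⟩ dt` for all `w ∈ 𝒲`. -/
def IsGivenBy (η : StrongDual ℝ (SpaceW D p q T)) (ζ : LqDual D p q T) : Prop :=
  ∀ w : SpaceW D p q T, η w = ∫ t in Ioo 0 T, ζ t (w.fn t)

variable {D p q T} in
/-- The condition `η(u) = 0` for a reflection which is both a functional `η ∈ 𝒲'` and a measure `μ`:
there is a quasi everywhere defined representative of `u`, nonnegative quasi everywhere, whose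
integral against `μ` vanishes, or else `η` lies in `L^q(0,T; W^{-1,q}(D))` and the duality pairing
of `η` with `u` vanishes. -/
def MinimalityCondition (u : LpW0 D p T) (η : StrongDual ℝ (SpaceW D p q T))
    (μ : Measure (ℝ × Eu d)) : Prop :=
  (∃ g : ℝ × Eu d → ℝ, IsQERepr q u g ∧ QuasiEverywhere D p q T (fun z => 0 ≤ g z) ∧
    IntegrableOn g (cyl D T) μ ∧ ∫ z in (cyl D T : Set (ℝ × Eu d)), g z ∂μ = 0) ∨
  (∃ ζ : LqDual D p q T, IsGivenBy η ζ ∧ ∫ t in Ioo 0 T, ζ t (u t) = 0)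

variable {D p q T} in
/-- `G ∈ 𝒲'` is the time derivative `∂_t z` of a function `z` on `Q_T`:
`⟨G, φ⟩ = - ∫_{Q_T} z ∂_t φ` for all `φ ∈ C_c^∞(Q_T)`. -/
def IsTimeDeriv (G : StrongDual ℝ (SpaceW D p q T)) (z : ℝ → Eu d → ℝ) : Prop :=
  ∀ (φ : 𝓓(cyl D T, ℝ)) (w : SpaceW D p q T), IsRepr w.fn φ →
    G w = - ∫ t in Ioo 0 T, ∫ x in (D : Set (Eu d)), z t x * deriv (fun s => φ (s, x)) t

/-- The functional `η ∈ 𝒲'` is the (Radon) measure `μ` on `Q_T`: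
`⟨η, φ⟩ = ∫_{Q_T} φ dμ` for all `φ ∈ C_c^∞(Q_T)`. -/
def IsMeasureFunctional {D : Opens (Eu d)} {p q : ℝ≥0∞} [Fact (1 ≤ p)] [Fact (1 ≤ q)]
    [p.HolderConjugate q] {T : ℝ} (η : StrongDual ℝ (SpaceW D p q T))
    (μ : Measure (ℝ × Eu d)) : Prop :=
  ∀ (φ : 𝓓(cyl D T, ℝ)) (w : SpaceW D p q T), IsRepr w.fn φ →
    η w = ∫ z in (cyl D T : Set (ℝ × Eu d)), φ z ∂μ

end capacity

/-! ### The operator -/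

/-- `a : D × ℝ × ℝ^d → ℝ^d` is a Carathéodory function satisfying the monotonicity,
coercivity and growth, and Lipschitz (in the second variable) conditions for the exponents `p` and `q = p'`. -/
structure IsLerayLions (D : Opens (Eu d)) (p q : ℝ≥0∞) (a : Eu d → ℝ → Eu d → Eu d) : Prop where
  measurable : ∀ l ξ, AEStronglyMeasurable (fun x => a x l ξ) (volD D)
  continuous : ∀ᵐ x ∂volD D, Continuous (fun z : ℝ × Eu d => a x z.1 z.2)
  monotone : ∀ᵐ x ∂volD D, ∀ l ξ ζ, 0 ≤ inner ℝ (a x l ξ - a x l ζ) (ξ - ζ)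
  coercive_growth : ∃ (κ : Eu d → ℝ) (C₁ C₂ C₃ : ℝ) (g : Eu d → ℝ),
    Integrable κ (volD D) ∧ 0 < C₁ ∧ 0 ≤ C₂ ∧ 0 ≤ C₃ ∧ (∀ x, 0 ≤ g x) ∧ MemLp g q (volD D) ∧
    ∀ᵐ x ∂volD D, ∀ l ξ, κ x + C₁ * ‖ξ‖ ^ p.toReal ≤ inner ℝ (a x l ξ) ξ ∧
      ‖a x l ξ‖ ≤ C₂ * ‖ξ‖ ^ (p.toReal - 1) + C₃ * |l| ^ (p.toReal - 1) + g x
  lipschitz : ∃ (C₄ : ℝ) (h : Eu d → ℝ), 0 ≤ C₄ ∧ (∀ x, 0 ≤ h x) ∧ MemLp h q (volD D) ∧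
    ∀ᵐ x ∂volD D, ∀ l₁ l₂ ξ,
      ‖a x l₁ ξ - a x l₂ ξ‖ ≤ (C₄ * ‖ξ‖ ^ (p.toReal - 1) + h x) * |l₁ - l₂|

/-! ### The noise -/

section noise

variable {Ω : Type*} [mΩ : MeasurableSpace Ω] {H : Type*} [NormedAddCommGroup H]
  [InnerProductSpace ℝ H]

/-- The filtration is complete (with respect to `P`): it contains all `P`-null sets. -/
def IsCompleteFiltration (P : Measure Ω) (ℱ : Filtration ℝ≥0 mΩ) : Prop :=
  ∀ s : Set Ω, P s = 0 → MeasurableSet[ℱ 0] s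

/-- An `H`-valued cylindrical Wiener process for the filtration `ℱ`: a family
`W t h`, a.s. linear in `h`, such that for each `h` the process `W · h` is adapted with a.s.
continuous paths, starts in `0`, and has increments `W t h - W s h` which are independent of `ℱ s`
and centered Gaussian of variance `(t - s) ‖h‖²`. -/
structure IsCylindricalWiener (P : Measure Ω) (ℱ : Filtration ℝ≥0 mΩ) (W : ℝ≥0 → H → Ω → ℝ) :
    Prop where
  adapted : ∀ t h, Measurable[ℱ t] (W t h)
  continuous_paths : ∀ h, ∀ᵐ ω ∂P, Continuous (fun t => W t h ω)
  zero : ∀ h, ∀ᵐ ω ∂P, W 0 h ω = 0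
  linear : ∀ t (b c : ℝ) (h k : H), ∀ᵐ ω ∂P, W t (b • h + c • k) ω = b * W t h ω + c * W t k ω
  gaussian : ∀ s t h, s ≤ t →
    P.map (fun ω => W t h ω - W s h ω) = gaussianReal 0 ((t - s) * ‖h‖₊ ^ 2)
  indep : ∀ s t h, s ≤ t →
    Indep (MeasurableSpace.comap (fun ω => W t h ω - W s h ω) inferInstance) (ℱ s) P

/-- The squared Hilbert-Schmidt norm of an operator: the supremum of `∑ ‖A e_i‖²` over all finite
orthonormal systems. -/
def hsNormSq (A : H →L[ℝ] H) : ℝ≥0∞ :=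
  ⨆ (n : ℕ) (e : Fin n → H) (_ : Orthonormal ℝ e), ∑ i, ‖A (e i)‖ₑ ^ 2

/-- `Φ : Ω × (0,T) → HS(H)` is progressively measurable and in `L²(Ω × (0,T); HS(H))`. (As `HS(H)`
is a separable Hilbert space for separable `H`, measurability is the measurability of all `Φ h`.) -/
structure IsIntegrand (P : Measure Ω) (ℱ : Filtration ℝ≥0 mΩ) (T : ℝ) (Φ : ℝ → Ω → (H →L[ℝ] H)) :
    Prop where
  hilbertSchmidt : ∀ t ∈ Ioo 0 T, ∀ ω, hsNormSq (Φ t ω) < ∞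
  progressive : ∀ h : H, IsStronglyProgressive ℱ
    (fun (t : ℝ≥0) ω => (Ioo 0 T).indicator (fun s => Φ s ω h) (t : ℝ))
  square_integrable : ∫⁻ ω, (∫⁻ t in Ioo 0 T, hsNormSq (Φ t ω)) ∂P < ∞

/-- An elementary `HS(H)`-valued process `∑_i 1_{A_i} 1_{(s_i, t_i]} ⟨h_i, ·⟩ k_i` with
`A_i ∈ ℱ_{s_i}`. -/
structure ElementaryProcess (ℱ : Filtration ℝ≥0 mΩ) (H : Type*) [NormedAddCommGroup H]
    [InnerProductSpace ℝ H] where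
  n : ℕ
  s : Fin n → ℝ≥0
  t : Fin n → ℝ≥0
  s_le_t : ∀ i, s i ≤ t i
  A : Fin n → Set Ω
  measurable_A : ∀ i, MeasurableSet[ℱ (s i)] (A i)
  h : Fin n → H
  k : Fin n → H

/-- The operators of an elementary process. -/
def ElementaryProcess.eval {ℱ : Filtration ℝ≥0 mΩ} (Ψ : ElementaryProcess ℱ H) (r : ℝ) (ω : Ω) :
    H →L[ℝ] H :=
  ∑ i, ((Ψ.A i).indicator (fun _ => (1 : ℝ)) ω *
    (Ioc (Ψ.s i : ℝ) (Ψ.t i)).indicator (fun _ => (1 : ℝ)) r) •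
      (innerSL ℝ (Ψ.h i)).smulRight (Ψ.k i)

/-- The stochastic integral `∫_0^r Ψ dW` of an elementary process. -/
def ElementaryProcess.integral {ℱ : Filtration ℝ≥0 mΩ} (W : ℝ≥0 → H → Ω → ℝ)
    (Ψ : ElementaryProcess ℱ H) (r : ℝ≥0) (ω : Ω) : H :=
  ∑ i, ((Ψ.A i).indicator (fun _ => (1 : ℝ)) ω *
    (W (min (Ψ.t i) r) (Ψ.h i) ω - W (min (Ψ.s i) r) (Ψ.h i) ω)) • Ψ.k i

/-- `M` is (a version of) the Itô integral process `M_t = ∫_0^t Φ dW`, `0 ≤ t ≤ T`: it is adapted,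
has a.s. continuous paths in `H`, and is the mean square limit of the stochastic integrals of
elementary processes converging to `Φ` in `L²(Ω × (0,T); HS(H))`. This determines `M` up to
indistinguishability. -/
structure IsItoIntegral (P : Measure Ω) (ℱ : Filtration ℝ≥0 mΩ) (W : ℝ≥0 → H → Ω → ℝ) (T : ℝ)
    (Φ : ℝ → Ω → (H →L[ℝ] H)) (M : ℝ≥0 → Ω → H) : Prop where
  adapted : ∀ t : ℝ≥0, (t : ℝ) ≤ T → StronglyMeasurable[ℱ t] (M t)
  continuous_paths : ∀ᵐ ω ∂P, ContinuousOn (fun t => M t ω) {t : ℝ≥0 | (t : ℝ) ≤ T}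
  limit : ∃ Ψ : ℕ → ElementaryProcess ℱ H,
    Tendsto (fun n => ∫⁻ ω, (∫⁻ t in Ioo 0 T, hsNormSq ((Ψ n).eval t ω - Φ t ω)) ∂P) atTop (𝓝 0) ∧
    ∀ t : ℝ≥0, (t : ℝ) ≤ T →
      Tendsto (fun n => ∫⁻ ω, ‖(Ψ n).integral W t ω - M t ω‖ₑ ^ 2 ∂P) atTop (𝓝 0)

end noise

/-! ### Solutions of the obstacle problem -/

section solution

variable {Ω : Type*} [mΩ : MeasurableSpace Ω]

/-- An admissible initial value: `u₀ ∈ L²(Ω × D)`, `ℱ_0`-measurable and nonnegative. -/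
structure IsInitialValue (P : Measure Ω) (ℱ : Filtration ℝ≥0 mΩ) {D : Opens (Eu d)}
    (u₀ : Ω → L2 D) : Prop where
  memLp : MemLp u₀ 2 P
  measurable : StronglyMeasurable[ℱ 0] u₀
  nonneg : ∀ᵐ ω ∂P, ∀ᵐ x ∂volD D, 0 ≤ u₀ ω x

/-- `η` is a random nonnegative Radon measure on `Q_T` (only its restriction to `Q_T` matters) that
is weak-`*` adapted. -/
structure IsAdaptedRandomRadon (ℱ : Filtration ℝ≥0 mΩ) (D : Opens (Eu d)) (T : ℝ)
    (η : Ω → Measure (ℝ × Eu d)) : Prop where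
  finite_on_compacts : ∀ ω, ∀ K : Set (ℝ × Eu d), IsCompact K → K ⊆ cyl D T → η ω K < ∞
  adapted : ∀ ψ : ℝ × Eu d → ℝ, Continuous ψ → HasCompactSupport ψ → tsupport ψ ⊆ cyl D T →
    ∀ t : ℝ≥0, (t : ℝ) ∈ Ioo 0 T →
      Measurable[ℱ t] (fun ω => ∫ z in Ioc 0 (t : ℝ) ×ˢ (D : Set (Eu d)), ψ z ∂η ω)

/-- `û` is a right-continuous in time `L²(D)`-valued representative, on `[0,T)`, of
`u ∈ L^p(0,T; W_0^{1,p}(D))` with `û(0) = û(0+) = u₀`. -/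
structure IsRightContRepr {D : Opens (Eu d)} {p : ℝ≥0∞} [Fact (1 ≤ p)] {T : ℝ} (u : LpW0 D p T)
    (u₀ : L2 D) (u' : ℝ → L2 D) : Prop where
  ae_eq : ∀ᵐ t ∂volT T, ∀ᵐ x ∂volD D, u' t x = val (u t) x
  right_continuous : ∀ t ∈ Ico 0 T, ContinuousWithinAt u' (Ioi t) t
  initial : u' 0 = u₀

/-- `(u, η)` is a solution of the obstacle problem
`du - div a(·,u,∇u) dt + f(u) dt = Φ dW + dη`, `u ≥ 0`, `η ≥ 0`, `η(u) = 0`, with initial value `u₀`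
and stochastic integral `M = ∫_0^· Φ dW`. The reflection is given by its functional
`η : Ω → 𝒲'` together with the random measure `μ` which this functional is. -/
structure IsSolution (P : Measure Ω) (ℱ : Filtration ℝ≥0 mΩ) {D : Opens (Eu d)} {p q : ℝ≥0∞}
    [Fact (1 ≤ p)] [Fact (1 ≤ q)] [p.HolderConjugate q] {T : ℝ} (a : Eu d → ℝ → Eu d → Eu d)
    (f : ℝ → ℝ) (M : ℝ≥0 → Ω → L2 D) (u₀ : Ω → L2 D)
    (u : Ω → LpW0 D p T) (η : Ω → StrongDual ℝ (SpaceW D p q T)) (μ : Ω → Measure (ℝ × Eu d)) :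
    Prop where
  /-- `u ≥ 0` a.e. in `Ω × Q_T` -/
  nonneg : ∀ᵐ ω ∂P, ∀ᵐ t ∂volT T, ∀ᵐ x ∂volD D, 0 ≤ val (u ω t) x
  /-- `u ∈ L^p(Ω; L^p(0,T; W_0^{1,p}(D)))` -/
  memLp : MemLp u p P
  /-- `u ∈ L²_w(Ω; L^∞(0,T; L²(D)))`: square integrability of the norm -/
  memLinfty : ∫⁻ ω, (essSup (fun t => eLpNorm (val (u ω t)) 2 (volD D)) (volT T)) ^ 2 ∂P < ∞
  /-- `u ∈ L²_w(Ω; L^∞(0,T; L²(D)))`: weak-`*` measurability -/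
  weakStar_measurable : ∀ ψ : Lp (L2 D) 1 (volT T),
    AEMeasurable (fun ω => ∫ t in Ioo 0 T, ∫ x in (D : Set (Eu d)), val (u ω t) x * ψ t x) P
  exists_rightContRepr : ∃ u' : Ω → ℝ → L2 D, ∀ᵐ ω ∂P, IsRightContRepr (u ω) (u₀ ω) (u' ω)
  /-- `η ∈ L^q(Ω; 𝒲')` -/
  reflection_memLp : MemLp η q P
  reflection_radon : IsAdaptedRandomRadon ℱ D T μ
  reflection_measure : ∀ᵐ ω ∂P, IsMeasureFunctional (η ω) (μ ω)
  /-- `∂_t [u - ∫_0^· Φ dW] - div a(·,u,∇u) + f(u) = η` in `𝒲'` -/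
  equation : ∀ᵐ ω ∂P, ∃ G : StrongDual ℝ (SpaceW D p q T),
    IsTimeDeriv G (fun t x => val (u ω t) x - M t.toNNReal ω x) ∧
    ∀ w : SpaceW D p q T,
      G w
      + (∫ t in Ioo 0 T, ∫ x in (D : Set (Eu d)),
          inner ℝ (a x (val (u ω t) x) (grad (u ω t) x)) (grad (w.fn t) x))
      + (∫ t in Ioo 0 T, ∫ x in (D : Set (Eu d)), f (val (u ω t) x) * val (w.fn t) x)
      = η ω w
  minimality : ∀ᵐ ω ∂P, MinimalityCondition (u ω) (η ω) (μ ω)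

end solution

end ObstacleProblem

end

noncomputable section

namespace ObstacleProblem

/-! ### Energy identity for right-continuous paths over a pivot space -/

section energy

/-! The noise is additive, so it cancels in the difference `z = u - v`, and the rest is a pathwise
deterministic argument. With `A` the diffusion operator, `B` the reaction operator and `ζ`, `ζ'` the
reflections in `L^q(0,T; W^{-1,q}(D))`, one has `∂_t z = -(A u - A v) - (B u - B v) + ζ - ζ'`.
Testing with `z` gives half the growth of `‖z‖²`. Since `a` does not depend on its second variable,
the term with `A` is dissipative by (A1); the term with `B` is at most `L ‖z‖²`. The reflections
have a good sign: `⟨ζ, u⟩ = 0 = ⟨ζ', v⟩`, while `⟨ζ, v⟩` and `⟨ζ', u⟩` are nonnegative because `u`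
and `v` are, so `⟨ζ - ζ', u - v⟩ ≤ 0`. Grönwall's inequality yields the constant `exp (T * L)`.

Two points need real work. The first is the energy equality, because `z` is given only as a
right-continuous path in `L²(D)`. A du Bois-Reymond argument turns the weak equation into an
integral identity for all times (`inner_sub_eq_integral`). Then `energy_identity` writes `‖y(r+h)‖²
- ‖y(r)‖²` as the inner product of the increment with the sum, averages over `h`, and uses
continuity of translations in `L^p` and `L^q`. Applied to `y - y(s)` at well chosen times `s`, the
same identity bounds the oscillation, which gives continuity on `(0,T)` and a limit at `T`
(`exists_continuous_extension`).

The second is the meaning of `η(u) = 0`. The reflection is at once a measure `μ` and a functional,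
and minimality may be stated through a quasi everywhere defined representative. Nonnegativity of `μ`
passes to `ζ(t)` for a.e. `t` (`ae_nonneg_apply_of_nonneg`), because nonnegative elements of
`W_0^{1,p}(D)` are limits of nonnegative test functions. This positivity bounds the `μ`-measure of
an open set by the pairing of `ζ` with any majorant of its indicator. Hence `μ` does not charge sets
of capacity zero, and a Chebyshev and Borel-Cantelli argument identifies the integral of the
representative with the duality pairing (`setIntegral_qeRepr_eq`). The pairing is an integral of a
nonnegative function of time, so it vanishes at a.e. time. -/

theorem tendsto_eLpNorm_translate {E : Type*} [NormedAddCommGroup E] {p : ℝ≥0∞} [Fact (1 ≤ p)]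
    (hp : p ≠ ∞) {f : ℝ → E} (hf : MemLp f p volume) :
    Tendsto (fun σ => eLpNorm (fun r => f (r + σ) - f r) p volume) (𝓝 0) (𝓝 0) := by
  let g : ℝ → C(ℝ, ℝ) := fun σ => ⟨fun r => r + σ, by fun_prop⟩
  -- Currying joint continuity of addition gives continuity of `σ ↦ (r ↦ r + σ)` in the compact-open
  -- topology, under which composition with measure preserving maps is continuous in `L^p` for
  -- finite `p`.
  have hg : Continuous g :=
    (ContinuousMap.mk (fun a : ℝ × ℝ => a.2 + a.1) (by fun_prop)).curry.continuous
  have hgm : ∀ σ, MeasurePreserving (g σ) volume volume := fun σ =>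
    measurePreserving_add_right volume σ
  have h0 : Lp.compMeasurePreserving (g 0) (hgm 0) (hf.toLp f) = hf.toLp f := by
    rw [Lp.toLp_compMeasurePreserving hf (hgm 0)]
    congr 1
    ext r; simp [g]
  have h := Filter.Tendsto.compMeasurePreservingLp
    (tendsto_const_nhds (x := hf.toLp f)) (hg.tendsto 0) hgm (hgm 0) hp
  rw [h0, tendsto_iff_edist_tendsto_0] at h
  refine h.congr fun σ => ?_
  rw [Lp.toLp_compMeasurePreserving hf (hgm σ), Lp.edist_toLp_toLp]
  rfl

variable {V H : Type*} [NormedAddCommGroup V] [NormedSpace ℝ V] [NormedAddCommGroup H]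
  [InnerProductSpace ℝ H] {p q : ℝ≥0∞} [p.HolderConjugate q]

theorem integrable_pairing {α : Type*} [MeasurableSpace α] {μ : Measure α}
    {f : α → StrongDual ℝ V} {g : α → V} (hf : MemLp f q μ) (hg : MemLp g p μ) :
    Integrable (fun r => f r (g r)) μ := by
  rw [← memLp_one_iff_integrable]
  have : q.HolderConjugate p := ENNReal.HolderConjugate.symm
  exact (ContinuousLinearMap.id ℝ (StrongDual ℝ V)).memLp_of_bilin 1 hf hg

theorem lintegral_pairing_le {α : Type*} [MeasurableSpace α] {μ : Measure α}
    {f : α → StrongDual ℝ V} {g : α → V} (hf : AEStronglyMeasurable f μ)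
    (hg : AEStronglyMeasurable g μ) :
    ∫⁻ r, ‖f r (g r)‖ₑ ∂μ ≤ eLpNorm f q μ * eLpNorm g p μ := by
  have : q.HolderConjugate p := ENNReal.HolderConjugate.symm
  have h := eLpNorm_le_eLpNorm_mul_eLpNorm_of_nnnorm (p := q) (q := p) (r := 1) hf hg
    (fun (a : StrongDual ℝ V) (b : V) => a b) 1 (Eventually.of_forall fun x => by
      simpa using (f x).le_opNNNorm (g x))
  rwa [eLpNorm_one_eq_lintegral_enorm, ENNReal.coe_one, one_mul] at h

theorem norm_setIntegral_pairing_le {α : Type*} [MeasurableSpace α] {μ : Measure α}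
    {f : α → StrongDual ℝ V} {g : α → V} (hf : MemLp f q μ)
    (hg : MemLp g p μ) (s : Set α) :
    ‖∫ r in s, f r (g r) ∂μ‖ ≤ (eLpNorm f q μ).toReal * (eLpNorm g p μ).toReal := by
  rw [← ENNReal.toReal_mul]
  refine (norm_integral_le_lintegral_norm _).trans ?_
  refine ENNReal.toReal_mono (ENNReal.mul_ne_top hf.2.ne hg.2.ne) ?_
  simp_rw [ofReal_norm]
  exact (setLIntegral_le_lintegral _ _).trans (lintegral_pairing_le hf.1 hg.1)

theorem memLp_translate {E : Type*} [NormedAddCommGroup E] {p : ℝ≥0∞} {f : ℝ → E}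
    (hf : MemLp f p volume) (σ : ℝ) : MemLp (fun r => f (r + σ)) p volume :=
  hf.comp_measurePreserving (measurePreserving_add_right volume σ)

theorem eLpNorm_translate {E : Type*} [NormedAddCommGroup E] {p : ℝ≥0∞} {f : ℝ → E}
    (hf : AEStronglyMeasurable f volume) (σ : ℝ) :
    eLpNorm (fun r => f (r + σ)) p volume = eLpNorm f p volume :=
  eLpNorm_comp_measurePreserving hf (measurePreserving_add_right volume σ)

/-- The inner integrals of the difference quotient of the energy converge. -/
theorem tendsto_translated_pairing [Fact (1 ≤ p)] [Fact (1 ≤ q)] (hp : p ≠ ∞) (hq : q ≠ ∞)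
    {Z : ℝ → V} {ζ : ℝ → StrongDual ℝ V} (hZ : MemLp Z p volume) (hζ : MemLp ζ q volume)
    (s : Set ℝ) {ε : ℝ} (hε : 0 < ε) :
    ∃ δ > 0, ∀ h σ, |h| < δ → |σ| < δ →
      ‖(∫ r in s, ζ (r + σ) (Z (r + h) + Z r)) - 2 * ∫ r in s, ζ r (Z r)‖ ≤ ε := by
  have h1 := tendsto_eLpNorm_translate hp hZ
  have h2 := tendsto_eLpNorm_translate hq hζ
  replace h1 := (ENNReal.tendsto_toReal_iff (fun σ => ((memLp_translate hZ σ).sub hZ).2.ne)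
    (by simp)).2 h1
  replace h2 := (ENNReal.tendsto_toReal_iff (fun σ => ((memLp_translate hζ σ).sub hζ).2.ne)
    (by simp)).2 h2
  set a := (eLpNorm Z p volume).toReal
  set b := (eLpNorm ζ q volume).toReal
  have ha : 0 ≤ a := ENNReal.toReal_nonneg
  have hb : 0 ≤ b := ENNReal.toReal_nonneg
  have e1 : 0 < ε / (2 * (b + 1)) := by positivity
  have e2 : 0 < ε / (2 * (2 * a + 1)) := by positivity
  obtain ⟨δ₁, hδ₁, H1⟩ := Metric.eventually_nhds_iff.1 (h1.eventually (gt_mem_nhds (by simpa using e1)))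
  obtain ⟨δ₂, hδ₂, H2⟩ := Metric.eventually_nhds_iff.1 (h2.eventually (gt_mem_nhds (by simpa using e2)))
  refine ⟨min δ₁ δ₂, lt_min hδ₁ hδ₂, fun h σ hh hσ => ?_⟩
  have H1' := H1 (y := h) (by simpa using hh.trans_le (min_le_left _ _))
  have H2' := H2 (y := σ) (by simpa using hσ.trans_le (min_le_right _ _))
  have hZh := memLp_translate hZ h
  have hζσ := memLp_translate hζ σ
  -- The first term carries the cost of translating `ζ` by `σ`, the second that of translating `Z`
  -- by `h`. The two shifts are independent, so the bound is uniform in `σ`.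
  have eq : (∫ r in s, ζ (r + σ) (Z (r + h) + Z r)) - 2 * ∫ r in s, ζ r (Z r)
      = (∫ r in s, (ζ (r + σ) - ζ r) (Z (r + h) + Z r)) + ∫ r in s, ζ r (Z (r + h) - Z r) := by
    rw [← integral_const_mul, ← integral_sub, ← integral_add]
    · congr 1; ext r; simp only [map_add, map_sub, _root_.sub_apply]; ring
    · exact (integrable_pairing (hζσ.sub hζ) (hZh.add hZ)).restrict
    · exact (integrable_pairing hζ (hZh.sub hZ)).restrict
    · exact (integrable_pairing hζσ (hZh.add hZ)).restrict
    · exact ((integrable_pairing hζ hZ).const_mul 2).restrict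
  rw [eq]
  have n1 := norm_setIntegral_pairing_le (hζσ.sub hζ) (hZh.add hZ) s
  have n2 := norm_setIntegral_pairing_le hζ (hZh.sub hZ) s
  have n3 : (eLpNorm ((fun r => Z (r + h)) + Z) p volume).toReal ≤ 2 * a := by
    have := eLpNorm_add_le hZh.1 hZ.1 (Fact.out : 1 ≤ p)
    rw [eLpNorm_translate hZ.1] at this
    have := ENNReal.toReal_mono (by simp [hZ.2.ne]) this
    rw [ENNReal.toReal_add hZ.2.ne hZ.2.ne] at this
    linarith
  refine (norm_add_le _ _).trans ((add_le_add n1 n2).trans ?_)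
  have k1 : (eLpNorm ((fun r => ζ (r + σ)) - ζ) q volume).toReal *
      (eLpNorm ((fun r => Z (r + h)) + Z) p volume).toReal ≤ ε / (2 * (2 * a + 1)) * (2 * a) :=
    mul_le_mul H2'.le n3 ENNReal.toReal_nonneg e2.le
  have k2 : b * (eLpNorm ((fun r => Z (r + h)) - Z) p volume).toReal ≤ b * (ε / (2 * (b + 1))) :=
    mul_le_mul_of_nonneg_left H1'.le hb
  have k3 : ε / (2 * (2 * a + 1)) * (2 * a) ≤ ε / 2 := by
    rw [div_mul_eq_mul_div, div_le_div_iff₀ (by positivity) (by positivity)]; nlinarith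
  have k4 : b * (ε / (2 * (b + 1))) ≤ ε / 2 := by
    rw [← mul_div_assoc, div_le_div_iff₀ (by positivity) (by positivity)]; nlinarith
  linarith


/-- Right averages converge. -/
theorem tendsto_average_right {N : ℝ → ℝ} {t b : ℝ} (htb : t < b)
    (hN : IntegrableOn N (Ioo t b) volume)
    (hc : ContinuousWithinAt N (Ioi t) t) :
    Tendsto (fun h => h⁻¹ * ∫ r in t..(t + h), N r) (𝓝[>] 0) (𝓝 (N t)) := by
  have hm : StronglyMeasurableAtFilter N (𝓝[>] t) volume :=
    ⟨Ioo t b, Ioo_mem_nhdsGT htb, hN.aestronglyMeasurable⟩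
  have h := intervalIntegral.integral_hasDerivWithinAt_right (a := t) (b := t) (f := N)
    (s := Ici t) (t := Ioi t) (by simp) hm hc
  replace h := (hasDerivWithinAt_iff_tendsto_slope' self_notMem_Ioi).1 h.Ioi_of_Ici
  have hmap : Tendsto (fun h : ℝ => t + h) (𝓝[>] 0) (𝓝[>] t) := by
    refine tendsto_nhdsWithin_iff.2 ⟨?_, ?_⟩
    · have : Tendsto (fun h : ℝ => t + h) (𝓝 0) (𝓝 (t + 0)) :=
        (continuous_const.add continuous_id).tendsto 0
      rw [add_zero] at this
      exact this.mono_left nhdsWithin_le_nhds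
    · filter_upwards [self_mem_nhdsWithin] with h hh
      simpa using hh
  refine (h.comp hmap).congr fun h => ?_
  simp [slope_def_field, div_eq_inv_mul]

/-- The energy identity for a function with values in `V` whose derivative has values in the dual
of `V`, with respect to the pivot space `H`. -/
theorem energy_identity [Fact (1 ≤ p)] [Fact (1 ≤ q)] (hp : p ≠ ∞) (hq : q ≠ ∞)
    (j : V →L[ℝ] H) {T : ℝ} {y : ℝ → H} {Z : ℝ → V} {ζ : ℝ → StrongDual ℝ V}
    (hZm : StronglyMeasurable Z) (hζm : StronglyMeasurable ζ)
    (hZ : MemLp Z p volume) (hζ : MemLp ζ q volume) (hZ2 : MemLp Z 2 volume)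
    (hyZ : ∀ᵐ t, t ∈ Ioo 0 T → y t = j (Z t))
    (hy : ∀ t ∈ Ico 0 T, ContinuousWithinAt y (Ioi t) t)
    (hder : ∀ s t, 0 ≤ s → s ≤ t → t < T → ∀ w, inner ℝ (y t - y s) (j w) = ∫ r in s..t, ζ r w)
    {s t : ℝ} (hs : 0 ≤ s) (hst : s ≤ t) (htT : t < T) :
    ‖y t‖ ^ 2 - ‖y s‖ ^ 2 = 2 * ∫ r in s..t, ζ r (Z r) := by
  set N : ℝ → ℝ := fun r => ‖y r‖ ^ 2 with hNdef
  have hN : IntegrableOn N (Ioo 0 T) volume := by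
    have h1 : Integrable (fun r => ‖j (Z r)‖ ^ 2) volume :=
      (memLp_two_iff_integrable_sq_norm (j.comp_memLp' hZ2).1).1 (j.comp_memLp' hZ2)
    refine (h1.integrableOn (s := Ioo 0 T)).congr ?_
    rw [EventuallyEq, ae_restrict_iff' measurableSet_Ioo]
    filter_upwards [hyZ] with r hr hr'
    simp [N, hr hr']
  have hNc : ∀ r ∈ Ico 0 T, ContinuousWithinAt N (Ioi r) r := fun r hr => ((hy r hr).norm).pow 2
  have hNi : ∀ a b, 0 ≤ a → 0 ≤ b → a < T → b < T → IntervalIntegrable N volume a b := by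
    intro a b ha hb haT hbT
    rw [intervalIntegrable_iff]
    rw [← integrableOn_Ioc_iff_integrableOn_Ioo] at hN
    refine hN.mono_set ?_
    rw [uIoc]
    exact Ioc_subset_Ioc (le_min ha hb) (max_le haT.le hbT.le)
  -- Right continuity recovers `N t` and `N s` as limits of averages over `(t, t + h)` and `(s, s +
  -- h)`; it remains to compute the same limit from the equation.
  have lim : Tendsto (fun h => h⁻¹ * (∫ r in t..(t + h), N r) - h⁻¹ * ∫ r in s..(s + h), N r)
      (𝓝[>] 0) (𝓝 (N t - N s)) :=
    (tendsto_average_right htT (hN.mono_set (Ioo_subset_Ioo_left (hs.trans hst)))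
      (hNc t ⟨hs.trans hst, htT⟩)).sub
    (tendsto_average_right (hst.trans_lt htT) (hN.mono_set (Ioo_subset_Ioo_left hs))
      (hNc s ⟨hs, hst.trans_lt htT⟩))
  set I := ∫ r in s..t, ζ r (Z r) with hI
  refine tendsto_nhds_unique lim ?_
  rw [Metric.tendsto_nhds]
  intro ε hε
  obtain ⟨δ, hδ, H⟩ := tendsto_translated_pairing hp hq hZ hζ (Ioc s t) (half_pos hε)
  have hsmall : ∀ᶠ h in 𝓝[>] (0 : ℝ), h < min δ (T - t) :=
    nhdsWithin_le_nhds (gt_mem_nhds (lt_min hδ (by linarith)))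
  filter_upwards [hsmall, self_mem_nhdsWithin] with h hh hpos
  have hpos : 0 < h := hpos
  have hhδ : h < δ := hh.trans_le (min_le_left _ _)
  have hhT : t + h < T := by linarith [hh.trans_le (min_le_right δ (T - t))]
  have hZh := memLp_translate hZ h
  set F : ℝ → ℝ → ℝ := fun r σ => ζ (r + σ) (Z (r + h) + Z r) with hF
  -- After shifting, the difference of averages is an integral of `N (r + h) - N r`, which equals
  -- `⟨y (r + h) - y r, y (r + h) + y r⟩`. For a.e. `r` the sum is `j (Z (r + h) + Z r)`, an
  -- admissible test vector, so the increment can be replaced by an integral of `ζ`.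
  have key : (∫ r in t..(t + h), N r) - ∫ r in s..(s + h), N r
      = ∫ r in s..t, ∫ σ in (0 : ℝ)..h, F r σ := by
    have e1 : (∫ r in t..(t + h), N r) - ∫ r in s..(s + h), N r
        = ∫ r in s..t, (N (r + h) - N r) := by
      have i1 : IntervalIntegrable (fun r => N (r + h)) volume s t := by
        have := (hNi (s + h) (t + h) (by linarith) (by linarith) (by linarith) hhT).comp_add_right
          (c := h)
        simpa using this
      rw [intervalIntegral.integral_sub i1 (hNi s t hs (hs.trans hst) (by linarith) htT),
        intervalIntegral.integral_comp_add_right,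
        intervalIntegral.integral_interval_sub_interval_comm'
          (hNi t (t + h) (by linarith) (by linarith) (by linarith) (by linarith))
          (hNi s (s + h) (by linarith) (by linarith) (by linarith) (by linarith))
          (hNi t s (by linarith) (by linarith) (by linarith) (by linarith))]
    rw [e1]
    refine intervalIntegral.integral_congr_ae ?_
    filter_upwards [hyZ, (measurePreserving_add_right volume h).quasiMeasurePreserving.ae hyZ]
      with r h1 h2 hr
    rw [uIoc_of_le hst] at hr
    have hr0 : 0 < r := hs.trans_lt hr.1
    have hrT : r + h < T := by linarith [hr.2]
    have y1 := h1 ⟨hr0, by linarith⟩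
    have y2 := h2 ⟨by linarith, hrT⟩
    have d := hder r (r + h) hr0.le (by linarith) hrT (Z (r + h) + Z r)
    have : (∫ σ in (0 : ℝ)..h, F r σ) = ∫ σ in r..(r + h), ζ σ (Z (r + h) + Z r) := by
      rw [hF]
      simp only
      rw [intervalIntegral.integral_comp_add_left (fun x => ζ x (Z (r + h) + Z r)) r, add_zero]
    rw [this, ← d, map_add, ← y1, ← y2, hNdef]
    simp only [inner_sub_left, inner_add_right, real_inner_self_eq_norm_sq,
      real_inner_comm (y r) (y (r + h))]
    ring
  -- Hölder in `r` for fixed `σ` gives a bound independent of `σ`, as the norm of `ζ` is translation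
  -- invariant; this justifies Fubini.
  have hFint : Integrable (Function.uncurry F)
      ((volume.restrict (Ioc s t)).prod (volume.restrict (Ioc 0 h))) := by
    have hm : AEStronglyMeasurable (Function.uncurry F)
        ((volume.restrict (Ioc s t)).prod (volume.restrict (Ioc 0 h))) := by
      have m1 : StronglyMeasurable fun z : ℝ × ℝ => ζ (z.1 + z.2) :=
        hζm.comp_measurable (by fun_prop)
      have m2 : StronglyMeasurable fun z : ℝ × ℝ => Z (z.1 + h) + Z z.1 :=
        (hZm.comp_measurable (by fun_prop)).add (hZm.comp_measurable (by fun_prop))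
      exact (ContinuousLinearMap.id ℝ (StrongDual ℝ V)).aestronglyMeasurable_comp₂
        m1.aestronglyMeasurable m2.aestronglyMeasurable
    refine ⟨hm, ?_⟩
    rw [HasFiniteIntegral, lintegral_prod_symm _ hm.enorm]
    have hb : ∀ σ, ∫⁻ r in Ioc s t, ‖Function.uncurry F (r, σ)‖ₑ
        ≤ eLpNorm ζ q volume * eLpNorm ((fun r => Z (r + h)) + Z) p volume := by
      intro σ
      refine (setLIntegral_le_lintegral _ _).trans ?_
      have := lintegral_pairing_le (p := p) (q := q) (memLp_translate hζ σ).1 (hZh.add hZ).1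
      rwa [eLpNorm_translate hζ.1] at this
    refine (lintegral_mono hb).trans_lt ?_
    rw [lintegral_const]
    exact ENNReal.mul_lt_top (ENNReal.mul_lt_top hζ.2 (hZh.add hZ).2) (by simp)
  have key2 : (∫ r in s..t, ∫ σ in (0 : ℝ)..h, F r σ) - h * (2 * I)
      = ∫ σ in (0 : ℝ)..h, ((∫ r in Ioc s t, F r σ) - 2 * I) := by
    rw [intervalIntegral.integral_sub]
    · simp only [intervalIntegral.integral_of_le hst, intervalIntegral.integral_of_le hpos.le]
      rw [integral_integral_swap hFint]
      simp [hpos.le]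
    · rw [intervalIntegrable_iff_integrableOn_Ioc_of_le hpos.le]
      exact hFint.integral_prod_right
    · simp
  have key3 : ‖(∫ r in s..t, ∫ σ in (0 : ℝ)..h, F r σ) - h * (2 * I)‖ ≤ ε / 2 * |h - 0| := by
    rw [key2]
    refine intervalIntegral.norm_integral_le_of_norm_le_const fun σ hσ => ?_
    rw [uIoc_of_le hpos.le] at hσ
    have := H h σ (by rwa [abs_of_pos hpos]) (by rw [abs_of_pos hσ.1]; linarith [hσ.2])
    rwa [hI, intervalIntegral.integral_of_le hst]
  rw [← mul_sub, key, Real.dist_eq]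
  have : h⁻¹ * (∫ r in s..t, ∫ σ in (0 : ℝ)..h, F r σ) - 2 * I
      = h⁻¹ * ((∫ r in s..t, ∫ σ in (0 : ℝ)..h, F r σ) - h * (2 * I)) := by
    field_simp
  rw [this, abs_mul, abs_of_pos (inv_pos.2 hpos)]
  rw [Real.norm_eq_abs, sub_zero, abs_of_pos hpos] at key3
  calc h⁻¹ * _ ≤ h⁻¹ * (ε / 2 * h) := by gcongr
    _ = ε / 2 := by field_simp
    _ < ε := by linarith

end energy

/-! ### Continuity in the pivot space and Grönwall's inequality -/

section extension

/-- A point at which a function is not larger than its `L^p` average. -/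
theorem exists_enorm_rpow_mul_le {E : Type*} [NormedAddCommGroup E] {Z : ℝ → E}
    (hZ : AEStronglyMeasurable Z volume) (P : ℝ) {a b : ℝ} (hab : a < b) {G : ℝ → Prop}
    (hG : ∀ᵐ s, G s) :
    ∃ s ∈ Ioo a b, G s ∧ ‖Z s‖ₑ ^ P * ENNReal.ofReal (b - a) ≤ ∫⁻ r in Ioo a b, ‖Z r‖ₑ ^ P := by
  have hpos : volume (Ioo a b) ≠ 0 := by simpa using hab
  have hfin : volume (Ioo a b) ≠ ∞ := by simp
  have h := measure_le_setLAverage_pos hpos hfin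
    (f := fun r => ‖Z r‖ₑ ^ P) (hZ.enorm.pow_const P).restrict
  obtain ⟨s, ⟨hs, hle⟩, hGs⟩ := ((frequently_ae_iff.2 h.ne').and_eventually hG).exists
  refine ⟨s, hs, hGs, ?_⟩
  rw [setLAverage_eq, Real.volume_Ioo] at hle
  exact (ENNReal.le_div_iff_mul_le (Or.inl (by simpa using hab)) (Or.inl (by simp))).1 hle

variable {V H : Type*} [NormedAddCommGroup V] [NormedSpace ℝ V] [NormedAddCommGroup H]
  [InnerProductSpace ℝ H] {p q : ℝ≥0∞} [p.HolderConjugate q]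

/-- The energy identity for `y - y s` reads `‖y t - y s‖² = 2 ∫_s^t ⟨ζ, Z - Z s⟩`, so it suffices
that `Z` and the constant `Z s` both have small `L^p` norm on a short interval around `t₀`. For `Z`
this is absolute continuity of the integral; for the constant, `s` is chosen shortly before `t₀`
where `Z` does not exceed its `L^p` mean. The case `t₀ = T` is included in order to obtain the limit
at the final time. -/
theorem exists_small_oscillation [Fact (1 ≤ p)] [Fact (1 ≤ q)] (hp : p ≠ ∞) (hq : q ≠ ∞)
    (j : V →L[ℝ] H) {T : ℝ} {y : ℝ → H} {Z : ℝ → V} {ζ : ℝ → StrongDual ℝ V}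
    (hZm : StronglyMeasurable Z) (hζm : StronglyMeasurable ζ)
    (hZ : MemLp Z p volume) (hζ : MemLp ζ q volume) (hZ2 : MemLp Z 2 volume)
    (hyZ : ∀ᵐ t, t ∈ Ioo 0 T → y t = j (Z t))
    (hy : ∀ t ∈ Ico 0 T, ContinuousWithinAt y (Ioi t) t)
    (hder : ∀ s t, 0 ≤ s → s ≤ t → t < T → ∀ w, inner ℝ (y t - y s) (j w) = ∫ r in s..t, ζ r w)
    {t₀ : ℝ} (ht₀ : t₀ ∈ Ioc 0 T) {ε : ℝ} (hε : 0 < ε) :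
    ∃ s ∈ Ioo 0 t₀, ∃ δ > 0, ∀ t, s ≤ t → t < t₀ + δ → t < T → ‖y t - y s‖ ≤ ε := by
  set b := (eLpNorm ζ q volume).toReal with hb
  have hb0 : 0 ≤ b := ENNReal.toReal_nonneg
  have hp1 : (1 : ℝ≥0∞) ≤ p := Fact.out
  have hp0 : p ≠ 0 := (one_pos.trans_le hp1).ne'
  have hP1 : 1 ≤ p.toReal := by simpa using ENNReal.toReal_mono hp hp1
  -- Chosen so that `2 * b * (4 * η) ≤ ε ^ 2`: the energy identity gives the factor 2, and the norm
  -- of `Z - Z s` is at most `4 * η`. The `b + 1` avoids division by zero.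
  have hη : 0 < ε ^ 2 / (8 * (b + 1)) := by positivity
  obtain ⟨δ', hδ', H⟩ := hZ.eLpNorm_indicator_le hp1 hp hη
  set η := ε ^ 2 / (8 * (b + 1)) with hηdef
  obtain ⟨δ, hδ, hδt, hδδ'⟩ : ∃ δ > 0, 2 * δ ≤ t₀ ∧ 3 * δ ≤ δ' := by
    refine ⟨min (t₀ / 2) (δ' / 3), lt_min (by linarith [ht₀.1]) (by linarith), ?_, ?_⟩
    · linarith [min_le_left (t₀ / 2) (δ' / 3)]
    · linarith [min_le_right (t₀ / 2) (δ' / 3)]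
  obtain ⟨s, hs, hGs, hle⟩ := exists_enorm_rpow_mul_le hZ.1 p.toReal
    (show t₀ - 2 * δ < t₀ - δ by linarith) hyZ
  have hs0 : 0 < s := by linarith [hs.1]
  have hst₀ : s < t₀ := by linarith [hs.2]
  have hsT : s < T := hst₀.trans_le ht₀.2
  have hys := hGs ⟨hs0, hsT⟩
  set J := Ioo (t₀ - 2 * δ) (t₀ + δ) with hJ
  have hJm : MeasurableSet J := measurableSet_Ioo
  have hJvol : volume J = ENNReal.ofReal (3 * δ) := by
    rw [hJ, Real.volume_Ioo]; congr 1; ring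
  have hB := H J hJm (by rw [hJvol]; exact ENNReal.ofReal_le_ofReal hδδ')
  -- The mean was taken over an interval of length `δ` inside `J`, which has length `3 * δ`; this
  -- costs a factor 3 in the `p`-th power, hence at most 3 in the norm.
  have hc : eLpNorm (J.indicator fun _ => Z s) p volume ≤ 3 * eLpNorm (J.indicator Z) p volume := by
    rw [eLpNorm_indicator_const hJm hp0 hp, eLpNorm_indicator_eq_eLpNorm_restrict hJm,
      eLpNorm_eq_lintegral_rpow_enorm_toReal hp0 hp, hJvol]
    have h3 : ‖Z s‖ₑ ^ p.toReal * ENNReal.ofReal (3 * δ) ≤ 3 * ∫⁻ r in J, ‖Z r‖ₑ ^ p.toReal := by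
      rw [ENNReal.ofReal_mul (by norm_num), mul_left_comm]
      refine mul_le_mul' (by simp) ?_
      have e : t₀ - δ - (t₀ - 2 * δ) = δ := by ring
      rw [e] at hle
      exact hle.trans (lintegral_mono_set (Ioo_subset_Ioo_right (by linarith)))
    calc ‖Z s‖ₑ * ENNReal.ofReal (3 * δ) ^ (1 / p.toReal)
        = (‖Z s‖ₑ ^ p.toReal * ENNReal.ofReal (3 * δ)) ^ (1 / p.toReal) := by
          rw [ENNReal.mul_rpow_of_nonneg _ _ (by positivity), ← ENNReal.rpow_mul,
            mul_one_div_cancel (by positivity), ENNReal.rpow_one]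
      _ ≤ (3 * ∫⁻ r in J, ‖Z r‖ₑ ^ p.toReal) ^ (1 / p.toReal) :=
          ENNReal.rpow_le_rpow h3 (by positivity)
      _ = 3 ^ (1 / p.toReal) * (∫⁻ r in J, ‖Z r‖ₑ ^ p.toReal) ^ (1 / p.toReal) :=
          ENNReal.mul_rpow_of_nonneg _ _ (by positivity)
      _ ≤ 3 * (∫⁻ r in J, ‖Z r‖ₑ ^ p.toReal) ^ (1 / p.toReal) := by
          gcongr
          calc (3 : ℝ≥0∞) ^ (1 / p.toReal) ≤ 3 ^ (1 : ℝ) :=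
                ENNReal.rpow_le_rpow_of_exponent_le (by norm_num)
                  (by rw [div_le_one (by linarith)]; exact hP1)
            _ = 3 := ENNReal.rpow_one _
  refine ⟨s, ⟨hs0, hst₀⟩, δ, hδ, fun t hst htδ htT => ?_⟩
  have hIm : MeasurableSet (Ioo 0 T) := measurableSet_Ioo
  have hcm : ∀ r : ℝ≥0∞, MemLp ((Ioo 0 T).indicator fun _ => Z s) r volume := fun r =>
    memLp_indicator_const r hIm _ (Or.inr (by simp))
  -- The constant is cut off to `(0, T)` to lie in `L^p` and `L²` of the line; only its values there
  -- enter the identity.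
  have E := energy_identity (p := p) (q := q) hp hq j (T := T) (y := fun r => y r - y s)
    (Z := Z - (Ioo 0 T).indicator fun _ => Z s)
    (hZm.sub (stronglyMeasurable_const.indicator hIm)) hζm (hZ.sub (hcm p)) hζ (hZ2.sub (hcm 2))
    (by
      filter_upwards [hyZ] with r hr hr'
      rw [hr hr', hys, Pi.sub_apply, indicator_of_mem hr', map_sub])
    (fun r hr => (hy r hr).sub continuousWithinAt_const)
    (fun a c ha hac hcT w => by rw [← hder a c ha hac hcT w, sub_sub_sub_cancel_right])
    hs0.le hst htT
  simp only [sub_self, norm_zero] at E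
  have hsub : Ioc s t ⊆ J := fun r hr => ⟨by linarith [hs.1, hr.1], by linarith [hr.2]⟩
  have e2 : ∫ r in s..t, ζ r ((Z - (Ioo 0 T).indicator fun _ => Z s) r)
      = ∫ r in Ioc s t, ζ r ((J.indicator Z - J.indicator fun _ => Z s) r) := by
    rw [intervalIntegral.integral_of_le hst]
    refine setIntegral_congr_fun measurableSet_Ioc fun r hr => ?_
    have : r ∈ Ioo 0 T := ⟨hs0.trans hr.1, hr.2.trans_lt htT⟩
    simp [indicator_of_mem this, indicator_of_mem (hsub hr)]
  have hcJ : MemLp (J.indicator fun _ => Z s) p volume :=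
    memLp_indicator_const p hJm _ (Or.inr (by rw [hJvol]; exact ENNReal.ofReal_ne_top))
  have bd := norm_setIntegral_pairing_le hζ ((hZ.indicator hJm).sub hcJ) (Ioc s t)
  rw [← e2] at bd
  have tot : (eLpNorm (J.indicator Z - J.indicator fun _ => Z s) p volume).toReal ≤ 4 * η := by
    refine ENNReal.toReal_le_of_le_ofReal (by positivity) ?_
    calc eLpNorm (J.indicator Z - J.indicator fun _ => Z s) p volume
        ≤ eLpNorm (J.indicator Z) p volume + eLpNorm (J.indicator fun _ => Z s) p volume :=
          eLpNorm_sub_le (hZ.indicator hJm).1 hcJ.1 hp1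
      _ ≤ eLpNorm (J.indicator Z) p volume + 3 * eLpNorm (J.indicator Z) p volume := by gcongr
      _ = 4 * eLpNorm (J.indicator Z) p volume := by ring
      _ ≤ 4 * ENNReal.ofReal η := by gcongr
      _ = ENNReal.ofReal (4 * η) := by rw [ENNReal.ofReal_mul (by norm_num)]; simp
  have fin : ‖y t - y s‖ ^ 2 ≤ ε ^ 2 := by
    have h1 := (le_abs_self _).trans (bd.trans (mul_le_mul_of_nonneg_left tot hb0))
    have h2 : b * (4 * η) * 2 ≤ ε ^ 2 := by
      rw [hηdef]
      have : b * (4 * (ε ^ 2 / (8 * (b + 1)))) * 2 = ε ^ 2 * (b / (b + 1)) := by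
        field_simp; ring
      rw [this]
      exact mul_le_of_le_one_right (by positivity) ((div_le_one (by positivity)).2 (by linarith))
    nlinarith
  exact (sq_le_sq₀ (norm_nonneg _) hε.le).1 fin

/-- The oscillation window begins before `t₀` and ends after it, so comparing two times with the
same `y s` gives two-sided continuity at interior points, and the Cauchy criterion at `T`. At `0`
right continuity suffices. -/
theorem exists_continuous_extension [Fact (1 ≤ p)] [Fact (1 ≤ q)] [CompleteSpace H]
    (hp : p ≠ ∞) (hq : q ≠ ∞)
    (j : V →L[ℝ] H) {T : ℝ} (hT : 0 < T) {y : ℝ → H} {Z : ℝ → V} {ζ : ℝ → StrongDual ℝ V}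
    (hZm : StronglyMeasurable Z) (hζm : StronglyMeasurable ζ)
    (hZ : MemLp Z p volume) (hζ : MemLp ζ q volume) (hZ2 : MemLp Z 2 volume)
    (hyZ : ∀ᵐ t, t ∈ Ioo 0 T → y t = j (Z t))
    (hy : ∀ t ∈ Ico 0 T, ContinuousWithinAt y (Ioi t) t)
    (hder : ∀ s t, 0 ≤ s → s ≤ t → t < T → ∀ w, inner ℝ (y t - y s) (j w) = ∫ r in s..t, ζ r w) :
    ∃ z : ℝ → H, ContinuousOn z (Icc 0 T) ∧ ∀ t ∈ Ico 0 T, z t = y t := by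
  have osc : ∀ {t₀ : ℝ}, t₀ ∈ Ioc 0 T → ∀ {ε : ℝ}, 0 < ε →
      ∃ s ∈ Ioo 0 t₀, ∃ δ > 0, ∀ t, s ≤ t → t < t₀ + δ → t < T → ‖y t - y s‖ ≤ ε :=
    fun ht₀ _ hε => exists_small_oscillation hp hq j hZm hζm hZ hζ hZ2 hyZ hy hder ht₀ hε
  have hcont : ContinuousOn y (Ioo 0 T) := by
    intro t₀ ht₀
    refine ContinuousAt.continuousWithinAt ?_
    rw [Metric.continuousAt_iff']
    intro ε hε
    obtain ⟨s, hs, δ, hδ, h⟩ := osc ⟨ht₀.1, ht₀.2.le⟩ (show 0 < ε / 3 by positivity)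
    have hmem : Ioo s (min (t₀ + δ) T) ∈ 𝓝 t₀ :=
      Ioo_mem_nhds hs.2 (lt_min (by linarith) ht₀.2)
    filter_upwards [hmem] with t ht
    have h1 := h t ht.1.le (ht.2.trans_le (min_le_left _ _)) (ht.2.trans_le (min_le_right _ _))
    have h2 := h t₀ hs.2.le (by linarith) ht₀.2
    rw [dist_eq_norm, show y t - y t₀ = (y t - y s) - (y t₀ - y s) by abel]
    exact (norm_sub_le _ _).trans_lt (by linarith)
  have hlim : ∃ l, Tendsto y (𝓝[<] T) (𝓝 l) := by
    refine cauchy_map_iff_exists_tendsto.1 ?_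
    rw [Metric.cauchy_iff]
    refine ⟨inferInstance, fun ε hε => ?_⟩
    obtain ⟨s, hs, δ, hδ, h⟩ := osc ⟨hT, le_rfl⟩ (show 0 < ε / 3 by positivity)
    refine ⟨y '' Ioo s T, image_mem_map (Ioo_mem_nhdsLT hs.2), ?_⟩
    rintro _ ⟨a, ha, rfl⟩ _ ⟨b, hb, rfl⟩
    have h1 := h a ha.1.le (by linarith [ha.2]) ha.2
    have h2 := h b hb.1.le (by linarith [hb.2]) hb.2
    rw [dist_eq_norm, show y a - y b = (y a - y s) - (y b - y s) by abel]
    exact (norm_sub_le _ _).trans_lt (by linarith)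
  obtain ⟨l, hl⟩ := hlim
  have h0 : Tendsto y (𝓝[>] 0) (𝓝 (y 0)) := hy 0 ⟨le_rfl, hT⟩
  refine ⟨extendFrom (Ioo 0 T) y, continuousOn_Icc_extendFrom_Ioo hcont h0 hl, ?_⟩
  intro t ht
  rcases ht.1.eq_or_lt with rfl | h
  · exact eq_lim_at_left_extendFrom_Ioo hT h0
  · exact extendFrom_extends hcont t ⟨h, ht.2⟩

/-- Grönwall's inequality for the squared norm in integral form. -/
theorem norm_le_exp_mul_of_sq_le_integral {E : Type*} [NormedAddCommGroup E] {z : ℝ → E} {T L : ℝ} (hL : 0 ≤ L)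
    (hz : ContinuousOn z (Icc 0 T))
    (h : ∀ t ∈ Ico 0 T, ‖z t‖ ^ 2 ≤ ‖z 0‖ ^ 2 + 2 * L * ∫ r in (0 : ℝ)..t, ‖z r‖ ^ 2) :
    ∀ t ∈ Icc 0 T, ‖z t‖ ≤ Real.exp (T * L) * ‖z 0‖ := by
  rcases lt_trichotomy T 0 with hT | rfl | hT
  · intro t ht; exact absurd (ht.1.trans ht.2) (not_le.2 hT)
  · intro t ht
    obtain rfl : t = 0 := le_antisymm ht.2 ht.1
    simp
  have hNc : ContinuousOn (fun r => ‖z r‖ ^ 2) (Icc 0 T) := hz.norm.pow 2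
  -- Grönwall is applied to the right-hand side `G`, which is differentiable with `G' = 2 * L * ‖z‖²
  -- ≤ 2 * L * G`. Taking square roots at the end halves the exponent, and `t = T` follows by
  -- continuity.
  set G : ℝ → ℝ := fun t => ‖z 0‖ ^ 2 + 2 * L * ∫ r in (0 : ℝ)..t, ‖z r‖ ^ 2 with hG
  have hNi : IntervalIntegrable (fun r => ‖z r‖ ^ 2) volume 0 T :=
    (hNc.mono (by rw [uIcc_of_le hT.le])).intervalIntegrable
  have hGc : ContinuousOn G (Icc 0 T) := by
    refine continuousOn_const.add (continuousOn_const.mul ?_)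
    have := intervalIntegral.continuousOn_primitive_interval' hNi left_mem_uIcc
    rwa [uIcc_of_le hT.le] at this
  have hGd : ∀ t ∈ Ico 0 T, HasDerivWithinAt G (2 * L * ‖z t‖ ^ 2) (Ici t) t := by
    intro t ht
    refine HasDerivWithinAt.const_add _ (HasDerivWithinAt.const_mul _ ?_)
    have hsub : Ioo t T ⊆ Icc 0 T := fun r hr => ⟨ht.1.trans hr.1.le, hr.2.le⟩
    refine intervalIntegral.integral_hasDerivWithinAt_right
      (hNi.mono_set ?_) (t := Ioi t) ⟨Ioo t T, Ioo_mem_nhdsGT ht.2, ?_⟩ ?_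
    · rw [uIcc_of_le hT.le, uIcc_of_le ht.1]; exact Icc_subset_Icc_right ht.2.le
    · exact (hNc.mono hsub).aestronglyMeasurable measurableSet_Ioo
    · refine (hNc t ⟨ht.1, ht.2.le⟩).mono_of_mem_nhdsWithin ?_
      exact mem_of_superset (Ioo_mem_nhdsGT ht.2) hsub
  have hGnn : ∀ t ∈ Icc 0 T, 0 ≤ G t := fun t ht => by
    have : 0 ≤ ∫ r in (0 : ℝ)..t, ‖z r‖ ^ 2 :=
      intervalIntegral.integral_nonneg ht.1 fun r _ => by positivity
    positivity
  have gr := norm_le_gronwallBound_of_norm_deriv_right_le (δ := ‖z 0‖ ^ 2) (K := 2 * L) (ε := 0)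
    hGc hGd (by simp [hG]) (fun t ht => by
      rw [Real.norm_of_nonneg (by positivity), Real.norm_of_nonneg (hGnn t ⟨ht.1, ht.2.le⟩),
        add_zero]
      exact mul_le_mul_of_nonneg_left (h t ht) (by positivity))
  have bound : ∀ t ∈ Ico 0 T, ‖z t‖ ≤ Real.exp (T * L) * ‖z 0‖ := by
    intro t ht
    have h1 := gr t ⟨ht.1, ht.2.le⟩
    rw [Real.norm_of_nonneg (hGnn t ⟨ht.1, ht.2.le⟩), gronwallBound_ε0] at h1
    have h2 : ‖z t‖ ^ 2 ≤ (Real.exp (T * L) * ‖z 0‖) ^ 2 := by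
      refine (h t ht).trans (h1.trans ?_)
      rw [mul_pow, ← Real.exp_nat_mul, mul_comm]
      refine mul_le_mul_of_nonneg_right (Real.exp_le_exp.2 ?_) (by positivity)
      push_cast
      nlinarith [mul_le_mul_of_nonneg_right ht.2.le hL]
    exact (sq_le_sq₀ (norm_nonneg _) (by positivity)).1 h2
  have hcl : closure (Ico 0 T) = Icc 0 T := closure_Ico hT.ne
  intro t ht
  have : ContinuousWithinAt z (Ico 0 T) t := (hz t ht).mono Ico_subset_Icc_self
  have : (𝓝[Ico 0 T] t).NeBot := mem_closure_iff_nhdsWithin_neBot.1 (hcl ▸ ht)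
  exact le_of_tendsto (‹ContinuousWithinAt z (Ico 0 T) t›.norm)
    (eventually_nhdsWithin_of_forall bound)

/-- Continuity in `H` and stability for a function with values in `V` whose derivative has values
in the dual of `V` and is dissipative up to a multiple of the squared norm. -/
theorem exists_continuous_extension_norm_le [Fact (1 ≤ p)] [Fact (1 ≤ q)] [CompleteSpace H]
    (hp : p ≠ ∞) (hq : q ≠ ∞)
    (j : V →L[ℝ] H) {T : ℝ} (hT : 0 < T) {y : ℝ → H} {Z : ℝ → V} {ζ : ℝ → StrongDual ℝ V}
    (hZm : StronglyMeasurable Z) (hζm : StronglyMeasurable ζ)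
    (hZ : MemLp Z p volume) (hζ : MemLp ζ q volume) (hZ2 : MemLp Z 2 volume)
    (hyZ : ∀ᵐ t, t ∈ Ioo 0 T → y t = j (Z t))
    (hy : ∀ t ∈ Ico 0 T, ContinuousWithinAt y (Ioi t) t)
    (hder : ∀ s t, 0 ≤ s → s ≤ t → t < T → ∀ w, inner ℝ (y t - y s) (j w) = ∫ r in s..t, ζ r w)
    {L : ℝ} (hL : 0 ≤ L) (hdiss : ∀ᵐ t, t ∈ Ioo 0 T → ζ t (Z t) ≤ L * ‖j (Z t)‖ ^ 2) :
    ∃ z : ℝ → H, ContinuousOn z (Icc 0 T) ∧ (∀ t ∈ Ico 0 T, z t = y t) ∧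
      ∀ t ∈ Icc 0 T, ‖z t‖ ≤ Real.exp (T * L) * ‖y 0‖ := by
  obtain ⟨z, hzc, hzy⟩ := exists_continuous_extension hp hq j hT hZm hζm hZ hζ hZ2 hyZ hy hder
  refine ⟨z, hzc, hzy, ?_⟩
  rw [← hzy 0 ⟨le_rfl, hT⟩]
  refine norm_le_exp_mul_of_sq_le_integral hL hzc fun t ht => ?_
  have E := energy_identity (p := p) (q := q) hp hq j hZm hζm hZ hζ hZ2 hyZ hy hder
    le_rfl ht.1 ht.2
  have hi : IntervalIntegrable (fun r => ‖z r‖ ^ 2) volume 0 t := by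
    refine ((hzc.norm.pow 2).mono ?_).intervalIntegrable
    rw [uIcc_of_le ht.1]; exact Icc_subset_Icc_right ht.2.le
  have mono : ∫ r in (0 : ℝ)..t, ζ r (Z r) ≤ ∫ r in (0 : ℝ)..t, L * ‖z r‖ ^ 2 := by
    refine intervalIntegral.integral_mono_ae_restrict ht.1
      (integrable_pairing hζ hZ).intervalIntegrable (hi.const_mul L) ?_
    have hne : ∀ᵐ r : ℝ, r ≠ 0 := by simp [ae_iff]
    rw [EventuallyLE, ae_restrict_iff' measurableSet_Icc]
    filter_upwards [hyZ, hdiss, hne] with r h1 h2 h0 hr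
    have hr' : r ∈ Ioo 0 T := ⟨hr.1.lt_of_ne h0.symm, hr.2.trans_lt ht.2⟩
    rw [hzy r ⟨hr.1, hr'.2⟩, h1 hr']
    exact h2 hr'
  rw [intervalIntegral.integral_const_mul] at mono
  rw [← hzy t ht, ← hzy 0 ⟨le_rfl, hT⟩] at E
  linarith

end extension

/-! ### Dominated convergence in `L^p` and calculus of test functions -/

variable {d : ℕ}

theorem tendsto_eLpNorm_zero_of_dominated {α E : Type*} [MeasurableSpace α] {μ : Measure α}
    [NormedAddCommGroup E] {p : ℝ≥0∞} (hp0 : p ≠ 0) (hp : p ≠ ∞) {F : ℕ → α → E} {G : α → ℝ}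
    (hF : ∀ n, AEStronglyMeasurable (F n) μ) (hG : MemLp G p μ)
    (hle : ∀ n, ∀ᵐ x ∂μ, ‖F n x‖ ≤ ‖G x‖) (hlim : ∀ᵐ x ∂μ, Tendsto (fun n => F n x) atTop (𝓝 0)) :
    Tendsto (fun n => eLpNorm (F n) p μ) atTop (𝓝 0) := by
  have hP : 0 < p.toReal := ENNReal.toReal_pos hp0 hp
  have h : Tendsto (fun n => ∫⁻ x, ‖F n x‖ₑ ^ p.toReal ∂μ) atTop (𝓝 (∫⁻ _, 0 ∂μ)) := by
    refine tendsto_lintegral_of_dominated_convergence' (fun x => ‖G x‖ₑ ^ p.toReal)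
      (fun n => (hF n).enorm.pow_const _) (fun n => ?_) ?_ ?_
    · filter_upwards [hle n] with x hx
      exact ENNReal.rpow_le_rpow (enorm_le_iff_norm_le.2 hx) hP.le
    · exact (lintegral_rpow_enorm_lt_top_of_eLpNorm_lt_top hp0 hp hG.2).ne
    · filter_upwards [hlim] with x hx
      have h1 := (ENNReal.continuous_rpow_const (y := p.toReal)).tendsto 0
      rw [ENNReal.zero_rpow_of_pos hP] at h1
      refine h1.comp ?_
      have := hx.enorm
      rwa [enorm_zero] at this
  rw [lintegral_zero] at h
  have h1 := (ENNReal.continuous_rpow_const (y := 1 / p.toReal)).tendsto 0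
  rw [ENNReal.zero_rpow_of_pos (by positivity)] at h1
  refine (h1.comp h).congr fun n => ?_
  rw [Function.comp, eLpNorm_eq_lintegral_rpow_enorm_toReal hp0 hp]

section testAlgebra

variable {E : Type*} [NormedAddCommGroup E] [NormedSpace ℝ E] {U : Opens E}

/-- Composition of a test function with a smooth function vanishing at zero. -/
def compTest (b : ℝ → ℝ) (hb : ContDiff ℝ (⊤ : ℕ∞) b) (hb0 : b 0 = 0) (φ : 𝓓(U, ℝ)) : 𝓓(U, ℝ) where
  toFun := b ∘ φ
  contDiff' := hb.comp φ.contDiff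
  hasCompactSupport' := φ.hasCompactSupport.comp_left hb0
  tsupport_subset' := (closure_mono (Function.support_comp_subset hb0 _)).trans φ.tsupport_subset

@[simp]
theorem compTest_apply (b : ℝ → ℝ) (hb : ContDiff ℝ (⊤ : ℕ∞) b) (hb0 : b 0 = 0) (φ : 𝓓(U, ℝ)) (x : E) :
    compTest b hb hb0 φ x = b (φ x) := rfl

theorem differentiable_test (φ : 𝓓(U, ℝ)) : Differentiable ℝ φ :=
  φ.contDiff.differentiable (by simp)

theorem eq_zero_of_notMem {φ : 𝓓(U, ℝ)} {x : E} (hx : x ∉ U) : φ x = 0 :=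
  image_eq_zero_of_notMem_tsupport fun h => hx (φ.tsupport_subset h)

end testAlgebra

section gradient

variable {D : Opens (Eu d)}

theorem gradient_test_add (φ ψ : 𝓓(D, ℝ)) :
    gradient (φ + ψ : 𝓓(D, ℝ)) = gradient φ + gradient ψ := by
  ext1 x
  simp only [gradient, Pi.add_apply, ← map_add]
  congr 1
  rw [FunLike.coe_add, fderiv_add (differentiable_test φ x) (differentiable_test ψ x)]

theorem gradient_test_smul (c : ℝ) (φ : 𝓓(D, ℝ)) :
    gradient (c • φ : 𝓓(D, ℝ)) = c • gradient φ := by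
  ext1 x
  simp only [gradient, Pi.smul_apply]
  rw [FunLike.coe_smul, fderiv_const_smul (differentiable_test φ x), map_smulₛₗ]
  simp

theorem gradient_compTest (b : ℝ → ℝ) (hb : ContDiff ℝ (⊤ : ℕ∞) b) (hb0 : b 0 = 0) (φ : 𝓓(D, ℝ))
    (x : Eu d) : gradient (compTest b hb hb0 φ) x = deriv b (φ x) • gradient φ x := by
  have h : fderiv ℝ (compTest b hb hb0 φ) x = deriv b (φ x) • fderiv ℝ φ x :=
    ((hb.differentiable (by simp) (φ x)).hasDerivAt.comp_hasFDerivAt x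
      (differentiable_test φ x).hasFDerivAt).fderiv
  rw [gradient, h, map_smulₛₗ, gradient]
  simp

/-- Integration by parts for test functions. -/
theorem integral_smul_gradient (φ ψ : 𝓓(D, ℝ)) :
    ∫ x in (D : Set (Eu d)), ψ x • gradient φ x = - ∫ x in (D : Set (Eu d)), φ x • gradient ψ x := by
  have full : ∀ φ ψ : 𝓓(D, ℝ), ∫ x in (D : Set (Eu d)), ψ x • gradient φ x
      = ∫ x, ψ x • gradient φ x := fun φ ψ =>
    setIntegral_eq_integral_of_forall_compl_eq_zero fun x hx => by
      rw [eq_zero_of_notMem hx, zero_smul]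
  have int : ∀ φ ψ : 𝓓(D, ℝ), Integrable (fun x => ψ x • gradient φ x) := fun φ ψ => by
    have hc : Continuous (gradient φ) :=
      (InnerProductSpace.toDual ℝ (Eu d)).symm.continuous.comp
        (φ.contDiff.continuous_fderiv (by simp))
    exact (ψ.continuous.smul hc).integrable_of_hasCompactSupport ψ.hasCompactSupport.smul_right
  have key : ∀ φ ψ : 𝓓(D, ℝ), ∀ e, inner ℝ e (∫ x, ψ x • gradient φ x)
      = ∫ x, ψ x * fderiv ℝ φ x e := fun φ ψ e => by
    rw [← integral_inner (int φ ψ)]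
    congr 1; ext x
    rw [inner_smul_right, real_inner_comm, gradient, InnerProductSpace.toDual_symm_apply]
  have hi : ∀ φ ψ : 𝓓(D, ℝ), ∀ e, Integrable fun x => ψ x * fderiv ℝ φ x e := fun φ ψ e => by
    have hc : Continuous fun x => fderiv ℝ φ x e :=
      (φ.contDiff.continuous_fderiv (by simp)).clm_apply continuous_const
    exact (ψ.continuous.mul hc).integrable_of_hasCompactSupport ψ.hasCompactSupport.mul_right
  rw [full, full]
  refine ext_inner_left ℝ fun e => ?_
  rw [inner_neg_right, key, key,
    integral_mul_fderiv_eq_neg_fderiv_mul_of_integrable (f := ψ) (g := φ)]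
  · congr 1; congr 1; ext x; ring
  · refine (hi ψ φ e).congr (Eventually.of_forall fun x => ?_); simp only; ring
  · exact hi φ ψ e
  · exact (ψ.continuous.mul φ.continuous).integrable_of_hasCompactSupport
      ψ.hasCompactSupport.mul_right
  · exact fun x _ => differentiable_test ψ x
  · exact fun x _ => differentiable_test φ x

end gradient

/-! ### The space `W_0^{1,p}(D)`: components, density, uniqueness of the gradient -/

section sobolev

variable {D : Opens (Eu d)} {p : ℝ≥0∞} [Fact (1 ≤ p)]

omit [Fact (1 ≤ p)] in
theorem testPair_add (φ ψ : 𝓓(D, ℝ)) :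
    testPair D p (φ + ψ) = testPair D p φ + testPair D p ψ := by
  rw [testPair, testPair, testPair, ← WithLp.toLp_add]
  congr 1
  refine Prod.ext ?_ ?_
  · exact (MemLp.toLp_add (memLp_test D p φ) (memLp_test D p ψ))
  · simp only [Prod.snd_add]
    rw [← MemLp.toLp_add]
    exact MemLp.toLp_congr _ _ (by rw [gradient_test_add])

omit [Fact (1 ≤ p)] in
theorem testPair_smul (c : ℝ) (φ : 𝓓(D, ℝ)) :
    testPair D p (c • φ) = c • testPair D p φ := by
  rw [testPair, testPair, ← WithLp.toLp_smul]
  congr 1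
  refine Prod.ext ?_ ?_
  · exact (MemLp.toLp_const_smul c (memLp_test D p φ))
  · simp only [Prod.smul_snd]
    rw [← MemLp.toLp_const_smul]
    exact MemLp.toLp_congr _ _ (by rw [gradient_test_smul])

/-- `testPair` as a linear map. -/
def testPairₗ (D : Opens (Eu d)) (p : ℝ≥0∞) [Fact (1 ≤ p)] :
    𝓓(D, ℝ) →ₗ[ℝ] WithLp p (Lp ℝ p (volD D) × Lp (Eu d) p (volD D)) where
  toFun := testPair D p
  map_add' := testPair_add
  map_smul' := testPair_smul

/-- The inclusion of `W_0^{1,p}(D)` into `L^p(D) × L^p(D)^d`. -/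
def toPair (D : Opens (Eu d)) (p : ℝ≥0∞) [Fact (1 ≤ p)] :
    W0 D p →ₗᵢ[ℝ] WithLp p (Lp ℝ p (volD D) × Lp (Eu d) p (volD D)) :=
  (W0Sub D p).subtypeₗᵢ

/-- The test pairs already form a subspace, so taking the span adds nothing. -/
theorem mem_W0Sub_iff {x : WithLp p (Lp ℝ p (volD D) × Lp (Eu d) p (volD D))} :
    x ∈ W0Sub D p ↔ x ∈ closure (range (testPair D p)) := by
  have : Submodule.span ℝ (range (testPair D p)) = LinearMap.range (testPairₗ D p) :=
    le_antisymm (Submodule.span_le.2 (by rintro _ ⟨φ, rfl⟩; exact ⟨φ, rfl⟩))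
      (by rintro _ ⟨φ, rfl⟩; exact Submodule.subset_span ⟨φ, rfl⟩)
  rw [W0Sub, this, ← SetLike.mem_coe, Submodule.topologicalClosure_coe]
  rfl

theorem denseRange_ofTest : DenseRange (ofTest D p) := by
  intro w
  have h := mem_W0Sub_iff.1 w.2
  rw [Metric.mem_closure_iff] at h ⊢
  intro ε hε
  obtain ⟨_, ⟨φ, rfl⟩, hφ⟩ := h ε hε
  exact ⟨_, ⟨φ, rfl⟩, hφ⟩

/-- The values of `w ∈ W_0^{1,p}(D)` as a continuous linear map. -/
def valL (D : Opens (Eu d)) (p : ℝ≥0∞) [Fact (1 ≤ p)] : W0 D p →L[ℝ] Lp ℝ p (volD D) :=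
  (ContinuousLinearMap.fst ℝ (Lp ℝ p (volD D)) (Lp (Eu d) p (volD D))) ∘L
    (WithLp.prodContinuousLinearEquiv p ℝ _ _).toContinuousLinearMap ∘L
    (toPair D p).toContinuousLinearMap

/-- The gradient of `w ∈ W_0^{1,p}(D)` as a continuous linear map. -/
def gradL (D : Opens (Eu d)) (p : ℝ≥0∞) [Fact (1 ≤ p)] : W0 D p →L[ℝ] Lp (Eu d) p (volD D) :=
  (ContinuousLinearMap.snd ℝ (Lp ℝ p (volD D)) (Lp (Eu d) p (volD D))) ∘L
    (WithLp.prodContinuousLinearEquiv p ℝ _ _).toContinuousLinearMap ∘L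
    (toPair D p).toContinuousLinearMap

theorem coe_valL (w : W0 D p) : ⇑(valL D p w) = val w := rfl

theorem coe_gradL (w : W0 D p) : ⇑(gradL D p w) = grad w := rfl

theorem memLp_val (w : W0 D p) : MemLp (val w) p (volD D) := Lp.memLp (valL D p w)

theorem memLp_grad (w : W0 D p) : MemLp (grad w) p (volD D) := Lp.memLp (gradL D p w)

theorem val_ofTest (φ : 𝓓(D, ℝ)) : val (ofTest D p φ) =ᵐ[volD D] φ :=
  (memLp_test D p φ).coeFn_toLp

theorem grad_ofTest (φ : 𝓓(D, ℝ)) : grad (ofTest D p φ) =ᵐ[volD D] gradient φ :=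
  (memLp_gradient_test D p φ).coeFn_toLp

theorem val_add (v w : W0 D p) : val (v + w) =ᵐ[volD D] val v + val w := by
  simpa only [← coe_valL, map_add] using Lp.coeFn_add (valL D p v) (valL D p w)

theorem val_sub (v w : W0 D p) : val (v - w) =ᵐ[volD D] val v - val w := by
  simpa only [← coe_valL, map_sub] using Lp.coeFn_sub (valL D p v) (valL D p w)

theorem val_smul (c : ℝ) (w : W0 D p) : val (c • w) =ᵐ[volD D] c • val w := by
  simpa only [← coe_valL, map_smul] using Lp.coeFn_smul c (valL D p w)

theorem grad_sub (v w : W0 D p) : grad (v - w) =ᵐ[volD D] grad v - grad w := by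
  simpa only [← coe_gradL, map_sub] using Lp.coeFn_sub (gradL D p v) (gradL D p w)

theorem norm_W0_rpow (hp : p ≠ ∞) (w : W0 D p) :
    ‖w‖ = (‖valL D p w‖ ^ p.toReal + ‖gradL D p w‖ ^ p.toReal) ^ (1 / p.toReal) := by
  have hP : 0 < p.toReal := ENNReal.toReal_pos (one_pos.trans_le Fact.out).ne' hp
  exact WithLp.prod_norm_eq_add hP w.1

theorem norm_gradL_le (w : W0 D p) : ‖gradL D p w‖ ≤ ‖w‖ := WithLp.norm_snd_le _ w.1

theorem norm_W0_le_add (w : W0 D p) : ‖w‖ ≤ ‖valL D p w‖ + ‖gradL D p w‖ := by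
  have h : w.1 = WithLp.toLp p (valL D p w, 0) + WithLp.toLp p (0, gradL D p w) := by
    rw [← WithLp.toLp_add, Prod.mk_add_mk, add_zero, zero_add]; rfl
  calc ‖w‖ = ‖w.1‖ := rfl
    _ ≤ _ := by
      rw [h]
      refine (norm_add_le _ _).trans ?_
      rw [WithLp.norm_toLp_fst, WithLp.norm_toLp_snd]

theorem norm_W0_mono (hp : p ≠ ∞) {v w : W0 D p}
    (h1 : ∀ᵐ x ∂volD D, |val v x| ≤ |val w x|) (h2 : ∀ᵐ x ∂volD D, ‖grad v x‖ ≤ ‖grad w x‖) :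
    ‖v‖ ≤ ‖w‖ := by
  rw [norm_W0_rpow hp, norm_W0_rpow hp]
  have n1 : ‖valL D p v‖ ≤ ‖valL D p w‖ := Lp.norm_le_norm_of_ae_le h1
  have n2 : ‖gradL D p v‖ ≤ ‖gradL D p w‖ := Lp.norm_le_norm_of_ae_le h2
  gcongr

/-- Both sides are continuous in `w` by Hölder and agree on test functions, which are dense. -/
theorem integral_smul_grad (q : ℝ≥0∞) [Fact (1 ≤ q)] [p.HolderConjugate q] (w : W0 D p)
    (ψ : 𝓓(D, ℝ)) :
    ∫ x in (D : Set (Eu d)), ψ x • grad w x = - ∫ x in (D : Set (Eu d)), val w x • gradient ψ x := by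
  have : q.HolderConjugate p := ENNReal.HolderConjugate.symm
  let A : W0 D p →L[ℝ] Eu d := (ContinuousLinearMap.lsmul ℝ ℝ).lpPairing (volD D) q p
    ((memLp_test D q ψ).toLp _) ∘L gradL D p
  let B : W0 D p →L[ℝ] Eu d := ((ContinuousLinearMap.lsmul ℝ ℝ).lpPairing (volD D) p q).flip
    ((memLp_gradient_test D q ψ).toLp _) ∘L valL D p
  have hA : ∀ w, A w = ∫ x in (D : Set (Eu d)), ψ x • grad w x := fun w => by
    refine (ContinuousLinearMap.lpPairing_eq_integral _ _ _).trans (integral_congr_ae ?_)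
    filter_upwards [(memLp_test D q ψ).coeFn_toLp] with x hx
    rw [hx]; rfl
  have hB : ∀ w, B w = ∫ x in (D : Set (Eu d)), val w x • gradient ψ x := fun w => by
    refine (ContinuousLinearMap.lpPairing_eq_integral _ _ _).trans (integral_congr_ae ?_)
    filter_upwards [(memLp_gradient_test D q ψ).coeFn_toLp] with x hx
    rw [hx]; rfl
  have : ⇑A = ⇑(-B) := by
    refine (denseRange_ofTest (D := D) (p := p)).equalizer A.continuous (-B).continuous ?_
    ext1 φ
    simp only [Function.comp_apply, _root_.neg_apply]
    rw [hA, hB]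
    have h1 : ∫ x in (D : Set (Eu d)), ψ x • grad (ofTest D p φ) x
        = ∫ x in (D : Set (Eu d)), ψ x • gradient φ x :=
      integral_congr_ae (by filter_upwards [grad_ofTest (p := p) φ] with x hx; rw [hx])
    have h2 : ∫ x in (D : Set (Eu d)), val (ofTest D p φ) x • gradient ψ x
        = ∫ x in (D : Set (Eu d)), φ x • gradient ψ x :=
      integral_congr_ae (by filter_upwards [val_ofTest (p := p) φ] with x hx; rw [hx])
    rw [h1, h2, integral_smul_gradient]
  rw [← hA, ← hB, this]; rfl

/-- The weak gradient is determined by the values. -/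
theorem eq_of_val_ae_eq (q : ℝ≥0∞) [Fact (1 ≤ q)] [p.HolderConjugate q] {v w : W0 D p}
    (h : val v =ᵐ[volD D] val w) : v = w := by
  have h0 : val (v - w) =ᵐ[volD D] 0 := by
    filter_upwards [val_sub v w, h] with x h1 h2
    simp [h1, h2]
  -- Integration by parts against any test function gives zero since the values vanish, so the
  -- fundamental lemma of the calculus of variations applies to the gradient.
  have hg : ∀ᵐ x, x ∈ (D : Set (Eu d)) → grad (v - w) x = 0 := by
    refine D.isOpen.ae_eq_zero_of_integral_contDiff_smul_eq_zero ?_ ?_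
    · intro x _
      obtain ⟨s, hs, hi⟩ := (memLp_grad (v - w)).locallyIntegrable Fact.out x
      refine ⟨s ∩ D, inter_mem (mem_nhdsWithin_of_mem_nhds hs) self_mem_nhdsWithin, ?_⟩
      rwa [IntegrableOn, Measure.restrict_restrict' D.isOpen.measurableSet] at hi
    · intro g hg hgs hgD
      let ψ : 𝓓(D, ℝ) := ⟨g, hg, hgs, hgD⟩
      have e := integral_smul_grad q (v - w) ψ
      have e0 : ∫ x in (D : Set (Eu d)), val (v - w) x • gradient ψ x = 0 :=
        integral_eq_zero_of_ae (by
          filter_upwards [h0] with x hx; rw [hx, Pi.zero_apply, zero_smul, Pi.zero_apply])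
      rw [e0, neg_zero] at e
      rw [← e]
      refine (setIntegral_eq_integral_of_forall_compl_eq_zero fun x hx => ?_).symm
      rw [show g x = 0 from eq_zero_of_notMem (φ := ψ) hx, zero_smul]
  have z1 : valL D p (v - w) = 0 := by
    rw [Lp.eq_zero_iff_ae_eq_zero]; exact h0
  have z2 : gradL D p (v - w) = 0 := by
    rw [Lp.eq_zero_iff_ae_eq_zero]; exact (ae_restrict_iff' D.isOpen.measurableSet).2 hg
  have : ‖v - w‖ ≤ 0 := (norm_W0_le_add _).trans (by rw [z1, z2]; simp)
  exact sub_eq_zero.1 (norm_le_zero_iff.1 this)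

end sobolev

/-! ### Absolute values in `W_0^{1,p}(D)` and its nonnegative cone -/

section smoothAbs

/-- A smooth approximation of the absolute value. -/
def smoothAbs (δ : ℝ) (s : ℝ) : ℝ := √(s ^ 2 + δ ^ 2) - δ

variable {δ : ℝ}

theorem smoothAbs_zero (hδ : 0 < δ) : smoothAbs δ 0 = 0 := by
  simp [smoothAbs, Real.sqrt_sq hδ.le]

theorem contDiff_smoothAbs (hδ : 0 < δ) : ContDiff ℝ (⊤ : ℕ∞) (smoothAbs δ) := by
  refine ContDiff.sub (ContDiff.sqrt (by fun_prop) fun s => ?_) contDiff_const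
  positivity

theorem deriv_smoothAbs (hδ : 0 < δ) (s : ℝ) : deriv (smoothAbs δ) s = s / √(s ^ 2 + δ ^ 2) := by
  have hpos : s ^ 2 + δ ^ 2 ≠ 0 := by positivity
  have h : HasDerivAt (fun s : ℝ => s ^ 2 + δ ^ 2) (2 * s) s := by
    simpa using (hasDerivAt_pow 2 s).add_const (δ ^ 2)
  have h2 : HasDerivAt (smoothAbs δ) _ s := (h.sqrt hpos).sub_const δ
  rw [h2.deriv]
  field_simp

theorem abs_le_sqrt_add (s δ : ℝ) : |s| ≤ √(s ^ 2 + δ ^ 2) :=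
  Real.abs_le_sqrt (by nlinarith [sq_nonneg δ])

theorem abs_deriv_smoothAbs_le (hδ : 0 < δ) (s : ℝ) : |deriv (smoothAbs δ) s| ≤ 1 := by
  rw [deriv_smoothAbs hδ, abs_div, abs_of_nonneg (Real.sqrt_nonneg _)]
  exact div_le_one_of_le₀ (abs_le_sqrt_add s δ) (Real.sqrt_nonneg _)

theorem smoothAbs_nonneg (δ s : ℝ) : 0 ≤ smoothAbs δ s :=
  sub_nonneg.2 (Real.le_sqrt_of_sq_le (by nlinarith [sq_nonneg s]))

theorem smoothAbs_le_abs (hδ : 0 < δ) (s : ℝ) : smoothAbs δ s ≤ |s| := by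
  rw [smoothAbs, sub_le_iff_le_add, Real.sqrt_le_left (by positivity)]
  nlinarith [sq_abs s, mul_nonneg (abs_nonneg s) hδ.le]

theorem abs_sub_le_smoothAbs (s : ℝ) : |s| - δ ≤ smoothAbs δ s :=
  sub_le_sub_right (abs_le_sqrt_add s δ) δ

theorem abs_smoothAbs_sub_le (hδ : 0 < δ) (a b : ℝ) :
    |smoothAbs δ a - smoothAbs δ b| ≤ |a - b| := by
  have h := Convex.norm_image_sub_le_of_norm_deriv_le (f := smoothAbs δ) (C := 1) (s := univ)
    (x := b) (y := a)
    (fun x _ => (contDiff_smoothAbs hδ).differentiable (by simp) x)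
    (fun x _ => abs_deriv_smoothAbs_le hδ x) convex_univ (mem_univ _) (mem_univ _)
  simpa using h

theorem tendsto_smoothAbs (s : ℝ) {δ : ℕ → ℝ} (hδ : ∀ n, 0 < δ n) (h : Tendsto δ atTop (𝓝 0)) :
    Tendsto (fun n => smoothAbs (δ n) s) atTop (𝓝 |s|) := by
  have := (tendsto_const_nhds (x := |s|) (f := atTop)).sub h
  rw [sub_zero] at this
  exact tendsto_of_tendsto_of_tendsto_of_le_of_le this tendsto_const_nhds
    (fun n => abs_sub_le_smoothAbs s) (fun n => smoothAbs_le_abs (hδ n) s)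

/-- By the convention `0 / 0 = 0` the limit is `0` at `s = 0`, where every approximating derivative
vanishes too. Convergence therefore holds at every point, and nothing has to be known about `∇w` on
the set where `w` vanishes. -/
theorem tendsto_deriv_smoothAbs (s : ℝ) {δ : ℕ → ℝ} (hδ : ∀ n, 0 < δ n)
    (h : Tendsto δ atTop (𝓝 0)) :
    Tendsto (fun n => deriv (smoothAbs (δ n)) s) atTop (𝓝 (s / |s|)) := by
  simp_rw [deriv_smoothAbs (hδ _)]
  rcases eq_or_ne s 0 with rfl | hs
  · simp
  · have : Tendsto (fun n => √(s ^ 2 + δ n ^ 2)) atTop (𝓝 (√(s ^ 2 + 0 ^ 2))) :=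
      (Real.continuous_sqrt.tendsto _).comp (tendsto_const_nhds.add (h.pow 2))
    rw [zero_pow two_ne_zero, add_zero, Real.sqrt_sq_eq_abs] at this
    exact tendsto_const_nhds.div this (abs_ne_zero.2 hs)

end smoothAbs

section sobolevAbs

variable {D : Opens (Eu d)} {p : ℝ≥0∞} [Fact (1 ≤ p)]

theorem tendsto_toLp_pair {f : ℕ → Eu d → ℝ} {g : ℕ → Eu d → Eu d} {f' : Eu d → ℝ}
    {g' : Eu d → Eu d} (hf : ∀ n, MemLp (f n) p (volD D)) (hg : ∀ n, MemLp (g n) p (volD D))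
    (hf' : MemLp f' p (volD D)) (hg' : MemLp g' p (volD D))
    (h1 : Tendsto (fun n => eLpNorm (f n - f') p (volD D)) atTop (𝓝 0))
    (h2 : Tendsto (fun n => eLpNorm (g n - g') p (volD D)) atTop (𝓝 0)) :
    Tendsto (fun n => WithLp.toLp p ((hf n).toLp, (hg n).toLp)) atTop
      (𝓝 (WithLp.toLp p (hf'.toLp, hg'.toLp))) := by
  refine ((WithLp.prod_continuous_toLp p _ _).tendsto _).comp (Tendsto.prodMk_nhds ?_ ?_)
  · rw [tendsto_iff_edist_tendsto_0]
    simpa only [Lp.edist_toLp_toLp] using h1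
  · rw [tendsto_iff_edist_tendsto_0]
    simpa only [Lp.edist_toLp_toLp] using h2

/-- The pairs `(ψ, ∇ψ)` for nonnegative test functions `ψ`. -/
def nonnegTestPairs (D : Opens (Eu d)) (p : ℝ≥0∞) [Fact (1 ≤ p)] :
    Set (WithLp p (Lp ℝ p (volD D) × Lp (Eu d) p (volD D))) :=
  testPair D p '' {ψ | ∀ x, 0 ≤ ψ x}

omit [Fact (1 ≤ p)] in
theorem memLp_smoothAbs {δ : ℝ} (hδ : 0 < δ) {f : Eu d → ℝ} (hf : MemLp f p (volD D)) :
    MemLp (fun x => smoothAbs δ (f x)) p (volD D) := by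
  refine hf.mono ((contDiff_smoothAbs hδ).continuous.comp_aestronglyMeasurable hf.1)
    (Eventually.of_forall fun x => ?_)
  rw [Real.norm_of_nonneg (smoothAbs_nonneg δ _)]
  exact smoothAbs_le_abs hδ _

omit [Fact (1 ≤ p)] in
theorem memLp_bdd_smul {f : Eu d → ℝ} {g : Eu d → Eu d}
    (hf : AEStronglyMeasurable f (volD D)) (hg : MemLp g p (volD D)) (hb : ∀ x, |f x| ≤ 1) :
    MemLp (fun x => f x • g x) p (volD D) := by
  refine hg.mono (hf.smul hg.1) (Eventually.of_forall fun x => ?_)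
  rw [norm_smul]
  exact mul_le_of_le_one_left (norm_nonneg _) (hb x)

theorem continuous_deriv_smoothAbs {δ : ℝ} (hδ : 0 < δ) : Continuous (deriv (smoothAbs δ)) :=
  (contDiff_smoothAbs hδ).continuous_deriv (by simp)

/-- The chain rule passes to the limit along test functions `φ_n → w`. With `b = smoothAbs δ`, the
values converge because `b` is 1-Lipschitz. For the gradients, `b'(φ_n) ∇φ_n - b'(w) ∇w = b'(φ_n)
(∇φ_n - ∇w) + (b'(φ_n) - b'(w)) ∇w`: the first term is controlled by `|b'| ≤ 1`, the second by
dominated convergence along an a.e. convergent subsequence. The approximants `b(φ_n)` are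
nonnegative. -/
theorem smoothAbs_mem_closure (hp : p ≠ ∞) {δ : ℝ} (hδ : 0 < δ) (w : W0 D p)
    (h1 : MemLp (fun x => smoothAbs δ (val w x)) p (volD D))
    (h2 : MemLp (fun x => deriv (smoothAbs δ) (val w x) • grad w x) p (volD D)) :
    WithLp.toLp p (h1.toLp, h2.toLp) ∈ closure (nonnegTestPairs D p) := by
  have hp1 : 1 ≤ p := Fact.out
  have hp0 : p ≠ 0 := (one_pos.trans_le hp1).ne'
  obtain ⟨x, hx, hlim⟩ := mem_closure_iff_seq_limit.1 (denseRange_ofTest (D := D) (p := p) w)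
  choose φ hφ using hx
  have hlim' : Tendsto (fun n => ofTest D p (φ n)) atTop (𝓝 w) := by simpa only [hφ] using hlim
  have v1 : Tendsto (fun n => valL D p (ofTest D p (φ n))) atTop (𝓝 (valL D p w)) :=
    ((valL D p).continuous.tendsto w).comp hlim'
  obtain ⟨ns, hns, hae⟩ := (tendstoInMeasure_of_tendsto_Lp v1).exists_seq_tendsto_ae
  replace hlim' := hlim'.comp hns.tendsto_atTop
  replace v1 := v1.comp hns.tendsto_atTop
  have g1 : Tendsto (fun n => gradL D p (ofTest D p (φ (ns n)))) atTop (𝓝 (gradL D p w)) :=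
    ((gradL D p).continuous.tendsto w).comp hlim'
  have hcd := continuous_deriv_smoothAbs hδ
  refine mem_closure_of_tendsto (tendsto_toLp_pair
    (fun n => memLp_test D p (compTest _ (contDiff_smoothAbs hδ) (smoothAbs_zero hδ) (φ (ns n))))
    (fun n => memLp_gradient_test D p
      (compTest _ (contDiff_smoothAbs hδ) (smoothAbs_zero hδ) (φ (ns n)))) h1 h2 ?_ ?_)
    (Eventually.of_forall fun n => ⟨_, fun x => smoothAbs_nonneg δ _, rfl⟩)
  · rw [tendsto_iff_edist_tendsto_0] at v1
    refine tendsto_of_tendsto_of_tendsto_of_le_of_le tendsto_const_nhds v1 (fun n => zero_le)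
      fun n => ?_
    simp only [Function.comp_apply, Lp.edist_def]
    refine eLpNorm_mono_ae ?_
    filter_upwards [val_ofTest (p := p) (φ (ns n))] with x hx
    simp only [Pi.sub_apply, compTest_apply, coe_valL, hx]
    exact abs_smoothAbs_sub_le hδ _ _
  · rw [tendsto_iff_edist_tendsto_0] at g1
    have dom : Tendsto (fun n => eLpNorm (fun x => (deriv (smoothAbs δ) (φ (ns n) x)
        - deriv (smoothAbs δ) (val w x)) • grad w x) p (volD D)) atTop (𝓝 0) := by
      refine tendsto_eLpNorm_zero_of_dominated hp0 hp (G := fun x => 2 * ‖grad w x‖)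
        (fun n => ?_) ((memLp_grad w).norm.const_mul 2) (fun n => ?_) ?_
      · exact ((hcd.comp (φ (ns n)).continuous).aestronglyMeasurable.sub
          (hcd.comp_aestronglyMeasurable (memLp_val w).1)).smul (memLp_grad w).1
      · refine Eventually.of_forall fun x => ?_
        rw [norm_smul, Real.norm_of_nonneg (by positivity : 0 ≤ 2 * ‖grad w x‖)]
        gcongr
        refine (norm_sub_le _ _).trans ?_
        have a1 := abs_deriv_smoothAbs_le hδ (φ (ns n) x)
        have a2 := abs_deriv_smoothAbs_le hδ (val w x)
        simp only [Real.norm_eq_abs]; linarith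
      · have hall := ae_all_iff.2 fun n => val_ofTest (p := p) (φ (ns n))
        filter_upwards [hae, hall] with x hx hx'
        simp only [coe_valL, hx'] at hx
        have := ((hcd.tendsto _).comp hx).sub_const (deriv (smoothAbs δ) (val w x))
        rw [sub_self] at this
        simpa using this.smul_const (grad w x)
    have tot := g1.add dom
    rw [add_zero] at tot
    refine tendsto_of_tendsto_of_tendsto_of_le_of_le tendsto_const_nhds tot (fun n => zero_le)
      fun n => ?_
    simp only [Lp.edist_def]
    have m1 : AEStronglyMeasurable (fun x => deriv (smoothAbs δ) (φ (ns n) x) •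
        (grad (ofTest D p (φ (ns n))) x - grad w x)) (volD D) :=
      (hcd.comp (φ (ns n)).continuous).aestronglyMeasurable.smul
        ((memLp_grad _).1.sub (memLp_grad w).1)
    have m2 : AEStronglyMeasurable (fun x => (deriv (smoothAbs δ) (φ (ns n) x)
        - deriv (smoothAbs δ) (val w x)) • grad w x) (volD D) :=
      ((hcd.comp (φ (ns n)).continuous).aestronglyMeasurable.sub
          (hcd.comp_aestronglyMeasurable (memLp_val w).1)).smul (memLp_grad w).1
    calc _ = eLpNorm ((fun x => deriv (smoothAbs δ) (φ (ns n) x) •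
        (grad (ofTest D p (φ (ns n))) x - grad w x)) + (fun x => (deriv (smoothAbs δ) (φ (ns n) x)
        - deriv (smoothAbs δ) (val w x)) • grad w x)) p (volD D) := by
          refine eLpNorm_congr_ae ?_
          filter_upwards [grad_ofTest (p := p) (φ (ns n))] with x hx
          simp only [Pi.sub_apply, Pi.add_apply, gradient_compTest, hx]
          module
      _ ≤ _ := eLpNorm_add_le m1 m2 hp1
      _ ≤ _ := by
          gcongr
          refine eLpNorm_mono fun x => ?_
          rw [norm_smul]
          exact mul_le_of_le_one_left (norm_nonneg _) (abs_deriv_smoothAbs_le hδ _)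

/-- The absolute value of a function in `W_0^{1,p}(D)` belongs to `W_0^{1,p}(D)` and is a limit of
nonnegative test functions. -/
theorem exists_abs (hp : p ≠ ∞) (w : W0 D p) :
    ∃ w' : W0 D p, w' ∈ closure (ofTest D p '' {ψ | ∀ x, 0 ≤ ψ x}) ∧
      val w' =ᵐ[volD D] (fun x => |val w x|) ∧ ‖w'‖ ≤ ‖w‖ := by
  have hp1 : 1 ≤ p := Fact.out
  have hp0 : p ≠ 0 := (one_pos.trans_le hp1).ne'
  have hδ : ∀ n : ℕ, (0 : ℝ) < 1 / ((n : ℝ) + 1) := fun n => by positivity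
  have hδ0 : Tendsto (fun n : ℕ => 1 / ((n : ℝ) + 1)) atTop (𝓝 0) :=
    tendsto_one_div_add_atTop_nhds_zero_nat
  have hs : ∀ s : ℝ, |(s / |s|)| ≤ 1 := fun s => by
    rw [abs_div, abs_abs]; exact div_self_le_one _
  have hsm : Measurable fun s : ℝ => s / |s| := by fun_prop
  have m1 : MemLp (fun x => |val w x|) p (volD D) := (memLp_val w).norm
  have m2 : MemLp (fun x => (val w x / |val w x|) • grad w x) p (volD D) :=
    memLp_bdd_smul (hsm.comp_aemeasurable (memLp_val w).1.aemeasurable).aestronglyMeasurable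
      (memLp_grad w) fun x => hs _
  have m3 : ∀ n : ℕ, MemLp (fun x => smoothAbs (1 / ((n : ℝ) + 1)) (val w x)) p (volD D) :=
    fun n => memLp_smoothAbs (hδ n) (memLp_val w)
  have m4 : ∀ n : ℕ, MemLp (fun x => deriv (smoothAbs (1 / ((n : ℝ) + 1))) (val w x) • grad w x) p
      (volD D) := fun n =>
    memLp_bdd_smul ((continuous_deriv_smoothAbs (hδ n)).comp_aestronglyMeasurable (memLp_val w).1)
      (memLp_grad w) fun x => abs_deriv_smoothAbs_le (hδ n) _
  -- A second limit, `δ → 0`, within the same closed set.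
  have hmem : WithLp.toLp p (m1.toLp, m2.toLp) ∈ closure (nonnegTestPairs D p) := by
    refine isClosed_closure.mem_of_tendsto (tendsto_toLp_pair m3 m4 m1 m2 ?_ ?_)
      (Eventually.of_forall fun n => smoothAbs_mem_closure hp (hδ n) w (m3 n) (m4 n))
    · refine tendsto_eLpNorm_zero_of_dominated hp0 hp (G := fun x => |val w x|)
        (fun n => ((m3 n).sub m1).1) m1 (fun n => Eventually.of_forall fun x => ?_)
        (Eventually.of_forall fun x => ?_)
      · rw [Pi.sub_apply, Real.norm_eq_abs, Real.norm_eq_abs, abs_abs, abs_le]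
        constructor
        · linarith [smoothAbs_nonneg (1 / ((n : ℝ) + 1)) (val w x)]
        · linarith [smoothAbs_le_abs (hδ n) (val w x), abs_nonneg (val w x)]
      · have := (tendsto_smoothAbs (val w x) hδ hδ0).sub_const |val w x|
        rwa [sub_self] at this
    · refine tendsto_eLpNorm_zero_of_dominated hp0 hp (G := fun x => 2 * ‖grad w x‖)
        (fun n => ((m4 n).sub m2).1) ((memLp_grad w).norm.const_mul 2)
        (fun n => Eventually.of_forall fun x => ?_) (Eventually.of_forall fun x => ?_)
      · rw [Pi.sub_apply, ← sub_smul, norm_smul,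
          Real.norm_of_nonneg (by positivity : 0 ≤ 2 * ‖grad w x‖)]
        gcongr
        refine (norm_sub_le _ _).trans ?_
        have a1 := abs_deriv_smoothAbs_le (hδ n) (val w x)
        have a2 := hs (val w x)
        simp only [Real.norm_eq_abs]; linarith
      · have := ((tendsto_deriv_smoothAbs (val w x) hδ hδ0).smul_const (grad w x)).sub_const
          ((val w x / |val w x|) • grad w x)
        rwa [sub_self] at this
  have hW : WithLp.toLp p (m1.toLp, m2.toLp) ∈ W0Sub D p :=
    mem_W0Sub_iff.2 (closure_mono (image_subset_range _ _) hmem)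
  obtain ⟨w', hw'⟩ : ∃ w' : W0 D p, w'.1 = WithLp.toLp p (m1.toLp, m2.toLp) := ⟨⟨_, hW⟩, rfl⟩
  have e1 : val w' =ᵐ[volD D] fun x => |val w x| := by
    change ⇑(w'.1.fst) =ᵐ[volD D] _
    rw [hw']; exact m1.coeFn_toLp
  have e2 : grad w' =ᵐ[volD D] fun x => (val w x / |val w x|) • grad w x := by
    change ⇑(w'.1.snd) =ᵐ[volD D] _
    rw [hw']; exact m2.coeFn_toLp
  refine ⟨w', ?_, e1, norm_W0_mono hp ?_ ?_⟩
  · rw [← hw'] at hmem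
    rw [Metric.mem_closure_iff] at hmem ⊢
    intro ε hε
    obtain ⟨_, ⟨φ, hφ, rfl⟩, h⟩ := hmem ε hε
    exact ⟨_, ⟨φ, hφ, rfl⟩, h⟩
  · filter_upwards [e1] with x hx
    rw [hx, abs_abs]
  · filter_upwards [e2] with x hx
    rw [hx, norm_smul]
    exact mul_le_of_le_one_left (norm_nonneg _) (hs _)

/-- Nonnegative functions in `W_0^{1,p}(D)` are limits of nonnegative test functions. -/
theorem mem_closure_of_nonneg (q : ℝ≥0∞) [Fact (1 ≤ q)] [p.HolderConjugate q] (hp : p ≠ ∞)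
    {w : W0 D p} (hw : ∀ᵐ x ∂volD D, 0 ≤ val w x) :
    w ∈ closure (ofTest D p '' {ψ | ∀ x, 0 ≤ ψ x}) := by
  obtain ⟨w', h1, h2, -⟩ := exists_abs hp w
  have : w' = w := eq_of_val_ae_eq q (by
    filter_upwards [h2, hw] with x h h0
    rw [h, abs_of_nonneg h0])
  rwa [← this]

end sobolevAbs

/-! ### Cut-off functions -/

section bump

theorem exists_test_one_on {E : Type*} [NormedAddCommGroup E] [NormedSpace ℝ E]
    [FiniteDimensional ℝ E] (U : Opens E) {K : Set E} (hK : IsCompact K) (hKU : K ⊆ U) :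
    ∃ φ : 𝓓(U, ℝ), (∀ x, φ x ∈ Icc 0 1) ∧ ∀ x ∈ K, φ x = 1 := by
  obtain ⟨L, hL, hKL, hLU⟩ := exists_compact_between hK U.isOpen hKU
  obtain ⟨f, h1, h0, h01⟩ := exists_contMDiffMap_one_nhds_of_subset_interior
    (n := ⊤) (modelWithCornersSelf ℝ E) hK.isClosed hKL
  have hs : tsupport f ⊆ L :=
    closure_minimal (fun x hx => by_contra fun h => hx (h0 x h)) hL.isClosed
  exact ⟨⟨f, f.contMDiff.contDiff, hL.of_isClosed_subset (isClosed_tsupport _) hs, hs.trans hLU⟩,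
    h01, fun x hx => h1.self_of_nhdsSet x hx⟩

/-- Indicators are `L^p`-limits of test functions on an interval. -/
theorem exists_test_eLpNorm_sub_indicator_le {T : ℝ} {p : ℝ≥0∞} (hp0 : p ≠ 0) (hp : p ≠ ∞)
    {s : Set ℝ} (hs : MeasurableSet s) {ε : ℝ≥0∞} (hε : ε ≠ 0) :
    ∃ θ : 𝓓((⟨Ioo 0 T, isOpen_Ioo⟩ : Opens ℝ), ℝ), (∀ t, θ t ∈ Icc 0 1) ∧
      eLpNorm (fun t => θ t - s.indicator (fun _ => (1 : ℝ)) t) p (volT T) ≤ ε := by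
  have hP : 0 < p.toReal := ENNReal.toReal_pos hp0 hp
  -- The cut-off and the indicator differ on `(0, T)` only in `s \ K` and `U \ K`, by at most one.
  -- Giving each of these measure at most `ε ^ p / 2` bounds the `L^p` norm by `ε`.
  have hη : ε ^ p.toReal / 2 ≠ 0 := by
    have : ε ^ p.toReal ≠ 0 := by simp [ENNReal.rpow_eq_zero_iff, hε, hP.not_gt]
    simp [this]
  set η := ε ^ p.toReal / 2
  have hsm : MeasurableSet (s ∩ Ioo 0 T) := hs.inter measurableSet_Ioo
  have hfin : volume (s ∩ Ioo 0 T) ≠ ∞ :=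
    ((measure_mono inter_subset_right).trans_lt (by simp : volume (Ioo 0 T) < ∞)).ne
  obtain ⟨K, hKs, hK, hKη⟩ := hsm.exists_isCompact_sdiff_lt hfin hη
  obtain ⟨U, hKU, hU, -, hUη⟩ := hK.measurableSet.exists_isOpen_sdiff_lt (hK.measure_lt_top (μ := volume)).ne hη
  obtain ⟨φ, h01, h1⟩ := exists_test_one_on (⟨U ∩ Ioo 0 T, hU.inter isOpen_Ioo⟩ : Opens ℝ) hK
    (subset_inter hKU (hKs.trans inter_subset_right))
  refine ⟨⟨φ, φ.contDiff, φ.hasCompactSupport, φ.tsupport_subset.trans inter_subset_right⟩,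
    h01, ?_⟩
  set A := ((s ∩ Ioo 0 T) \ K) ∪ (U \ K) with hA
  have hAm : MeasurableSet A :=
    (hsm.diff hK.measurableSet).union (hU.measurableSet.diff hK.measurableSet)
  have hbd : ∀ᵐ t ∂volT T, ‖φ t - s.indicator (fun _ => (1 : ℝ)) t‖
      ≤ ‖A.indicator (fun _ => (1 : ℝ)) t‖ := by
    refine (ae_restrict_iff' measurableSet_Ioo).2 (Eventually.of_forall fun t ht => ?_)
    by_cases hA' : t ∈ A
    · rw [indicator_of_mem hA', norm_one, Real.norm_eq_abs, abs_le]
      have := h01 t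
      by_cases hts : t ∈ s
      · rw [indicator_of_mem hts]; constructor <;> linarith [this.1, this.2]
      · rw [indicator_of_notMem hts]; constructor <;> linarith [this.1, this.2]
    · by_cases htK : t ∈ K
      · rw [h1 t htK, indicator_of_mem (hKs htK).1]; simp
      · have hts : t ∉ s := fun h => hA' (Or.inl ⟨⟨h, ht⟩, htK⟩)
        have htU : t ∉ U := fun h => hA' (Or.inr ⟨h, htK⟩)
        rw [indicator_of_notMem hts, eq_zero_of_notMem (φ := φ) (fun h => htU h.1)]; simp
  refine (eLpNorm_mono_ae hbd).trans ?_
  rw [eLpNorm_indicator_const hAm hp0 hp, enorm_one, one_mul]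
  have hvA : volT T A ≤ ε ^ p.toReal := by
    refine (Measure.restrict_apply_le _ _).trans ((measure_union_le _ _).trans ?_)
    calc _ ≤ η + η := add_le_add hKη.le hUη.le
      _ = _ := ENNReal.add_halves _
  calc _ ≤ (ε ^ p.toReal) ^ (1 / p.toReal) := ENNReal.rpow_le_rpow hvA (by positivity)
    _ = ε := by rw [← ENNReal.rpow_mul, mul_one_div_cancel hP.ne', ENNReal.rpow_one]

end bump

/-! ### Test functions on the cylinder as paths of test functions -/

section slice

variable {D : Opens (Eu d)} {T : ℝ}

theorem continuous_mkPair {F : Type*} [TopologicalSpace F] (t : ℝ) :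
    Continuous fun x : F => (t, x) := by fun_prop

/-- The slice `φ(t, ·)` of a test function on the cylinder. -/
def sliceTest (φ : 𝓓(cyl D T, ℝ)) (t : ℝ) : 𝓓(D, ℝ) where
  toFun x := φ (t, x)
  contDiff' := φ.contDiff.comp (contDiff_const.prodMk contDiff_id)
  hasCompactSupport' := by
    refine HasCompactSupport.of_support_subset_isCompact
      (φ.hasCompactSupport.isCompact.image continuous_snd) fun x hx => ?_
    exact ⟨(t, x), subset_tsupport _ hx, rfl⟩
  tsupport_subset' := by
    refine (tsupport_comp_subset_preimage φ (continuous_mkPair t)).trans fun x hx => ?_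
    exact (φ.tsupport_subset hx).2

@[simp]
theorem sliceTest_apply (φ : 𝓓(cyl D T, ℝ)) (t : ℝ) (x : Eu d) : sliceTest φ t x = φ (t, x) := rfl

theorem sliceTest_add (φ ψ : 𝓓(cyl D T, ℝ)) (t : ℝ) :
    sliceTest (φ + ψ) t = sliceTest φ t + sliceTest ψ t := rfl

theorem sliceTest_eq_zero {φ : 𝓓(cyl D T, ℝ)} {t : ℝ} (ht : t ∉ Ioo 0 T) : sliceTest φ t = 0 := by
  ext x
  exact eq_zero_of_notMem (φ := φ) (x := (t, x)) fun h => ht h.1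

/-- The time derivative of a test function on the cylinder. -/
def dtTest (φ : 𝓓(cyl D T, ℝ)) : 𝓓(cyl D T, ℝ) where
  toFun z := fderiv ℝ φ z (1, 0)
  contDiff' := (φ.contDiff.fderiv_right (m := (⊤ : ℕ∞)) (by simp)).clm_apply contDiff_const
  hasCompactSupport' := (φ.hasCompactSupport.fderiv (𝕜 := ℝ)).comp_left
    (g := fun l : ℝ × Eu d →L[ℝ] ℝ => l (1, 0)) rfl
  tsupport_subset' := (closure_mono (fun z hz => by
    contrapose! hz
    rw [Function.mem_support, not_not] at hz ⊢
    simp [hz])).trans ((tsupport_fderiv_subset ℝ).trans φ.tsupport_subset)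

theorem hasDerivAt_slice (φ : 𝓓(cyl D T, ℝ)) (t : ℝ) (x : Eu d) :
    HasDerivAt (fun s => φ (s, x)) (dtTest φ (t, x)) t := by
  have h1 : HasDerivAt (fun s : ℝ => (s, x)) ((1 : ℝ), (0 : Eu d)) t :=
    (hasDerivAt_id t).prodMk (hasDerivAt_const t x)
  exact (differentiable_test φ (t, x)).hasFDerivAt.comp_hasDerivAt t h1

/-- The product of a test function of time and a test function of space. -/
def tensorTest (θ : 𝓓((⟨Ioo 0 T, isOpen_Ioo⟩ : Opens ℝ), ℝ)) (ψ : 𝓓(D, ℝ)) : 𝓓(cyl D T, ℝ) where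
  toFun z := θ z.1 * ψ z.2
  contDiff' := (θ.contDiff.comp contDiff_fst).mul (ψ.contDiff.comp contDiff_snd)
  hasCompactSupport' := by
    refine HasCompactSupport.of_support_subset_isCompact
      (θ.hasCompactSupport.isCompact.prod ψ.hasCompactSupport.isCompact) fun z hz => ?_
    exact ⟨subset_tsupport _ (left_ne_zero_of_mul hz), subset_tsupport _ (right_ne_zero_of_mul hz)⟩
  tsupport_subset' := by
    refine (closure_minimal (t := tsupport θ ×ˢ tsupport ψ) (fun z hz => ?_)
      ((isClosed_tsupport _).prod (isClosed_tsupport _))).trans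
      (prod_mono θ.tsupport_subset ψ.tsupport_subset)
    exact ⟨subset_tsupport _ (left_ne_zero_of_mul hz), subset_tsupport _ (right_ne_zero_of_mul hz)⟩

theorem sliceTest_tensorTest (θ : 𝓓((⟨Ioo 0 T, isOpen_Ioo⟩ : Opens ℝ), ℝ)) (ψ : 𝓓(D, ℝ)) (t : ℝ) :
    sliceTest (tensorTest θ ψ) t = θ t • ψ := rfl

theorem gradient_sliceTest (φ : 𝓓(cyl D T, ℝ)) (t : ℝ) (x : Eu d) :
    gradient (sliceTest φ t) x = (InnerProductSpace.toDual ℝ (Eu d)).symm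
      ((fderiv ℝ φ (t, x)).comp (ContinuousLinearMap.inr ℝ ℝ (Eu d))) := by
  rw [gradient]
  congr 1
  have h1 : HasFDerivAt (fun y : Eu d => (t, y)) (ContinuousLinearMap.inr ℝ ℝ (Eu d)) x :=
    hasFDerivAt_prodMk_right t x
  exact ((differentiable_test φ (t, x)).hasFDerivAt.comp x h1).fderiv

variable {p : ℝ≥0∞} [Fact (1 ≤ p)]

theorem ofTest_add (φ ψ : 𝓓(D, ℝ)) : ofTest D p (φ + ψ) = ofTest D p φ + ofTest D p ψ :=
  Subtype.ext (testPair_add φ ψ)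

theorem ofTest_smul (c : ℝ) (φ : 𝓓(D, ℝ)) : ofTest D p (c • φ) = c • ofTest D p φ :=
  Subtype.ext (testPair_smul c φ)

theorem ofTest_zero : ofTest D p 0 = 0 := by
  have := ofTest_smul (p := p) 0 (0 : 𝓓(D, ℝ))
  rwa [zero_smul, zero_smul] at this

theorem ofTest_sub (φ ψ : 𝓓(D, ℝ)) : ofTest D p (φ - ψ) = ofTest D p φ - ofTest D p ψ := by
  rw [eq_sub_iff_add_eq, ← ofTest_add, sub_add_cancel]

theorem norm_ofTest_le [IsFiniteMeasure (volD D)] {φ : 𝓓(D, ℝ)} {C : ℝ} (hC : 0 ≤ C)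
    (h1 : ∀ x, |φ x| ≤ C) (h2 : ∀ x, ‖gradient φ x‖ ≤ C) :
    ‖ofTest D p φ‖ ≤ 2 * ((volD D).real univ ^ (p.toReal)⁻¹ * C) := by
  refine (norm_W0_le_add _).trans ?_
  rw [two_mul]
  refine add_le_add (Lp.norm_le_of_ae_bound hC ?_) (Lp.norm_le_of_ae_bound hC ?_)
  · filter_upwards [val_ofTest (p := p) φ] with x hx
    rw [coe_valL, hx]; exact h1 x
  · filter_upwards [grad_ofTest (p := p) φ] with x hx
    rw [coe_gradL, hx]; exact h2 x

/-- Uniform continuity of `φ` and of its derivative makes slices and their spatial gradients close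
uniformly in `x`, and `D` has finite measure. -/
theorem continuous_ofTest_slice [IsFiniteMeasure (volD D)] (φ : 𝓓(cyl D T, ℝ)) :
    Continuous fun t => ofTest D p (sliceTest φ t) := by
  rw [Metric.continuous_iff]
  intro t₀ ε hε
  set m := (volD D).real univ ^ (p.toReal)⁻¹ with hm
  have hm0 : 0 ≤ m := by positivity
  set C := ε / (2 * (m + 1)) / 2 with hC
  have hC0 : 0 < C := by positivity
  have u1 : UniformContinuous φ := φ.hasCompactSupport.uniformContinuous_of_continuous φ.continuous
  have u2 : UniformContinuous (fderiv ℝ φ) :=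
    (φ.hasCompactSupport.fderiv (𝕜 := ℝ)).uniformContinuous_of_continuous
      (φ.contDiff.continuous_fderiv (by simp))
  obtain ⟨δ₁, hδ₁, H1⟩ := Metric.uniformContinuous_iff.1 u1 C hC0
  obtain ⟨δ₂, hδ₂, H2⟩ := Metric.uniformContinuous_iff.1 u2 C hC0
  refine ⟨min δ₁ δ₂, lt_min hδ₁ hδ₂, fun t ht => ?_⟩
  have hd : ∀ x : Eu d, dist (t, x) (t₀, x) = dist t t₀ := fun x => by
    rw [Prod.dist_eq, dist_self, max_eq_left dist_nonneg]
  rw [dist_eq_norm, ← ofTest_sub]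
  refine (norm_ofTest_le hC0.le (fun x => ?_) fun x => ?_).trans_lt ?_
  · have := H1 (a := (t, x)) (b := (t₀, x)) (by rw [hd]; exact ht.trans_le (min_le_left _ _))
    exact this.le
  · have := H2 (a := (t, x)) (b := (t₀, x)) (by rw [hd]; exact ht.trans_le (min_le_right _ _))
    rw [dist_eq_norm] at this
    have hg : gradient (sliceTest φ t - sliceTest φ t₀ : 𝓓(D, ℝ)) x
        = gradient (sliceTest φ t) x - gradient (sliceTest φ t₀) x := by
      rw [sub_eq_add_neg, ← neg_one_smul ℝ, gradient_test_add, gradient_test_smul]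
      simp [sub_eq_add_neg]
    rw [hg, gradient_sliceTest, gradient_sliceTest, ← map_sub, LinearIsometryEquiv.norm_map,
      ← ContinuousLinearMap.sub_comp]
    refine (ContinuousLinearMap.opNorm_comp_le _ _).trans ?_
    have := ContinuousLinearMap.norm_inr_le_one ℝ ℝ (Eu d)
    nlinarith [norm_nonneg (fderiv ℝ φ (t, x) - fderiv ℝ φ (t₀, x))]
  · rw [← hm, hC]
    have : 2 * (m * (ε / (2 * (m + 1)) / 2)) = ε * (m / (2 * (m + 1))) := by field_simp
    rw [this]
    have h2 : m / (2 * (m + 1)) < 1 := by rw [div_lt_one (by positivity)]; linarith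
    nlinarith

theorem memLp_ofTest_slice [IsFiniteMeasure (volD D)] (φ : 𝓓(cyl D T, ℝ)) (r : ℝ≥0∞) :
    MemLp (fun t => ofTest D p (sliceTest φ t)) r (volT T) := by
  have hc := continuous_ofTest_slice (p := p) φ
  refine (hc.memLp_of_hasCompactSupport (HasCompactSupport.of_support_subset_isCompact
    (K := Icc 0 T) isCompact_Icc fun t ht => ?_) (μ := volume)).restrict _
  by_contra h
  exact ht (by
    simp only
    rw [sliceTest_eq_zero fun h' => h (Ioo_subset_Icc_self h'), ofTest_zero])

end slice

/-- The inclusion of `L^p` into `L^r` for `r ≤ p` on a finite measure space. -/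
def lpInclusion {α : Type*} [MeasurableSpace α] (E : Type*) [NormedAddCommGroup E]
    [NormedSpace ℝ E] (μ : Measure α) [IsFiniteMeasure μ] {r p : ℝ≥0∞} [Fact (1 ≤ r)] [Fact (1 ≤ p)]
    (h : r ≤ p) : Lp E p μ →L[ℝ] Lp E r μ :=
  LinearMap.mkContinuous
    { toFun := fun f => ((Lp.memLp f).mono_exponent h).toLp f
      map_add' := fun f g => by
        rw [← MemLp.toLp_add]
        exact MemLp.toLp_congr _ _ (Lp.coeFn_add f g)
      map_smul' := fun c f => by
        rw [RingHom.id_apply, ← MemLp.toLp_const_smul]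
        exact MemLp.toLp_congr _ _ (Lp.coeFn_smul c f) }
    (μ univ ^ (1 / r.toReal - 1 / p.toReal)).toReal fun f => by
      have hr : 0 < r.toReal ∨ p.toReal = 0 := by
        rcases eq_or_ne r ∞ with rfl | hr
        · exact Or.inr (by rw [top_le_iff.1 h]; simp)
        · exact Or.inl (ENNReal.toReal_pos (one_pos.trans_le Fact.out).ne' hr)
      have hexp : 0 ≤ 1 / r.toReal - 1 / p.toReal := by
        rcases hr with hr | hp
        · rcases eq_or_ne p ∞ with rfl | hp
          · simp
          · exact sub_nonneg.2 (one_div_le_one_div_of_le hr (ENNReal.toReal_mono hp h))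
        · rw [hp]; simp
      change ‖((Lp.memLp f).mono_exponent h).toLp f‖ ≤ _
      rw [Lp.norm_toLp, Lp.norm_def, mul_comm, ← ENNReal.toReal_mul]
      exact ENNReal.toReal_mono (ENNReal.mul_ne_top (Lp.eLpNorm_ne_top f)
        (ENNReal.rpow_ne_top_of_nonneg hexp (measure_ne_top _ _)))
        (eLpNorm_le_eLpNorm_mul_rpow_measure_univ h (Lp.aestronglyMeasurable f))

theorem coeFn_lpInclusion {α : Type*} [MeasurableSpace α] {E : Type*} [NormedAddCommGroup E]
    [NormedSpace ℝ E] {μ : Measure α} [IsFiniteMeasure μ] {r p : ℝ≥0∞} [Fact (1 ≤ r)]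
    [Fact (1 ≤ p)] (h : r ≤ p) (f : Lp E p μ) : lpInclusion E μ h f =ᵐ[μ] f :=
  ((Lp.memLp f).mono_exponent h).coeFn_toLp

/-! ### Embedding into `L²(D)` and density in `L^p(0,T; W_0^{1,p}(D))` -/

section spaceTime

variable {D : Opens (Eu d)} {p q : ℝ≥0∞} [Fact (1 ≤ p)] [Fact (1 ≤ q)] [p.HolderConjugate q]
  {T : ℝ} [IsFiniteMeasure (volD D)]

/-- The embedding of `W_0^{1,p}(D)` into `L²(D)` for `p ≥ 2`. -/
def toL2 (D : Opens (Eu d)) [IsFiniteMeasure (volD D)] {p : ℝ≥0∞} [Fact (1 ≤ p)] (h2 : 2 ≤ p) :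
    W0 D p →L[ℝ] L2 D :=
  lpInclusion ℝ (volD D) h2 ∘L valL D p

theorem coeFn_toL2 (h2 : 2 ≤ p) (w : W0 D p) : toL2 D h2 w =ᵐ[volD D] val w :=
  coeFn_lpInclusion h2 (valL D p w)

theorem inner_toL2 (h2 : 2 ≤ p) (f : L2 D) (w : W0 D p) :
    inner ℝ f (toL2 D h2 w) = ∫ x in (D : Set (Eu d)), f x * val w x := by
  rw [L2.inner_def]
  refine integral_congr_ae ?_
  filter_upwards [coeFn_toL2 h2 w] with x hx
  rw [hx]; simp [mul_comm]

theorem inner_toL2_ofTest (h2 : 2 ≤ p) (f : L2 D) (ψ : 𝓓(D, ℝ)) :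
    inner ℝ f (toL2 D h2 (ofTest D p ψ)) = ∫ x in (D : Set (Eu d)), f x * ψ x := by
  rw [inner_toL2]
  refine integral_congr_ae ?_
  filter_upwards [val_ofTest (p := p) ψ] with x hx
  rw [hx]

theorem inner_toL2_toL2_ofTest (h2 : 2 ≤ p) (w : W0 D p) (ψ : 𝓓(D, ℝ)) :
    inner ℝ (toL2 D h2 w) (toL2 D h2 (ofTest D p ψ))
      = ∫ x in (D : Set (Eu d)), val w x * ψ x := by
  rw [inner_toL2_ofTest]
  refine integral_congr_ae ?_
  filter_upwards [coeFn_toL2 h2 w] with x hx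
  rw [hx]

/-- The functional on `W_0^{1,p}(D)` given by an element of `L²(D)`. -/
def dualOfL2 (D : Opens (Eu d)) [IsFiniteMeasure (volD D)] {p : ℝ≥0∞} [Fact (1 ≤ p)] (h2 : 2 ≤ p) :
    L2 D →L[ℝ] StrongDual ℝ (W0 D p) :=
  ((ContinuousLinearMap.compL ℝ (W0 D p) (L2 D) ℝ).flip (toL2 D h2)) ∘L innerSL ℝ

theorem dualOfL2_apply (h2 : 2 ≤ p) (f : L2 D) (w : W0 D p) :
    dualOfL2 D h2 f w = inner ℝ f (toL2 D h2 w) := rfl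

omit [IsFiniteMeasure (volD D)] in
theorem hasDerivAt_integral_slice (φ : 𝓓(cyl D T, ℝ)) (ψ : 𝓓(D, ℝ)) (t : ℝ) :
    HasDerivAt (fun s => ∫ x in (D : Set (Eu d)), φ (s, x) * ψ x)
      (∫ x in (D : Set (Eu d)), dtTest φ (t, x) * ψ x) t := by
  obtain ⟨C, hC⟩ := (dtTest φ).continuous.bounded_above_of_compact_support
    (dtTest φ).hasCompactSupport
  have hcont : ∀ (χ : 𝓓(cyl D T, ℝ)) (s : ℝ), Continuous fun x => χ (s, x) * ψ x := fun χ s =>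
    (χ.continuous.comp (by fun_prop)).mul ψ.continuous
  refine (hasDerivAt_integral_of_dominated_loc_of_deriv_le (s := univ)
    (bound := fun x => C * |ψ x|) univ_mem
    (Eventually.of_forall fun s => (hcont φ s).aestronglyMeasurable)
    (((hcont φ t).integrable_of_hasCompactSupport ψ.hasCompactSupport.mul_left).restrict)
    (hcont (dtTest φ) t).aestronglyMeasurable (Eventually.of_forall fun x s _ => ?_) ?_
    (Eventually.of_forall fun x s _ => (hasDerivAt_slice φ s x).mul_const (ψ x))).2
  · rw [norm_mul]
    exact mul_le_mul_of_nonneg_right (hC _) (norm_nonneg _)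
  · exact ((ψ.continuous.abs.integrable_of_hasCompactSupport
      (ψ.hasCompactSupport.comp_left abs_zero)).const_mul C).restrict

/-- This supplies the elements of `𝒲` on which the equation and the identification of `η` with a
measure are tested. The time derivative is `∂_t φ`, read as a functional through `L²(D)`; the
defining identity is an integration by parts in `t` for `∫ φ(t, x) ψ(x) dx`. -/
theorem exists_spaceW (hp2 : 2 ≤ p) (φ : 𝓓(cyl D T, ℝ)) :
    ∃ w : SpaceW D p q T, ∀ᵐ t ∂volT T, w.fn t = ofTest D p (sliceTest φ t) := by
  let v : LpW0 D p T := (memLp_ofTest_slice φ p).toLp _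
  have hζ : MemLp (fun t => dualOfL2 D hp2 (toL2 D hp2 (ofTest D p (sliceTest (dtTest φ) t)))) q
      (volT T) :=
    ((dualOfL2 D hp2 : L2 D →L[ℝ] StrongDual ℝ (W0 D p)) ∘L toL2 D hp2).comp_memLp' (memLp_ofTest_slice (p := p) (dtTest φ) q)
  let ζ : LqDual D p q T := hζ.toLp _
  have hw : IsWeakTimeDeriv v ζ := by
    intro θ ψ
    have e1 : ∫ t in Ioo 0 T, deriv θ t * (∫ x in (D : Set (Eu d)), val (v t) x * ψ x)
        = ∫ t, deriv θ t * (∫ x in (D : Set (Eu d)), φ (t, x) * ψ x) := by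
      refine Eq.trans ?_ (setIntegral_eq_integral_of_forall_compl_eq_zero (s := Ioo 0 T) ?_)
      · refine integral_congr_ae ?_
        filter_upwards [(memLp_ofTest_slice (p := p) φ p).coeFn_toLp] with t ht
        congr 1
        refine integral_congr_ae ?_
        filter_upwards [val_ofTest (p := p) (sliceTest φ t)] with x hx
        rw [show v t = ofTest D p (sliceTest φ t) from ht, hx]; rfl
      · intro t ht
        have : deriv θ t = 0 := image_eq_zero_of_notMem_tsupport fun h =>
          ht (θ.tsupport_subset (tsupport_deriv_subset h))
        rw [this, zero_mul]
    have e2 : ∫ t in Ioo 0 T, θ t * ζ t (ofTest D p ψ)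
        = ∫ t, θ t * (∫ x in (D : Set (Eu d)), dtTest φ (t, x) * ψ x) := by
      refine Eq.trans ?_ (setIntegral_eq_integral_of_forall_compl_eq_zero (s := Ioo 0 T) ?_)
      · refine integral_congr_ae ?_
        filter_upwards [hζ.coeFn_toLp] with t ht
        congr 1
        rw [show ζ t = _ from ht, dualOfL2_apply, inner_toL2_toL2_ofTest]
        refine integral_congr_ae ?_
        filter_upwards [val_ofTest (p := p) (sliceTest (dtTest φ) t)] with x hx
        rw [hx]; rfl
      · intro t ht
        rw [eq_zero_of_notMem (φ := θ) ht, zero_mul]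
    rw [e1, e2]
    have hI := hasDerivAt_integral_slice φ ψ
    have hI' := hasDerivAt_integral_slice (dtTest φ) ψ
    have c0 : Continuous fun t => ∫ x in (D : Set (Eu d)), φ (t, x) * ψ x :=
      continuous_iff_continuousAt.2 fun t => (hI t).continuousAt
    have c1 : Continuous fun t => ∫ x in (D : Set (Eu d)), dtTest φ (t, x) * ψ x :=
      continuous_iff_continuousAt.2 fun t => (hI' t).continuousAt
    have cθ : Continuous (deriv θ) := θ.contDiff.continuous_deriv (by simp)
    have := integral_mul_deriv_eq_deriv_mul_of_integrable (u := θ) (u' := deriv θ)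
      (fun t _ => (differentiable_test θ t).hasDerivAt) (fun t _ => hI t)
      ((θ.continuous.mul c1).integrable_of_hasCompactSupport θ.hasCompactSupport.mul_right)
      ((cθ.mul c0).integrable_of_hasCompactSupport θ.hasCompactSupport.deriv.mul_right)
      ((θ.continuous.mul c0).integrable_of_hasCompactSupport θ.hasCompactSupport.mul_right)
    rw [this, neg_neg]
  exact ⟨⟨WithLp.toLp p (v, ζ), hw⟩, (memLp_ofTest_slice (p := p) φ p).coeFn_toLp⟩

omit [IsFiniteMeasure (volD D)] in
theorem isRepr_of_ae_eq_slice {v : LpW0 D p T} {φ : 𝓓(cyl D T, ℝ)}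
    (h : ∀ᵐ t ∂volT T, v t = ofTest D p (sliceTest φ t)) : IsRepr v φ := by
  filter_upwards [h] with t ht
  rw [ht]
  exact val_ofTest _

omit [IsFiniteMeasure (volD D)] in
theorem norm_fn_le (w : SpaceW D p q T) : ‖w.fn‖ ≤ ‖w‖ := WithLp.norm_fst_le _ w.1

/-- Test functions on the cylinder are dense in `L^p(0,T; W_0^{1,p}(D))`. -/
theorem exists_test_norm_sub_le (hp2 : 2 ≤ p) (hp : p ≠ ∞) (v : LpW0 D p T) {ε : ℝ} (hε : 0 < ε) :
    ∃ (φ : 𝓓(cyl D T, ℝ)) (w : SpaceW D p q T),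
      (∀ᵐ t ∂volT T, w.fn t = ofTest D p (sliceTest φ t)) ∧ ‖v - w.fn‖ ≤ ε := by
  have hp1 : 1 ≤ p := Fact.out
  have hp0 : p ≠ 0 := (one_pos.trans_le hp1).ne'
  suffices H : ∃ g : ℝ → W0 D p, eLpNorm (⇑v - g) p (volT T) ≤ ENNReal.ofReal ε ∧
      ∃ φ : 𝓓(cyl D T, ℝ), g = fun t => ofTest D p (sliceTest φ t) by
    obtain ⟨g, hg, φ, rfl⟩ := H
    obtain ⟨w, hw⟩ := exists_spaceW (q := q) hp2 φ
    refine ⟨φ, w, hw, ?_⟩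
    rw [Lp.norm_def]
    refine ENNReal.toReal_le_of_le_ofReal hε.le ((eLpNorm_congr_ae ?_).trans_le hg)
    filter_upwards [Lp.coeFn_sub v w.fn, hw] with t h1 h2
    rw [h1, Pi.sub_apply, Pi.sub_apply, h2]
  -- It suffices to approximate `1_s c`. Taking a test function `ψ` near `c` and `θ` near `1_s`, the
  -- error of the product `θ ψ` splits into `(θ - 1_s) ψ` and `1_s (ψ - c)`, each at most `ε / 2`.
  refine MemLp.induction_dense (μ := volT T) (E := W0 D p) hp
    (fun g => ∃ φ : 𝓓(cyl D T, ℝ), g = fun t => ofTest D p (sliceTest φ t)) ?_ ?_ ?_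
    (Lp.memLp v) (ε := ENNReal.ofReal ε) (by simpa using hε)
  · intro c s hs _ ε hε
    wlog hεfin : ε ≠ ∞ generalizing ε
    · obtain ⟨g, hg, hP⟩ := this (ε := 1) one_ne_zero (by simp)
      exact ⟨g, hg.trans (by rw [not_not.1 hεfin]; exact le_top), hP⟩
    have hε2 : ε / 2 ≠ 0 := by simpa using hε
    have hm : volT T univ < ∞ := measure_lt_top _ _
    set m := (volT T univ) ^ (1 / p.toReal) with hmdef
    have hmfin : m ≠ ∞ := ENNReal.rpow_ne_top_of_nonneg (by positivity) hm.ne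
    obtain ⟨ψ, hψ⟩ := Metric.denseRange_iff.1 (denseRange_ofTest (D := D) (p := p)) c
      ((ε / 2 / (m + 1)).toReal) (ENNReal.toReal_pos
        (ENNReal.div_ne_zero.2 ⟨hε2, by simp [hmfin]⟩)
        (ENNReal.div_ne_top (ENNReal.div_ne_top hεfin (by simp)) (by simp)))
    obtain ⟨θ, -, hθ⟩ := exists_test_eLpNorm_sub_indicator_le (T := T) hp0 hp hs
      (ε := ε / 2 / (‖ofTest D p ψ‖ₑ + 1)) (ENNReal.div_ne_zero.2 ⟨hε2, by simp⟩)
    refine ⟨_, ?_, tensorTest θ ψ, rfl⟩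
    have e : (fun t => ofTest D p (sliceTest (tensorTest θ ψ) t)) - s.indicator (fun _ => c)
        = (fun t => (θ t - s.indicator (fun _ => (1 : ℝ)) t) • ofTest D p ψ)
          + s.indicator (fun _ => ofTest D p ψ - c) := by
      ext1 t
      simp only [Pi.sub_apply, Pi.add_apply, sliceTest_tensorTest, ofTest_smul]
      by_cases ht : t ∈ s
      · simp only [indicator_of_mem ht]; module
      · simp only [indicator_of_notMem ht]; module
    have hmeas : AEStronglyMeasurable (fun t => θ t - s.indicator (fun _ => (1 : ℝ)) t) (volT T) :=
      θ.continuous.aestronglyMeasurable.sub (aestronglyMeasurable_const.indicator hs)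
    rw [e]
    calc _ ≤ eLpNorm (fun t => (θ t - s.indicator (fun _ => (1 : ℝ)) t) • ofTest D p ψ) p (volT T)
          + eLpNorm (s.indicator (fun _ => ofTest D p ψ - c)) p (volT T) :=
          eLpNorm_add_le (hmeas.smul_const _) (aestronglyMeasurable_const.indicator hs) hp1
      _ ≤ ε / 2 + ε / 2 := by
          refine add_le_add ?_ ?_
          · calc _ = ‖ofTest D p ψ‖ₑ *
                  eLpNorm (fun t => θ t - s.indicator (fun _ => (1 : ℝ)) t) p (volT T) := by
                  rw [← enorm_norm (ofTest D p ψ), ← eLpNorm_const_smul]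
                  refine eLpNorm_congr_norm_ae (Eventually.of_forall fun t => ?_)
                  rw [norm_smul, Pi.smul_apply, norm_smul, norm_norm, mul_comm]
              _ ≤ (‖ofTest D p ψ‖ₑ + 1) * (ε / 2 / (‖ofTest D p ψ‖ₑ + 1)) := by
                  gcongr; exact le_self_add
              _ = ε / 2 := ENNReal.mul_div_cancel (by simp) (by simp)
          · calc _ ≤ eLpNorm (fun _ => ofTest D p ψ - c) p (volT T) := eLpNorm_indicator_le _
              _ = ‖ofTest D p ψ - c‖ₑ * m := by
                  rw [eLpNorm_const' _ hp0 hp]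
              _ ≤ (ε / 2 / (m + 1)) * (m + 1) := by
                  gcongr
                  · rw [← ofReal_norm, ← dist_eq_norm, dist_comm]
                    refine (ENNReal.ofReal_le_ofReal hψ.le).trans ENNReal.ofReal_toReal_le
                  · exact le_self_add
              _ = ε / 2 := ENNReal.div_mul_cancel (by simp) (by simp [hmfin])
      _ = ε := ENNReal.add_halves ε
  · rintro _ _ ⟨φ, rfl⟩ ⟨ψ, rfl⟩
    exact ⟨φ + ψ, by ext1 t; rw [sliceTest_add, ofTest_add]; rfl⟩
  · rintro _ ⟨φ, rfl⟩
    exact (continuous_ofTest_slice φ).aestronglyMeasurable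

end spaceTime

/-! ### Separability of `W_0^{1,p}(D)` -/

section separable

theorem secondCountableTopology_W0 {D : Opens (Eu d)} {p : ℝ≥0∞} [Fact (1 ≤ p)] (hp : p ≠ ∞) :
    SecondCountableTopology (W0 D p) := by
  have : Fact (p ≠ ∞) := ⟨hp⟩
  have h1 : SecondCountableTopology (Lp ℝ p (volD D)) := Lp.SecondCountableTopology
  have h2 : SecondCountableTopology (Lp (Eu d) p (volD D)) := Lp.SecondCountableTopology
  have h3 : SecondCountableTopology (Lp ℝ p (volD D) × Lp (Eu d) p (volD D)) := inferInstance
  have : SecondCountableTopology (WithLp p (Lp ℝ p (volD D) × Lp (Eu d) p (volD D))) :=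
    (WithLp.homeomorphProd p _ _).secondCountableTopology
  exact inferInstanceAs (SecondCountableTopology ↥(W0Sub D p))

end separable

/-! ### Reflections that are both measures and functionals -/

section measureFunctional

variable {D : Opens (Eu d)} {p q : ℝ≥0∞} [Fact (1 ≤ p)] [Fact (1 ≤ q)] [p.HolderConjugate q]
  {T : ℝ} {η : StrongDual ℝ (SpaceW D p q T)} {ζ : LqDual D p q T} {μ : Measure (ℝ × Eu d)}

/-- An open set is an increasing union of compact sets, closed sets intersected with balls, so
continuity from below suffices and no regularity of the measure is needed. -/
theorem isOpen_measure_le_of_isCompact {X : Type*} [PseudoMetricSpace X] [ProperSpace X]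
    [MeasurableSpace X] [BorelSpace X] {μ : Measure X} {O : Set X} (hO : IsOpen O) {c : ℝ≥0∞}
    (h : ∀ K, IsCompact K → K ⊆ O → μ K ≤ c) : μ O ≤ c := by
  rcases isEmpty_or_nonempty X with hX | ⟨⟨x⟩⟩
  · rw [eq_empty_of_isEmpty O]; simp
  obtain ⟨F, hFc, hFO, hFU, hFm⟩ := hO.exists_iUnion_isClosed
  have hU : ⋃ n : ℕ, (F n ∩ Metric.closedBall x n) = O := by
    refine Subset.antisymm (iUnion_subset fun n => inter_subset_left.trans (hFO n)) fun y hy => ?_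
    rw [← hFU] at hy
    obtain ⟨n, hn⟩ := mem_iUnion.1 hy
    obtain ⟨m, hm⟩ := exists_nat_ge (dist y x)
    refine mem_iUnion.2 ⟨max n m, hFm (le_max_left _ _) hn, ?_⟩
    exact hm.trans (by exact_mod_cast le_max_right n m)
  have hmono : Monotone fun n : ℕ => F n ∩ Metric.closedBall x n := fun a b hab =>
    inter_subset_inter (hFm hab) (Metric.closedBall_subset_closedBall (by exact_mod_cast hab))
  rw [← hU, hmono.measure_iUnion]
  exact iSup_le fun n => h _ ((isCompact_closedBall x n).inter_left (hFc n))
    (inter_subset_left.trans (hFO n))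

theorem integrable_test_cyl (hfin : ∀ K : Set (ℝ × Eu d), IsCompact K → K ⊆ cyl D T → μ K < ∞)
    (φ : 𝓓(cyl D T, ℝ)) : IntegrableOn φ (cyl D T) μ := by
  obtain ⟨C, hC⟩ := φ.continuous.bounded_above_of_compact_support φ.hasCompactSupport
  have h1 : IntegrableOn φ (tsupport φ) μ :=
    Measure.integrableOn_of_bounded (M := C)
      (hfin _ φ.hasCompactSupport.isCompact φ.tsupport_subset).ne
      φ.continuous.aestronglyMeasurable (Eventually.of_forall hC)
  have := (integrableOn_iff_integrable_of_support_subset (subset_tsupport _)).1 h1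
  exact this.integrableOn

variable [IsFiniteMeasure (volD D)]

/-- Both sides are the value of `η` at the element of `𝒲` defined by `φ`. -/
theorem setIntegral_test_eq (hp2 : 2 ≤ p) (hη : IsGivenBy η ζ) (hμ : IsMeasureFunctional η μ)
    (φ : 𝓓(cyl D T, ℝ)) :
    ∫ z in (cyl D T : Set (ℝ × Eu d)), φ z ∂μ
      = ∫ t in Ioo 0 T, ζ t (ofTest D p (sliceTest φ t)) := by
  obtain ⟨w, hw⟩ := exists_spaceW (q := q) hp2 φ
  rw [← hμ φ w (isRepr_of_ae_eq_slice hw), hη w]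
  refine integral_congr_ae ?_
  filter_upwards [hw] with t ht
  rw [ht]

/-- The exceptional null set of times must not depend on `y`. For one nonnegative test function `ψ`,
the integral of `ζ(t)(ψ)` over a measurable set of times is a limit of integrals of products `θ ψ`
against `μ`, hence nonnegative. Separability reduces all nonnegative test functions to countably
many, and these are dense in the nonnegative cone. -/
theorem ae_nonneg_apply_of_nonneg (hp2 : 2 ≤ p) (hp : p ≠ ∞) (hη : IsGivenBy η ζ)
    (hμ : IsMeasureFunctional η μ) :
    ∀ᵐ t ∂volT T, ∀ y : W0 D p, (∀ᵐ x ∂volD D, 0 ≤ val y x) → 0 ≤ ζ t y := by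
  have hζi : Integrable (fun t => ζ t) (volT T) := (Lp.memLp ζ).integrable Fact.out
  have step : ∀ ψ : 𝓓(D, ℝ), (∀ x, 0 ≤ ψ x) → ∀ᵐ t ∂volT T, 0 ≤ ζ t (ofTest D p ψ) := by
    intro ψ hψ
    have hi : Integrable (fun t => ζ t (ofTest D p ψ)) (volT T) :=
      (ContinuousLinearMap.apply ℝ ℝ (ofTest D p ψ)).integrable_comp hζi
    refine ae_nonneg_of_forall_setIntegral_nonneg hi fun s hs _ => ?_
    have hε : ∀ n : ℕ, ENNReal.ofReal (1 / ((n : ℝ) + 1)) ≠ 0 := fun n => by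
      simp only [ne_eq, ENNReal.ofReal_eq_zero, not_le]; positivity
    choose θ hθ01 hθ using fun n => exists_test_eLpNorm_sub_indicator_le (T := T) (p := 1)
      one_ne_zero ENNReal.one_ne_top hs (hε n)
    have hlim : Tendsto (fun n => eLpNorm (⇑(θ n) - s.indicator (fun _ => (1 : ℝ))) 1 (volT T)) atTop
        (𝓝 0) := by
      refine tendsto_of_tendsto_of_tendsto_of_le_of_le tendsto_const_nhds ?_ (fun _ => zero_le) hθ
      have := ENNReal.tendsto_ofReal (tendsto_one_div_add_atTop_nhds_zero_nat (𝕜 := ℝ))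
      rwa [ENNReal.ofReal_zero] at this
    obtain ⟨ns, -, hns⟩ := (tendstoInMeasure_of_tendsto_eLpNorm one_ne_zero
      (fun n => (θ n).continuous.aestronglyMeasurable)
      ((aestronglyMeasurable_const (b := (1 : ℝ))).indicator hs) hlim).exists_seq_tendsto_ae
    have hconv : Tendsto (fun k => ∫ t, θ (ns k) t * ζ t (ofTest D p ψ) ∂volT T) atTop
        (𝓝 (∫ t, s.indicator (fun _ => (1 : ℝ)) t * ζ t (ofTest D p ψ) ∂volT T)) := by
      refine tendsto_integral_of_dominated_convergence (fun t => ‖ζ t (ofTest D p ψ)‖)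
        (fun k => (θ (ns k)).continuous.aestronglyMeasurable.mul hi.1) hi.norm
        (fun k => Eventually.of_forall fun t => ?_) ?_
      · rw [norm_mul]
        refine mul_le_of_le_one_left (norm_nonneg _) ?_
        rw [Real.norm_of_nonneg (hθ01 _ t).1]; exact (hθ01 _ t).2
      · filter_upwards [hns] with t ht using ht.mul_const _
    have hpos : ∀ k, 0 ≤ ∫ t, θ (ns k) t * ζ t (ofTest D p ψ) ∂volT T := fun k => by
      have := setIntegral_test_eq hp2 hη hμ (tensorTest (θ (ns k)) ψ)
      simp only [sliceTest_tensorTest, ofTest_smul, map_smul, smul_eq_mul] at this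
      rw [← this]
      exact integral_nonneg fun z => mul_nonneg (hθ01 _ _).1 (hψ _)
    have := ge_of_tendsto' hconv hpos
    rw [← integral_indicator hs]
    refine this.trans_eq (integral_congr_ae (Eventually.of_forall fun t => ?_))
    by_cases ht : t ∈ s <;> simp [ht]
  have := secondCountableTopology_W0 (D := D) hp
  set S : Set (W0 D p) := ofTest D p '' {ψ | ∀ x, 0 ≤ ψ x} with hS
  obtain ⟨c, hcS, hcc, hSc⟩ := (IsSeparable.of_separableSpace S).exists_countable_dense_subset
  have hall : ∀ᵐ t ∂volT T, ∀ y ∈ c, 0 ≤ ζ t y := by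
    refine (ae_ball_iff hcc).2 fun y hy => ?_
    obtain ⟨ψ, hψ, rfl⟩ := hcS hy
    exact step ψ hψ
  filter_upwards [hall] with t ht y hy
  have hcl : IsClosed {y : W0 D p | 0 ≤ ζ t y} :=
    isClosed_le continuous_const (ζ t).continuous
  have h1 : closure c ⊆ {y : W0 D p | 0 ≤ ζ t y} := closure_minimal ht hcl
  have h2 : closure S ⊆ closure c := closure_minimal hSc isClosed_closure
  exact h1 (h2 (mem_closure_of_nonneg q hp hy))

/-- Positivity of `ζ t` gives the comparison at each time separately. The majorant `y` may be chosen
for each `t` with no measurability in `t`, as only the bound `F` is integrated; this allows absolute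
values to be taken slice by slice. -/
theorem setIntegral_test_le (hp2 : 2 ≤ p) (hp : p ≠ ∞) (hη : IsGivenBy η ζ)
    (hμ : IsMeasureFunctional η μ) (χ : 𝓓(cyl D T, ℝ)) {F : ℝ → ℝ} (hF : Integrable F (volT T))
    (h : ∀ᵐ t ∂volT T, ∃ y : W0 D p, (∀ᵐ x ∂volD D, χ (t, x) ≤ val y x) ∧ ζ t y ≤ F t) :
    ∫ z in (cyl D T : Set (ℝ × Eu d)), χ z ∂μ ≤ ∫ t in Ioo 0 T, F t := by
  rw [setIntegral_test_eq hp2 hη hμ]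
  have : q.HolderConjugate p := ENNReal.HolderConjugate.symm
  refine integral_mono_ae (integrable_pairing (p := p) (q := q) (Lp.memLp ζ)
    (memLp_ofTest_slice χ p)) hF ?_
  filter_upwards [h, ae_nonneg_apply_of_nonneg hp2 hp hη hμ] with t ⟨y, h1, h2⟩ hpos
  refine le_trans ?_ h2
  rw [← sub_nonneg, ← map_sub]
  refine hpos _ ?_
  filter_upwards [val_sub y (ofTest D p (sliceTest χ t)), val_ofTest (p := p) (sliceTest χ t), h1]
    with x e1 e2 e3
  rw [e1, Pi.sub_apply, e2]
  exact sub_nonneg.2 e3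

/-- A cut-off equal to one on a compact subset of `O`, supported in `O` and with values in `[0, 1]`,
lies below the indicator of `O`, hence below `y`. -/
theorem measure_open_le (hp2 : 2 ≤ p) (hp : p ≠ ∞) (hη : IsGivenBy η ζ)
    (hμ : IsMeasureFunctional η μ)
    (hfin : ∀ K : Set (ℝ × Eu d), IsCompact K → K ⊆ cyl D T → μ K < ∞)
    {O : Set (ℝ × Eu d)} (hO : IsOpen O) (hOc : O ⊆ cyl D T) {F : ℝ → ℝ}
    (hF : Integrable F (volT T))
    (h : ∀ᵐ t ∂volT T, ∃ y : W0 D p,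
      (∀ᵐ x ∂volD D, O.indicator (fun _ => (1 : ℝ)) (t, x) ≤ val y x) ∧ ζ t y ≤ F t) :
    μ O ≤ ENNReal.ofReal (∫ t in Ioo 0 T, F t) := by
  refine isOpen_measure_le_of_isCompact hO fun K hK hKO => ?_
  obtain ⟨φ₀, h01, h1⟩ := exists_test_one_on ⟨O, hO⟩ hK hKO
  let φ : 𝓓(cyl D T, ℝ) := ⟨φ₀, φ₀.contDiff, φ₀.hasCompactSupport, φ₀.tsupport_subset.trans hOc⟩
  have hle : ∫ z in (cyl D T : Set (ℝ × Eu d)), φ z ∂μ ≤ ∫ t in Ioo 0 T, F t := by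
    refine setIntegral_test_le hp2 hp hη hμ φ hF ?_
    filter_upwards [h] with t ⟨y, hy1, hy2⟩
    refine ⟨y, ?_, hy2⟩
    filter_upwards [hy1] with x hx
    refine le_trans ?_ hx
    by_cases hm : (t, x) ∈ O
    · rw [indicator_of_mem hm]; exact (h01 _).2
    · rw [indicator_of_notMem hm]; exact (eq_zero_of_notMem (φ := φ₀) hm).le
  refine le_trans ?_ (ENNReal.ofReal_le_ofReal hle)
  rw [ofReal_integral_eq_lintegral_ofReal (integrable_test_cyl hfin φ)
    (Eventually.of_forall fun z => (h01 z).1)]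
  calc μ K = ∫⁻ _ in K, 1 ∂μ := by simp
    _ ≤ ∫⁻ z in K, ENNReal.ofReal (φ z) ∂μ := by
        refine setLIntegral_mono' hK.measurableSet fun z hz => ?_
        rw [show φ z = 1 from h1 z hz]; simp
    _ ≤ _ := lintegral_mono_set (hKO.trans hOc)

end measureFunctional

/-! ### Hölder's inequality for the duality pairing in time -/

section dualPairing

variable {V : Type*} [NormedAddCommGroup V] [NormedSpace ℝ V] {α : Type*} [MeasurableSpace α]
  {μ : Measure α} {p q : ℝ≥0∞} [p.HolderConjugate q]

theorem integrable_norm_mul_norm (ζ : Lp (StrongDual ℝ V) q μ) (v : Lp V p μ) :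
    Integrable (fun t => ‖ζ t‖ * ‖v t‖) μ := by
  have : q.HolderConjugate p := ENNReal.HolderConjugate.symm
  exact (Lp.memLp ζ).norm.integrable_mul (Lp.memLp v).norm

theorem integral_norm_mul_norm_le (ζ : Lp (StrongDual ℝ V) q μ) (v : Lp V p μ) :
    ∫ t, ‖ζ t‖ * ‖v t‖ ∂μ ≤ ‖ζ‖ * ‖v‖ := by
  have : q.HolderConjugate p := ENNReal.HolderConjugate.symm
  -- Viewing the number `‖ζ t‖` as a functional on `ℝ` reduces the scalar inequality to the estimate
  -- for pairings.
  let f : α → StrongDual ℝ ℝ := fun t => ‖ζ t‖ • ContinuousLinearMap.id ℝ ℝ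
  have hfn : ∀ t, ‖f t‖ = ‖ζ t‖ := fun t => by simp [f, norm_smul]
  have hfm : AEStronglyMeasurable f μ := (Lp.memLp ζ).1.norm.smul_const _
  have hf : MemLp f q μ :=
    (Lp.memLp ζ).of_le hfm (Eventually.of_forall fun t => (hfn t).le)
  have hfe : eLpNorm f q μ = eLpNorm ζ q μ :=
    eLpNorm_congr_norm_ae (Eventually.of_forall hfn)
  have h := norm_setIntegral_pairing_le (p := p) (q := q) hf (Lp.memLp v).norm univ
  rw [Measure.restrict_univ, hfe, eLpNorm_norm, ← Lp.norm_def, ← Lp.norm_def] at h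
  exact (le_abs_self _).trans h

theorem integrable_apply (ζ : Lp (StrongDual ℝ V) q μ) (v : Lp V p μ) :
    Integrable (fun t => ζ t (v t)) μ := by
  have : q.HolderConjugate p := ENNReal.HolderConjugate.symm
  exact integrable_pairing (Lp.memLp ζ) (Lp.memLp v)

theorem tendsto_integral_apply [Fact (1 ≤ p)] (ζ : Lp (StrongDual ℝ V) q μ)
    {v : ℕ → Lp V p μ} {u : Lp V p μ}
    (hv : Tendsto v atTop (𝓝 u)) :
    Tendsto (fun n => ∫ t, ζ t (v n t) ∂μ) atTop (𝓝 (∫ t, ζ t (u t) ∂μ)) := by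
  rw [tendsto_iff_norm_sub_tendsto_zero] at hv ⊢
  have h0 : Tendsto (fun n => ‖ζ‖ * ‖v n - u‖) atTop (𝓝 0) := by
    simpa using hv.const_mul ‖ζ‖
  refine squeeze_zero (fun _ => norm_nonneg _) (fun n => ?_) h0
  rw [← integral_sub (integrable_apply ζ (v n)) (integrable_apply ζ u)]
  refine (norm_integral_le_of_norm_le (integrable_norm_mul_norm ζ (v n - u)) ?_).trans
    (integral_norm_mul_norm_le ζ (v n - u))
  filter_upwards [Lp.coeFn_sub (v n) u] with t ht
  rw [ht, ← map_sub]
  exact (ζ t).le_opNorm _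

end dualPairing

/-! ### Capacity estimates for the measure and the minimality condition -/

section capacityNull

variable {D : Opens (Eu d)} {p q : ℝ≥0∞} [Fact (1 ≤ p)] [Fact (1 ≤ q)] [p.HolderConjugate q]
  {T : ℝ} {η : StrongDual ℝ (SpaceW D p q T)} {ζ : LqDual D p q T} {μ : Measure (ℝ × Eu d)}

theorem exists_open_of_cap_lt {B : Set (ℝ × Eu d)} {ε : ℝ≥0∞} (h : cap D p q T B < ε) :
    ∃ U : Set (ℝ × Eu d), IsOpen U ∧ U ⊆ cyl D T ∧ B ⊆ U ∧ ∃ v : SpaceW D p q T,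
      (∀ᵐ t ∂volT T, ∀ᵐ x ∂volD D, U.indicator (fun _ => (1 : ℝ)) (t, x) ≤ val (v.fn t) x) ∧
      ‖v‖ₑ < ε := by
  simp only [cap, capOpen, iInf_lt_iff] at h
  obtain ⟨U, ⟨h1, h2, h3⟩, v, hv, hvε⟩ := h
  exact ⟨U, h1, h2, h3, v, hv, hvε⟩

theorem norm_lt_of_enorm_lt_ofReal {E : Type*} [SeminormedAddCommGroup E] {v : E} {ε : ℝ}
    (h : ‖v‖ₑ < ENNReal.ofReal ε) : ‖v‖ < ε := by
  rw [← ofReal_norm] at h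
  exact (ENNReal.ofReal_lt_ofReal_iff_of_nonneg (norm_nonneg _)).1 h

theorem apply_le_norm_mul_norm {V : Type*} [NormedAddCommGroup V] [NormedSpace ℝ V]
    (ζ : StrongDual ℝ V) (v : V) : ζ v ≤ ‖ζ‖ * ‖v‖ :=
  (le_abs_self _).trans (ζ.le_opNorm v)

variable [IsFiniteMeasure (volD D)]

/-- A competitor `v ≥ 1_U` gives `μ U ≤ ∫ ‖ζ‖ ‖v‖ ≤ ‖ζ‖ ‖v‖_𝒲`; the part of the `𝒲` norm without the
time derivative is enough. -/
theorem measure_le_of_cap_lt (hp2 : 2 ≤ p) (hp : p ≠ ∞) (hη : IsGivenBy η ζ)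
    (hμ : IsMeasureFunctional η μ)
    (hfin : ∀ K : Set (ℝ × Eu d), IsCompact K → K ⊆ cyl D T → μ K < ∞)
    {B : Set (ℝ × Eu d)} {ε : ℝ} (h : cap D p q T B < ENNReal.ofReal ε) :
    μ B ≤ ENNReal.ofReal (‖ζ‖ * ε) := by
  obtain ⟨U, hU, hUc, hBU, v, hv, hvε⟩ := exists_open_of_cap_lt h
  refine (measure_mono hBU).trans ?_
  refine (measure_open_le hp2 hp hη hμ hfin hU hUc (integrable_norm_mul_norm ζ v.fn) ?_).trans ?_
  · filter_upwards [hv] with t ht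
    exact ⟨v.fn t, ht, apply_le_norm_mul_norm _ _⟩
  · refine ENNReal.ofReal_le_ofReal ((integral_norm_mul_norm_le ζ v.fn).trans ?_)
    exact mul_le_mul_of_nonneg_left
      ((norm_fn_le v).trans (norm_lt_of_enorm_lt_ofReal hvε).le) (norm_nonneg _)

theorem measure_eq_zero_of_cap_eq_zero (hp2 : 2 ≤ p) (hp : p ≠ ∞) (hη : IsGivenBy η ζ)
    (hμ : IsMeasureFunctional η μ)
    (hfin : ∀ K : Set (ℝ × Eu d), IsCompact K → K ⊆ cyl D T → μ K < ∞)
    {B : Set (ℝ × Eu d)} (h : cap D p q T B = 0) : μ B = 0 := by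
  have h1 : ∀ n : ℕ, μ B ≤ ENNReal.ofReal (‖ζ‖ * (1 / ((n : ℝ) + 1))) := fun n =>
    measure_le_of_cap_lt hp2 hp hη hμ hfin (by rw [h, ENNReal.ofReal_pos]; positivity)
  have h2 : Tendsto (fun n : ℕ => ENNReal.ofReal (‖ζ‖ * (1 / ((n : ℝ) + 1)))) atTop (𝓝 0) := by
    have := ENNReal.tendsto_ofReal
      ((tendsto_one_div_add_atTop_nhds_zero_nat (𝕜 := ℝ)).const_mul ‖ζ‖)
    rwa [mul_zero, ENNReal.ofReal_zero] at this
  exact le_antisymm (ge_of_tendsto' h2 h1) zero_le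

/-- A Chebyshev inequality with respect to `μ`. The set `|g - φ| > c` need not be open, but it
becomes so after adding an open set `U` of small capacity off which `g` is continuous. At a.e. time
the indicator of the enlarged set is at most `y + c⁻¹ |v - w|`, with `y` a competitor for the
capacity of `U`; and `|v - w|` has no larger norm than `v - w`. -/
theorem measure_dev_le_add (hp2 : 2 ≤ p) (hp : p ≠ ∞) (hη : IsGivenBy η ζ)
    (hμ : IsMeasureFunctional η μ)
    (hfin : ∀ K : Set (ℝ × Eu d), IsCompact K → K ⊆ cyl D T → μ K < ∞)
    {g : ℝ × Eu d → ℝ} {v w : LpW0 D p T} {φ : 𝓓(cyl D T, ℝ)} (hg : QuasiContinuous D p q T g)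
    (hv : IsRepr v g) (hw : ∀ᵐ t ∂volT T, w t = ofTest D p (sliceTest φ t)) {c ε : ℝ}
    (hc : 0 < c) (hε : 0 < ε) :
    μ {z | z ∈ cyl D T ∧ c < |g z - φ z|} ≤ ENNReal.ofReal (‖ζ‖ * ε + c⁻¹ * (‖ζ‖ * ‖v - w‖)) := by
  -- Halving `ε` gives the strict inequality needed to pick a competitor with norm below `ε`. It
  -- belongs to a possibly larger open set `U`.
  obtain ⟨U₀, hU₀, hU₀c, hcap, hcont₀⟩ := hg (ENNReal.ofReal (ε / 2)) (by simpa using hε)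
  obtain ⟨U, hU, hUc, hUU, y, hy, hyε⟩ := exists_open_of_cap_lt
    (hcap.trans_lt ((ENNReal.ofReal_lt_ofReal_iff hε).2 (half_lt_self hε)))
  have hcont : ContinuousOn (fun z => |g z - φ z|) ((cyl D T : Set (ℝ × Eu d)) \ U) :=
    ((hcont₀.mono (sdiff_subset_sdiff_right hUU)).sub φ.continuous.continuousOn).abs
  obtain ⟨V, hV, hVeq⟩ := continuousOn_iff'.1 hcont _ (isOpen_Ioi (a := c))
  have hVmem : ∀ z, z ∈ cyl D T → z ∉ U → (z ∈ V ↔ c < |g z - φ z|) := fun z h1 h2 =>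
    ⟨fun h => ((Set.ext_iff.1 hVeq z).2 ⟨h, h1, h2⟩).1,
      fun h => ((Set.ext_iff.1 hVeq z).1 ⟨h, h1, h2⟩).1⟩
  set O : Set (ℝ × Eu d) := U ∪ (V ∩ cyl D T) with hO
  have hOo : IsOpen O := hU.union (hV.inter (cyl D T).isOpen)
  have hOc : O ⊆ cyl D T := union_subset hUc inter_subset_right
  have hsub : {z | z ∈ cyl D T ∧ c < |g z - φ z|} ⊆ O := fun z ⟨h1, h2⟩ => by
    by_cases hz : z ∈ U
    · exact Or.inl hz
    · exact Or.inr ⟨(hVmem z h1 hz).2 h2, h1⟩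
  refine (measure_mono hsub).trans ?_
  have hi1 := integrable_norm_mul_norm ζ y.fn
  have hi2 := (integrable_norm_mul_norm ζ (v - w)).const_mul c⁻¹
  refine (measure_open_le hp2 hp hη hμ hfin hOo hOc (hi1.add hi2) ?_).trans ?_
  · filter_upwards [hy, hv, hw, Lp.coeFn_sub v w] with t h1 h2 h3 h4
    obtain ⟨b, -, hb, hbn⟩ := exists_abs hp ((v - w) t)
    refine ⟨y.fn t + c⁻¹ • b, ?_, ?_⟩
    · have h5 := val_sub (v t) (w t)
      rw [← Pi.sub_apply, ← h4] at h5
      filter_upwards [h1, h2, hb, h5, val_add (y.fn t) (c⁻¹ • b), val_smul c⁻¹ b,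
        val_ofTest (p := p) (sliceTest φ t)] with x e1 e2 e3 e4 e5 e6 e7
      rw [e5, Pi.add_apply, e6, Pi.smul_apply, e3, e4, Pi.sub_apply, e2, h3, e7, smul_eq_mul,
        sliceTest_apply]
      have hpos : 0 ≤ c⁻¹ * |g (t, x) - φ (t, x)| := by positivity
      by_cases hz : (t, x) ∈ U
      · rw [indicator_of_mem hz] at e1
        rw [indicator_of_mem (show (t, x) ∈ O from Or.inl hz)]
        linarith
      · rw [indicator_of_notMem hz] at e1
        by_cases hz' : (t, x) ∈ O
        · rw [indicator_of_mem hz']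
          have hzV := hz'.resolve_left hz
          have := (hVmem _ hzV.2 hz).1 hzV.1
          have : 1 ≤ c⁻¹ * |g (t, x) - φ (t, x)| := by
            rw [inv_mul_eq_div, one_le_div hc]; exact this.le
          linarith
        · rw [indicator_of_notMem hz']
          linarith
    · rw [map_add, map_smul, smul_eq_mul]
      refine add_le_add (apply_le_norm_mul_norm _ _) ?_
      refine mul_le_mul_of_nonneg_left ((apply_le_norm_mul_norm _ _).trans ?_) (inv_pos.2 hc).le
      exact mul_le_mul_of_nonneg_left hbn (norm_nonneg _)
  · refine ENNReal.ofReal_le_ofReal ?_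
    have e : ∫ t in Ioo 0 T, ((fun t => ‖ζ t‖ * ‖y.fn t‖) + fun t => c⁻¹ * (‖ζ t‖ * ‖(v - w) t‖)) t
        = (∫ t in Ioo 0 T, ‖ζ t‖ * ‖y.fn t‖) + c⁻¹ * ∫ t in Ioo 0 T, ‖ζ t‖ * ‖(v - w) t‖ := by
      rw [← integral_const_mul]
      exact integral_add hi1 hi2
    rw [e]
    refine add_le_add ((integral_norm_mul_norm_le ζ y.fn).trans ?_)
      (mul_le_mul_of_nonneg_left (integral_norm_mul_norm_le ζ (v - w)) (inv_pos.2 hc).le)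
    exact mul_le_mul_of_nonneg_left
      ((norm_fn_le y).trans (norm_lt_of_enorm_lt_ofReal hyε).le) (norm_nonneg _)

theorem measure_dev_le (hp2 : 2 ≤ p) (hp : p ≠ ∞) (hη : IsGivenBy η ζ)
    (hμ : IsMeasureFunctional η μ)
    (hfin : ∀ K : Set (ℝ × Eu d), IsCompact K → K ⊆ cyl D T → μ K < ∞)
    {g : ℝ × Eu d → ℝ} {v w : LpW0 D p T} {φ : 𝓓(cyl D T, ℝ)} (hg : QuasiContinuous D p q T g)
    (hv : IsRepr v g) (hw : ∀ᵐ t ∂volT T, w t = ofTest D p (sliceTest φ t)) {c : ℝ}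
    (hc : 0 < c) :
    μ {z | z ∈ cyl D T ∧ c < |g z - φ z|} ≤ ENNReal.ofReal (c⁻¹ * (‖ζ‖ * ‖v - w‖)) := by
  have h1 : ∀ n : ℕ, μ {z | z ∈ cyl D T ∧ c < |g z - φ z|} ≤
      ENNReal.ofReal (‖ζ‖ * (1 / ((n : ℝ) + 1)) + c⁻¹ * (‖ζ‖ * ‖v - w‖)) := fun n =>
    measure_dev_le_add hp2 hp hη hμ hfin hg hv hw hc (by positivity)
  have h2 := ENNReal.tendsto_ofReal
    (((tendsto_one_div_add_atTop_nhds_zero_nat (𝕜 := ℝ)).const_mul ‖ζ‖).add_const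
      (c⁻¹ * (‖ζ‖ * ‖v - w‖)))
  rw [mul_zero, zero_add] at h2
  exact ge_of_tendsto' h2 h1

/-- Since `|φ|` is not a test function, the comparison is made for its smooth approximations, which
lie below it, and dominated convergence gives the limit. This makes a sequence of test functions
that converges in `L^p(0,T; W_0^{1,p}(D))` Cauchy in `L¹(μ)`. -/
theorem setIntegral_abs_test_le (hp2 : 2 ≤ p) (hp : p ≠ ∞) (hη : IsGivenBy η ζ)
    (hμ : IsMeasureFunctional η μ)
    (hfin : ∀ K : Set (ℝ × Eu d), IsCompact K → K ⊆ cyl D T → μ K < ∞)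
    {w : LpW0 D p T} {φ : 𝓓(cyl D T, ℝ)}
    (hw : ∀ᵐ t ∂volT T, w t = ofTest D p (sliceTest φ t)) :
    ∫ z in (cyl D T : Set (ℝ × Eu d)), |φ z| ∂μ ≤ ‖ζ‖ * ‖w‖ := by
  set δ : ℕ → ℝ := fun n => 1 / ((n : ℝ) + 1) with hδd
  have hδ : ∀ n, 0 < δ n := fun n => by positivity
  have hδ0 : Tendsto δ atTop (𝓝 0) := tendsto_one_div_add_atTop_nhds_zero_nat
  have hφ := integrable_test_cyl hfin φ
  have hlim : Tendsto (fun n => ∫ z in (cyl D T : Set (ℝ × Eu d)), smoothAbs (δ n) (φ z) ∂μ) atTop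
      (𝓝 (∫ z in (cyl D T : Set (ℝ × Eu d)), |φ z| ∂μ)) := by
    refine tendsto_integral_of_dominated_convergence (fun z => ‖φ z‖) (fun n =>
      ((contDiff_smoothAbs (hδ n)).continuous.comp φ.continuous).aestronglyMeasurable) hφ.norm
      (fun n => Eventually.of_forall fun z => ?_)
      (Eventually.of_forall fun z => tendsto_smoothAbs _ hδ hδ0)
    rw [Real.norm_of_nonneg (smoothAbs_nonneg _ _)]
    exact smoothAbs_le_abs (hδ n) _
  refine le_of_tendsto' hlim fun n => ?_
  refine le_trans ?_ (integral_norm_mul_norm_le ζ w)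
  refine setIntegral_test_le hp2 hp hη hμ
    (compTest (smoothAbs (δ n)) (contDiff_smoothAbs (hδ n)) (smoothAbs_zero (hδ n)) φ)
    (integrable_norm_mul_norm ζ w) ?_
  filter_upwards [hw] with t ht
  obtain ⟨b, -, hb, hbn⟩ := exists_abs hp (w t)
  refine ⟨b, ?_, (apply_le_norm_mul_norm _ _).trans
    (mul_le_mul_of_nonneg_left hbn (norm_nonneg _))⟩
  filter_upwards [hb, val_ofTest (p := p) (sliceTest φ t)] with x e1 e2
  rw [e1, ht, e2, compTest_apply, sliceTest_apply]
  exact smoothAbs_le_abs (hδ n) _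

/-- The integral of a quasi everywhere defined representative of `u` against the measure is the
duality pairing with `u`. -/
theorem setIntegral_qeRepr_eq (hp2 : 2 ≤ p) (hp : p ≠ ∞) (hη : IsGivenBy η ζ)
    (hμ : IsMeasureFunctional η μ)
    (hfin : ∀ K : Set (ℝ × Eu d), IsCompact K → K ⊆ cyl D T → μ K < ∞)
    {u : LpW0 D p T} {g : ℝ × Eu d → ℝ} (hg : IsQERepr q u g) (hgi : IntegrableOn g (cyl D T) μ) :
    ∫ z in (cyl D T : Set (ℝ × Eu d)), g z ∂μ = ∫ t in Ioo 0 T, ζ t (u t) := by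
  obtain ⟨-, gn, vn, hgn, hvn, hqe⟩ := hg
  -- With error `4⁻ⁿ`, Chebyshev at level `2⁻ⁿ` leaves an exceptional set of measure at most `‖ζ‖
  -- 2⁻ⁿ`, which is summable.
  choose φ w hw hwn using fun n : ℕ =>
    exists_test_norm_sub_le (q := q) hp2 hp (vn n) (ε := (1 / 4 : ℝ) ^ n) (by positivity)
  have hwu : Tendsto (fun n => (w n).fn) atTop (𝓝 u) := by
    have h0 : Tendsto (fun n => vn n - (w n).fn) atTop (𝓝 0) :=
      squeeze_zero_norm hwn (tendsto_pow_atTop_nhds_zero_of_lt_one (by norm_num) (by norm_num))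
    simpa using hvn.sub h0
  -- Borel-Cantelli gives `gn n - φ n → 0` a.e. for `μ`, and `gn n → g` off a set of capacity zero,
  -- which is `μ`-null.
  have hae : ∀ᵐ z ∂μ.restrict (cyl D T : Set (ℝ × Eu d)),
      Tendsto (fun n => φ n z) atTop (𝓝 (g z)) := by
    set A : ℕ → Set (ℝ × Eu d) := fun n => {z | z ∈ cyl D T ∧ (1 / 2 : ℝ) ^ n < |gn n z - φ n z|}
    have hA : ∀ n, μ (A n) ≤ ENNReal.ofReal (‖ζ‖ * (1 / 2 : ℝ) ^ n) := fun n => by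
      refine (measure_dev_le hp2 hp hη hμ hfin (hgn n).1 (hgn n).2 (hw n) (by positivity)).trans
        (ENNReal.ofReal_le_ofReal ?_)
      calc ((1 / 2 : ℝ) ^ n)⁻¹ * (‖ζ‖ * ‖vn n - (w n).fn‖)
          ≤ ((1 / 2 : ℝ) ^ n)⁻¹ * (‖ζ‖ * (1 / 4 : ℝ) ^ n) := by gcongr; exact hwn n
        _ = ‖ζ‖ * (((1 / 2 : ℝ) ^ n)⁻¹ * (1 / 4 : ℝ) ^ n) := by ring
        _ = ‖ζ‖ * (1 / 2 : ℝ) ^ n := by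
            rw [← inv_pow, ← mul_pow]; norm_num
    have hsum : Summable fun n : ℕ => ‖ζ‖ * (1 / 2 : ℝ) ^ n :=
      (summable_geometric_of_lt_one (by norm_num) (by norm_num)).mul_left _
    have hAfin : ∑' n, μ (A n) ≠ ∞ := by
      refine ne_top_of_le_ne_top ?_ (ENNReal.tsum_le_tsum hA)
      rw [← ENNReal.ofReal_tsum_of_nonneg (fun n => by positivity) hsum]
      exact ENNReal.ofReal_ne_top
    have hev := ae_restrict_of_ae (s := (cyl D T : Set (ℝ × Eu d))) (ae_eventually_notMem hAfin)
    have hnull := measure_eq_zero_of_cap_eq_zero hp2 hp hη hμ hfin hqe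
    have hev2 := ae_restrict_of_ae (s := (cyl D T : Set (ℝ × Eu d)))
      (measure_eq_zero_iff_ae_notMem.1 hnull)
    filter_upwards [hev, hev2, ae_restrict_mem (cyl D T).isOpen.measurableSet] with z h1 h2 h3
    have h4 : Tendsto (fun n => gn n z) atTop (𝓝 (g z)) := by
      by_contra hcon
      exact h2 ⟨h3, hcon⟩
    have h5 : Tendsto (fun n => gn n z - φ n z) atTop (𝓝 0) := by
      refine squeeze_zero_norm' ?_
        (tendsto_pow_atTop_nhds_zero_of_lt_one (r := (1 / 2 : ℝ)) (by norm_num) (by norm_num))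
      filter_upwards [h1] with n hn
      by_contra hcon
      exact hn ⟨h3, not_le.1 hcon⟩
    simpa using h4.sub h5
  have hφi := fun n => integrable_test_cyl hfin (φ n)
  -- By Fatou, the `L¹(μ)` distance of `φ m` to `g` is at most the lower limit in `n` of its
  -- distance to `φ n`, hence at most `‖ζ‖ ‖w m - u‖`.
  have hL1 : Tendsto (fun m => ∫⁻ z in (cyl D T : Set (ℝ × Eu d)), ‖φ m z - g z‖ₑ ∂μ) atTop
      (𝓝 0) := by
    have hb : ∀ m, ∫⁻ z in (cyl D T : Set (ℝ × Eu d)), ‖φ m z - g z‖ₑ ∂μ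
        ≤ ENNReal.ofReal (‖ζ‖ * ‖(w m).fn - u‖) := fun m => by
      have h1 := Lp.eLpNorm_lim_le_liminf_eLpNorm (p := 1)
        (μ := μ.restrict (cyl D T : Set (ℝ × Eu d))) (f := fun n z => φ m z - φ n z)
        (fun n => ((φ m).continuous.sub (φ n).continuous).aestronglyMeasurable)
        (fun z => φ m z - g z) (by filter_upwards [hae] with z hz using hz.const_sub _)
      rw [eLpNorm_one_eq_lintegral_enorm] at h1
      refine h1.trans ?_
      have hlim : Tendsto (fun n => ENNReal.ofReal (‖ζ‖ * ‖(w m).fn - (w n).fn‖)) atTop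
          (𝓝 (ENNReal.ofReal (‖ζ‖ * ‖(w m).fn - u‖))) :=
        ENNReal.tendsto_ofReal ((hwu.const_sub _).norm.const_mul _)
      rw [← hlim.liminf_eq]
      refine liminf_le_liminf (Eventually.of_forall fun n => ?_)
      have hd : ∀ᵐ t ∂volT T, ((w m).fn - (w n).fn) t = ofTest D p (sliceTest (φ m - φ n) t) := by
        filter_upwards [hw m, hw n, Lp.coeFn_sub (w m).fn (w n).fn] with t e1 e2 e3
        rw [e3, Pi.sub_apply, e1, e2, ← ofTest_sub]
        rfl
      have h2 := setIntegral_abs_test_le hp2 hp hη hμ hfin hd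
      rw [eLpNorm_one_eq_lintegral_enorm]
      refine le_trans (le_of_eq ?_) (ENNReal.ofReal_le_ofReal h2)
      rw [ofReal_integral_eq_lintegral_ofReal (integrable_test_cyl hfin (φ m - φ n)).abs
        (Eventually.of_forall fun z => abs_nonneg _)]
      refine lintegral_congr fun z => ?_
      rw [← ofReal_norm]
      rfl
    refine tendsto_of_tendsto_of_tendsto_of_le_of_le tendsto_const_nhds ?_ (fun _ => zero_le) hb
    have := ENNReal.tendsto_ofReal ((hwu.sub_const u).norm.const_mul ‖ζ‖)
    rwa [sub_self, norm_zero, mul_zero, ENNReal.ofReal_zero] at this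
  have h1 : Tendsto (fun m => ∫ z in (cyl D T : Set (ℝ × Eu d)), φ m z ∂μ) atTop
      (𝓝 (∫ z in (cyl D T : Set (ℝ × Eu d)), g z ∂μ)) :=
    tendsto_integral_of_L1 g hgi.1 (Eventually.of_forall hφi) hL1
  have h2 := tendsto_integral_apply ζ hwu
  refine tendsto_nhds_unique h1 (h2.congr fun m => ?_)
  rw [setIntegral_test_eq hp2 hη hμ]
  refine integral_congr_ae ?_
  filter_upwards [hw m] with t ht
  rw [ht]

/-- A reflection which lies in `L^q(0,T; W^{-1,q}(D))` and satisfies the minimality condition is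
given by a nonnegative functional which vanishes on the solution at almost every time. -/
theorem exists_nonneg_vanishing (hp2 : 2 ≤ p) (hp : p ≠ ∞) (hη : ∃ ζ : LqDual D p q T, IsGivenBy η ζ)
    (hμ : IsMeasureFunctional η μ)
    (hfin : ∀ K : Set (ℝ × Eu d), IsCompact K → K ⊆ cyl D T → μ K < ∞)
    {u : LpW0 D p T} (hu : ∀ᵐ t ∂volT T, ∀ᵐ x ∂volD D, 0 ≤ val (u t) x)
    (hmin : MinimalityCondition u η μ) :
    ∃ ζ : LqDual D p q T, IsGivenBy η ζ ∧
      (∀ᵐ t ∂volT T, ∀ y : W0 D p, (∀ᵐ x ∂volD D, 0 ≤ val y x) → 0 ≤ ζ t y) ∧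
      ∀ᵐ t ∂volT T, ζ t (u t) = 0 := by
  -- The second alternative of the minimality condition brings its own `ζ`; in the first it comes
  -- from the hypothesis on `η`.
  obtain ⟨ζ, hζ, h0⟩ : ∃ ζ : LqDual D p q T, IsGivenBy η ζ ∧ ∫ t in Ioo 0 T, ζ t (u t) = 0 := by
    rcases hmin with ⟨g, hg, -, hgi, hg0⟩ | h
    · obtain ⟨ζ, hζ⟩ := hη
      exact ⟨ζ, hζ, by rw [← setIntegral_qeRepr_eq hp2 hp hζ hμ hfin hg hgi, hg0]⟩
    · exact h
  have hpos := ae_nonneg_apply_of_nonneg hp2 hp hζ hμ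
  refine ⟨ζ, hζ, hpos, ?_⟩
  have hu0 : 0 ≤ᵐ[volT T] fun t => ζ t (u t) := by
    filter_upwards [hpos, hu] with t h1 h2 using h1 _ h2
  exact (integral_eq_zero_iff_of_nonneg_ae hu0 (integrable_apply ζ u)).1 h0

end capacityNull

/-! ### Superposition operators from `L^p` to `L^q` -/

section superposition

variable {α E F : Type*} [MeasurableSpace α] {μ : Measure α} [NormedAddCommGroup E]
  [NormedAddCommGroup F] {b : α → E → F}

/-- The Carathéodory argument: the composition is measurable for simple functions, which take
finitely many values, and continuity in the second variable passes to their limits. -/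
theorem aestronglyMeasurable_superposition (hm : ∀ ξ, AEStronglyMeasurable (fun x => b x ξ) μ)
    (hc : ∀ᵐ x ∂μ, Continuous (b x)) {f : α → E} (hf : AEStronglyMeasurable f μ) :
    AEStronglyMeasurable (fun x => b x (f x)) μ := by
  have hs : ∀ s : SimpleFunc α E, AEStronglyMeasurable (fun x => b x (s x)) μ := fun s => by
    have h : (fun x => b x (s x)) =
        fun x => ∑ c ∈ s.range, (s ⁻¹' {c}).indicator (fun x => b x c) x := by
      funext x
      rw [Finset.sum_eq_single (s x)]
      · rw [indicator_of_mem (by simp)]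
      · intro c _ hcx
        exact indicator_of_notMem (fun h => hcx (by simpa using h.symm)) _
      · intro h
        exact absurd (s.mem_range_self x) h
    rw [h]
    exact Finset.aestronglyMeasurable_fun_sum _ fun c _ => (hm c).indicator (s.measurableSet_fiber c)
  have hf' := hf.stronglyMeasurable_mk
  refine aestronglyMeasurable_of_tendsto_ae atTop (fun n => hs (hf'.approx n)) ?_
  filter_upwards [hc, hf.ae_eq_mk] with x h1 h2
  rw [h2]
  exact (h1.tendsto _).comp (hf'.tendsto_approx x)

variable {p q : ℝ≥0∞} [p.HolderConjugate q]

theorem div_sub_one_eq (hp1 : 1 < p) (hp : p ≠ ∞) : p / (p - 1) = q := by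
  have h := ENNReal.HolderConjugate.sub_one_mul_inv p q hp
  rw [← inv_inv q, ← h, ENNReal.mul_inv (Or.inl (tsub_pos_of_lt hp1).ne')
    (Or.inl (ne_top_of_le_ne_top hp tsub_le_self)), inv_inv, mul_comm, div_eq_mul_inv]

theorem toReal_sub_one_eq (hp1 : 1 < p) (hp : p ≠ ∞) : (p - 1).toReal = p.toReal - 1 := by
  rw [ENNReal.toReal_sub_of_le hp1.le hp, ENNReal.toReal_one]

theorem memLp_norm_rpow_sub_one (hp1 : 1 < p) (hp : p ≠ ∞) {f : α → E} (hf : MemLp f p μ) :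
    MemLp (fun x => ‖f x‖ ^ (p.toReal - 1)) q μ := by
  have := hf.norm_rpow_div (p - 1)
  rwa [div_sub_one_eq (q := q) hp1 hp, toReal_sub_one_eq hp1 hp] at this

variable {C : ℝ} {g : α → ℝ}

theorem memLp_superposition (hp1 : 1 < p) (hp : p ≠ ∞)
    (hm : ∀ ξ, AEStronglyMeasurable (fun x => b x ξ) μ)
    (hc : ∀ᵐ x ∂μ, Continuous (b x)) (hg : MemLp g q μ)
    (hb : ∀ᵐ x ∂μ, ∀ ξ, ‖b x ξ‖ ≤ C * ‖ξ‖ ^ (p.toReal - 1) + g x) {f : α → E}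
    (hf : MemLp f p μ) : MemLp (fun x => b x (f x)) q μ := by
  refine MemLp.of_le (((memLp_norm_rpow_sub_one hp1 hp hf).const_mul C).add hg)
    (aestronglyMeasurable_superposition hm hc hf.1) ?_
  filter_upwards [hb] with x hx
  exact (hx _).trans (le_abs_self _)

variable [Fact (1 ≤ p)] [Fact (1 ≤ q)]

omit [p.HolderConjugate q] [Fact (1 ≤ q)] in
/-- A summable sequence in `L^p` is dominated by an `L^p` function. -/
theorem exists_dominating_of_summable {f : ℕ → Lp E p μ} (hf : Summable fun n => ‖f n‖) :
    ∃ S : Lp ℝ p μ, ∀ n, ∀ᵐ x ∂μ, ‖f n x‖ ≤ S x := by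
  let N : ℕ → Lp ℝ p μ := fun n => (Lp.memLp (f n)).norm.toLp _
  have hN : ∀ n, N n =ᵐ[μ] fun x => ‖f n x‖ := fun n => MemLp.coeFn_toLp _
  have hNn : ∀ n, ‖N n‖ ≤ ‖f n‖ := fun n => by
    rw [Lp.norm_toLp, eLpNorm_norm, ← Lp.norm_def]
  have hN0 : ∀ n, 0 ≤ N n := fun n => by
    rw [← Lp.coeFn_nonneg]
    filter_upwards [hN n] with x hx
    rw [hx]
    exact norm_nonneg _
  obtain ⟨S, hS⟩ := Summable.of_norm_bounded hf hNn
  refine ⟨S, fun n => ?_⟩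
  filter_upwards [(Lp.coeFn_le _ _).2 (le_hasSum hS n fun j _ => hN0 j), hN n] with x e1 e2
  rwa [e2] at e1

omit [p.HolderConjugate q] [Fact (1 ≤ q)] in
/-- A sequence converging in `L^p` has a dominated, almost everywhere convergent subsequence. -/
theorem exists_dominated_subseq {f : ℕ → Lp E p μ} {f' : Lp E p μ}
    (hf : Tendsto f atTop (𝓝 f')) :
    ∃ (ns : ℕ → ℕ) (K : α → ℝ), MemLp K p μ ∧ (∀ n, ∀ᵐ x ∂μ, ‖f (ns n) x‖ ≤ K x) ∧
      (∀ᵐ x ∂μ, ‖f' x‖ ≤ K x) ∧ ∀ᵐ x ∂μ, Tendsto (fun n => f (ns n) x) atTop (𝓝 (f' x)) := by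
  have h1 : ∀ n : ℕ, ∀ᶠ k in atTop, ‖f k - f'‖ ≤ (1 / 2 : ℝ) ^ n := fun n => by
    have := (tendsto_iff_norm_sub_tendsto_zero.1 hf).eventually
      (eventually_lt_nhds (b := (1 / 2 : ℝ) ^ n) (by positivity))
    exact this.mono fun k hk => hk.le
  obtain ⟨ks, hks, hk⟩ := extraction_forall_of_eventually h1
  obtain ⟨ms, hms, hm⟩ := (tendstoInMeasure_of_tendsto_Lp
    (hf.comp hks.tendsto_atTop)).exists_seq_tendsto_ae
  obtain ⟨S, hS⟩ := exists_dominating_of_summable (f := fun n => f (ks n) - f')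
    (Summable.of_nonneg_of_le (fun n => norm_nonneg _) hk
      (summable_geometric_of_lt_one (by norm_num) (by norm_num)))
  refine ⟨ks ∘ ms, fun x => S x + ‖f' x‖, (Lp.memLp S).add (Lp.memLp f').norm, fun n => ?_, ?_, hm⟩
  · filter_upwards [hS (ms n), Lp.coeFn_sub (f (ks (ms n))) f'] with x e1 e3
    rw [e3, Pi.sub_apply] at e1
    have := norm_le_norm_sub_add (f (ks (ms n)) x) (f' x)
    exact this.trans (by gcongr)
  · filter_upwards [hS 0] with x e1
    have := (norm_nonneg _).trans e1
    linarith

/-- Every convergent sequence in `L^p` has a subsequence that converges a.e. under an `L^p`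
majorant. The growth bound turns it into an `L^q` majorant because `(p - 1) q = p`, and dominated
convergence applies. -/
theorem continuous_superposition (hp1 : 1 < p) (hp : p ≠ ∞) (hq : q ≠ ∞) (hC : 0 ≤ C)
    (hm : ∀ ξ, AEStronglyMeasurable (fun x => b x ξ) μ)
    (hc : ∀ᵐ x ∂μ, Continuous (b x)) (hg : MemLp g q μ)
    (hb : ∀ᵐ x ∂μ, ∀ ξ, ‖b x ξ‖ ≤ C * ‖ξ‖ ^ (p.toReal - 1) + g x) :
    Continuous fun f : Lp E p μ => (memLp_superposition hp1 hp hm hc hg hb (Lp.memLp f)).toLp _ := by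
  rw [continuous_iff_continuousAt]
  intro f'
  refine tendsto_of_subseq_tendsto fun fs hfs => ?_
  obtain ⟨ns, K, hK, h1, h2, h3⟩ := exists_dominated_subseq hfs
  refine ⟨ns, ?_⟩
  rw [Lp.tendsto_Lp_iff_tendsto_eLpNorm'']
  have hr : 0 ≤ p.toReal - 1 := by
    rw [← toReal_sub_one_eq hp1 hp]; exact ENNReal.toReal_nonneg
  refine tendsto_eLpNorm_zero_of_dominated
    (G := fun x => 2 * (C * ‖K x‖ ^ (p.toReal - 1) + g x)) (zero_lt_one.trans_le Fact.out).ne' hq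
    (fun n => ((memLp_superposition hp1 hp hm hc hg hb (Lp.memLp _)).sub
      (memLp_superposition hp1 hp hm hc hg hb (Lp.memLp _))).1)
    ((((memLp_norm_rpow_sub_one hp1 hp hK).const_mul C).add hg).const_mul 2) (fun n => ?_) ?_
  · filter_upwards [hb, h1 n, h2] with x e1 e2 e3
    have key : ∀ ξ : E, ‖ξ‖ ≤ K x → ‖b x ξ‖ ≤ C * ‖K x‖ ^ (p.toReal - 1) + g x := fun ξ hξ => by
      refine (e1 ξ).trans ?_
      have := Real.rpow_le_rpow (norm_nonneg ξ) (hξ.trans (le_abs_self _)) hr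
      rw [Real.norm_eq_abs]
      gcongr
    refine le_trans ?_ (le_abs_self _)
    rw [two_mul]
    exact (norm_sub_le _ _).trans (add_le_add (key _ e2) (key _ e3))
  · filter_upwards [hc, h3] with x e1 e2
    have := ((e1.tendsto (f' x)).comp e2).sub_const (b x (f' x))
    rwa [sub_self] at this

omit [Fact (1 ≤ p)] in
theorem norm_superposition_le (hp1 : 1 < p) (hp : p ≠ ∞) (hC : 0 ≤ C)
    (hm : ∀ ξ, AEStronglyMeasurable (fun x => b x ξ) μ)
    (hc : ∀ᵐ x ∂μ, Continuous (b x)) (hg : MemLp g q μ)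
    (hb : ∀ᵐ x ∂μ, ∀ ξ, ‖b x ξ‖ ≤ C * ‖ξ‖ ^ (p.toReal - 1) + g x) (f : Lp E p μ) :
    ‖(memLp_superposition hp1 hp hm hc hg hb (Lp.memLp f)).toLp _‖
      ≤ C * ‖f‖ ^ (p.toReal - 1) + (eLpNorm g q μ).toReal := by
  have hr : 0 < p.toReal - 1 := by
    rw [← toReal_sub_one_eq hp1 hp]
    exact ENNReal.toReal_pos (tsub_pos_of_lt hp1).ne' (ne_top_of_le_ne_top hp tsub_le_self)
  have hF := memLp_norm_rpow_sub_one (q := q) hp1 hp (Lp.memLp f)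
  let A : Lp ℝ q μ := hF.toLp _
  have hA : ‖A‖ = ‖f‖ ^ (p.toReal - 1) := by
    rw [Lp.norm_toLp, eLpNorm_norm_rpow _ hr, ← ENNReal.toReal_rpow, Lp.norm_def]
    congr 3
    rw [← toReal_sub_one_eq hp1 hp, ENNReal.ofReal_toReal (ne_top_of_le_ne_top hp tsub_le_self),
      ← div_sub_one_eq (p := p) (q := q) hp1 hp, mul_comm]
    exact ENNReal.mul_div_cancel (tsub_pos_of_lt hp1).ne' (ne_top_of_le_ne_top hp tsub_le_self)
  have h : ‖(memLp_superposition hp1 hp hm hc hg hb (Lp.memLp f)).toLp _‖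
      ≤ ‖C • A + hg.toLp g‖ := by
    refine Lp.norm_le_norm_of_ae_le ?_
    filter_upwards [hb, MemLp.coeFn_toLp (memLp_superposition hp1 hp hm hc hg hb (Lp.memLp f)),
      Lp.coeFn_add (C • A) (hg.toLp g), Lp.coeFn_smul C A, hF.coeFn_toLp, hg.coeFn_toLp]
      with x e1 e2 e3 e4 e5 e6
    rw [e2, e3, Pi.add_apply, e4, Pi.smul_apply, e5, e6]
    exact (e1 _).trans (le_abs_self _)
  refine h.trans ((norm_add_le _ _).trans_eq ?_)
  rw [norm_smul, hA, Lp.norm_toLp, Real.norm_of_nonneg hC]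

end superposition

/-! ### The diffusion and reaction operators -/

section operators

variable {D : Opens (Eu d)} {p q : ℝ≥0∞} [Fact (1 ≤ p)] [Fact (1 ≤ q)] [p.HolderConjugate q]

/-- The functional `w ↦ ∫_D k · ∇w`. -/
def divL (D : Opens (Eu d)) (p q : ℝ≥0∞) [Fact (1 ≤ p)] [Fact (1 ≤ q)] [p.HolderConjugate q] :
    Lp (Eu d) q (volD D) →L[ℝ] StrongDual ℝ (W0 D p) :=
  have : q.HolderConjugate p := ENNReal.HolderConjugate.symm
  (ContinuousLinearMap.precomp ℝ (gradL D p)) ∘L ((innerSL ℝ).lpPairing (volD D) q p)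

theorem divL_apply (k : Lp (Eu d) q (volD D)) (w : W0 D p) :
    divL D p q k w = ∫ x in (D : Set (Eu d)), inner ℝ (k x) (grad w x) := by
  have : q.HolderConjugate p := ENNReal.HolderConjugate.symm
  exact ContinuousLinearMap.lpPairing_eq_integral (innerSL ℝ) k (gradL D p w)

/-- The second variable of `a` is frozen at `0`, so the operator is a superposition operator in the
gradient alone and (A1) makes it monotone. Continuity and growth serve to make `t ↦ A (u t)`
measurable and in `L^q`. -/
theorem exists_diffusion_operator (hp2 : 2 ≤ p) (hp : p ≠ ∞) (hq : q ≠ ∞)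
    {a : Eu d → ℝ → Eu d → Eu d} (ha : IsLerayLions D p q a)
    (ha_indep : ∀ᵐ x ∂volD D, ∀ l₁ l₂ ξ, a x l₁ ξ = a x l₂ ξ) :
    ∃ A : W0 D p → StrongDual ℝ (W0 D p), Continuous A ∧
      (∀ u w, A u w = ∫ x in (D : Set (Eu d)), inner ℝ (a x (val u x) (grad u x)) (grad w x)) ∧
      (∃ C K : ℝ, ∀ u, ‖A u‖ ≤ C * ‖u‖ ^ (p.toReal - 1) + K) ∧
      ∀ u v, 0 ≤ (A u - A v) (u - v) := by
  have hp1 : 1 < p := lt_of_lt_of_le (by norm_num) hp2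
  have hr : 0 < p.toReal - 1 := by
    rw [← toReal_sub_one_eq hp1 hp]
    exact ENNReal.toReal_pos (tsub_pos_of_lt hp1).ne' (ne_top_of_le_ne_top hp tsub_le_self)
  obtain ⟨_, _, C, _, g, _, _, hC, _, _, hg, hag⟩ := ha.coercive_growth
  have hm : ∀ ξ, AEStronglyMeasurable (fun x => a x 0 ξ) (volD D) := ha.measurable 0
  have hc : ∀ᵐ x ∂volD D, Continuous (a x 0) := by
    filter_upwards [ha.continuous] with x hx
    exact hx.comp (continuous_const.prodMk continuous_id)
  have hb : ∀ᵐ x ∂volD D, ∀ ξ, ‖a x 0 ξ‖ ≤ C * ‖ξ‖ ^ (p.toReal - 1) + g x := by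
    filter_upwards [hag] with x hx ξ
    -- At `l = 0` the term `C₃ * |l| ^ (p - 1)` vanishes, as the exponent is positive.
    simpa [Real.zero_rpow hr.ne'] using (hx 0 ξ).2
  let N : Lp (Eu d) p (volD D) → Lp (Eu d) q (volD D) := fun f =>
    (memLp_superposition hp1 hp hm hc hg hb (Lp.memLp f)).toLp _
  have hNc : Continuous N := continuous_superposition hp1 hp hq hC hm hc hg hb
  have hN : ∀ f, N f =ᵐ[volD D] fun x => a x 0 (f x) := fun f => MemLp.coeFn_toLp _
  refine ⟨fun u => divL D p q (N (gradL D p u)),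
    (divL D p q).continuous.comp (hNc.comp (gradL D p).continuous), fun u w => ?_,
    ⟨‖divL D p q‖ * C, ‖divL D p q‖ * (eLpNorm g q (volD D)).toReal, fun u => ?_⟩, fun u v => ?_⟩
  · rw [divL_apply]
    refine integral_congr_ae ?_
    filter_upwards [hN (gradL D p u), ha_indep] with x h1 h2
    rw [h1, coe_gradL, h2 0 (val u x)]
  · refine ((divL D p q).le_opNorm _).trans ?_
    rw [mul_assoc, ← mul_add]
    refine mul_le_mul_of_nonneg_left
      ((norm_superposition_le hp1 hp hC hm hc hg hb (gradL D p u)).trans ?_) (norm_nonneg _)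
    have := Real.rpow_le_rpow (norm_nonneg _) (norm_gradL_le u) hr.le
    gcongr
  · rw [← map_sub, divL_apply]
    refine integral_nonneg_of_ae ?_
    filter_upwards [hN (gradL D p u), hN (gradL D p v), grad_sub u v, ha.monotone,
      Lp.coeFn_sub (N (gradL D p u)) (N (gradL D p v))] with x h1 h2 h3 h4 h5
    rw [h5, Pi.sub_apply, h1, h2, h3, coe_gradL, coe_gradL]
    exact h4 _ _ _

/-- `f` acts as a Lipschitz map of `L²(D)`, and the lower bound is the Cauchy-Schwarz inequality
there. -/
theorem exists_reaction_operator [IsFiniteMeasure (volD D)] (hp2 : 2 ≤ p) {f : ℝ → ℝ} {L : ℝ≥0}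
    (hf : LipschitzWith L f) (hf0 : f 0 = 0) :
    ∃ B : W0 D p → StrongDual ℝ (W0 D p), Continuous B ∧
      (∀ u w, B u w = ∫ x in (D : Set (Eu d)), f (val u x) * val w x) ∧
      (∃ C : ℝ, ∀ u, ‖B u‖ ≤ C * ‖u‖) ∧
      ∀ u v, -(L * ‖toL2 D hp2 (u - v)‖ ^ 2) ≤ (B u - B v) (u - v) := by
  refine ⟨fun u => dualOfL2 D hp2 (hf.compLp hf0 (toL2 D hp2 u)),
    (dualOfL2 D hp2).continuous.comp ((hf.continuous_compLp hf0).comp (toL2 D hp2).continuous),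
    fun u w => ?_, ⟨‖dualOfL2 D hp2‖ * (L * ‖toL2 D hp2‖), fun u => ?_⟩, fun u v => ?_⟩
  · rw [dualOfL2_apply, inner_toL2]
    refine integral_congr_ae ?_
    filter_upwards [hf.coeFn_compLp hf0 (toL2 D hp2 u), coeFn_toL2 hp2 u] with x h1 h2
    rw [h1, Function.comp_apply, h2]
  · refine ((dualOfL2 D hp2).le_opNorm _).trans ?_
    rw [mul_assoc, mul_assoc]
    refine mul_le_mul_of_nonneg_left ((hf.norm_compLp_le hf0 _).trans ?_) (norm_nonneg _)
    exact mul_le_mul_of_nonneg_left ((toL2 D hp2).le_opNorm u) L.coe_nonneg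
  · rw [← map_sub, dualOfL2_apply]
    have h1 := abs_real_inner_le_norm (hf.compLp hf0 (toL2 D hp2 u) - hf.compLp hf0 (toL2 D hp2 v))
      (toL2 D hp2 (u - v))
    have h2 := hf.norm_compLp_sub_le hf0 (toL2 D hp2 u) (toL2 D hp2 v)
    rw [← map_sub] at h2
    have h3 := mul_le_mul_of_nonneg_right h2 (norm_nonneg (toL2 D hp2 (u - v)))
    have h4 := neg_le_of_abs_le (h1.trans h3)
    linarith [h4, sq (‖toL2 D hp2 (u - v)‖)]

theorem exists_operator [IsFiniteMeasure (volD D)] (hp2 : 2 ≤ p) (hp : p ≠ ∞) (hq : q ≠ ∞)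
    {a : Eu d → ℝ → Eu d → Eu d} (ha : IsLerayLions D p q a)
    (ha_indep : ∀ᵐ x ∂volD D, ∀ l₁ l₂ ξ, a x l₁ ξ = a x l₂ ξ) {f : ℝ → ℝ} {L : ℝ≥0}
    (hf : LipschitzWith L f) (hf0 : f 0 = 0) :
    ∃ A B : W0 D p → StrongDual ℝ (W0 D p),
      (∀ u w, A u w = ∫ x in (D : Set (Eu d)), inner ℝ (a x (val u x) (grad u x)) (grad w x)) ∧
      (∀ u w, B u w = ∫ x in (D : Set (Eu d)), f (val u x) * val w x) ∧
      (∀ (T : ℝ) (u : LpW0 D p T), MemLp (fun t => A (u t)) q (volT T)) ∧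
      (∀ (T : ℝ) (u : LpW0 D p T), MemLp (fun t => B (u t)) q (volT T)) ∧
      ∀ u v, -(L * ‖toL2 D hp2 (u - v)‖ ^ 2) ≤ (A u - A v) (u - v) + (B u - B v) (u - v) := by
  obtain ⟨A, hAc, hA, ⟨C, K, hAb⟩, hAm⟩ := exists_diffusion_operator hp2 hp hq ha ha_indep
  obtain ⟨B, hBc, hB, ⟨C', hBb⟩, hBm⟩ := exists_reaction_operator (D := D) hp2 hf hf0
  have hp1 : 1 < p := lt_of_lt_of_le (by norm_num) hp2
  -- Conjugacy and `2 ≤ p` give `q ≤ 2 ≤ p`; thus a function of linear growth in `u` is in `L^q` of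
  -- time.
  have hqp : q ≤ p := by
    refine le_trans ?_ hp2
    have h := ENNReal.HolderConjugate.inv_add_inv_eq_one p q
    by_contra hcon
    have h1 : p⁻¹ ≤ 2⁻¹ := ENNReal.inv_le_inv.2 hp2
    have h2 : q⁻¹ < 2⁻¹ := ENNReal.inv_lt_inv.2 (not_le.1 hcon)
    have := ENNReal.add_lt_add_of_le_of_lt (ne_top_of_le_ne_top (by simp) h1) h1 h2
    rw [h, ENNReal.inv_two_add_inv_two] at this
    exact lt_irrefl _ this
  refine ⟨A, B, hA, hB, fun T u => ?_, fun T u => ?_, fun u v => ?_⟩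
  · refine MemLp.of_le (((memLp_norm_rpow_sub_one (q := q) hp1 hp (Lp.memLp u)).const_mul C).add
      (memLp_const K)) (hAc.comp_aestronglyMeasurable (Lp.memLp u).1)
      (Eventually.of_forall fun t => ?_)
    exact (hAb _).trans (le_abs_self _)
  · refine MemLp.of_le (((Lp.memLp u).norm.mono_exponent hqp).const_mul C')
      (hBc.comp_aestronglyMeasurable (Lp.memLp u).1) (Eventually.of_forall fun t => ?_)
    exact (hBb _).trans (le_abs_self _)
  · linarith [hAm u v, hBm u v]

end operators

/-! ### From weak time derivatives to integral identities -/

section duBoisReymond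

variable {T : ℝ}

/-- The primitive starting at `0` vanishes before the support of `κ`, and after it because the total
integral is zero. -/
theorem exists_test_primitive (hT : 0 < T) (κ : 𝓓((⟨Ioo 0 T, isOpen_Ioo⟩ : Opens ℝ), ℝ))
    (h0 : ∫ t in (0 : ℝ)..T, κ t = 0) :
    ∃ θ : 𝓓((⟨Ioo 0 T, isOpen_Ioo⟩ : Opens ℝ), ℝ), deriv θ = κ := by
  -- The extra point keeps `K` nonempty when `κ` vanishes identically.
  set K : Set ℝ := tsupport κ ∪ {T / 2} with hK
  have hKc : IsCompact K := κ.hasCompactSupport.isCompact.union isCompact_singleton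
  have hKT : K ⊆ Ioo 0 T := union_subset κ.tsupport_subset
    (singleton_subset_iff.2 ⟨half_pos hT, half_lt_self hT⟩)
  have hKn : K.Nonempty := ⟨T / 2, Or.inr rfl⟩
  obtain ⟨α, hα, hαK⟩ := hKc.exists_isLeast hKn
  obtain ⟨β, hβ, hβK⟩ := hKc.exists_isGreatest hKn
  have hκ1 : ∀ t, t < α → κ t = 0 := fun t ht =>
    image_eq_zero_of_notMem_tsupport fun h => ht.not_ge (hαK (Or.inl h))
  have hκ2 : ∀ t, β < t → κ t = 0 := fun t ht =>
    image_eq_zero_of_notMem_tsupport fun h => ht.not_ge (hβK (Or.inl h))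
  let F : ℝ → ℝ := fun t => ∫ s in (0 : ℝ)..t, κ s
  have hF : ∀ t, HasDerivAt F (κ t) t := fun t =>
    (κ.continuous.integral_hasStrictDerivAt 0 t).hasDerivAt
  have hFd : deriv F = κ := funext fun t => (hF t).deriv
  have hF0 : ∀ t, t ∉ Icc α β → F t = 0 := fun t ht => by
    rcases lt_or_ge t α with h | h
    · refine (intervalIntegral.integral_congr (g := fun _ => 0) fun s hs => ?_).trans (by simp)
      refine hκ1 s (lt_of_le_of_lt hs.2 (max_lt (hKT hα).1 h))
    · have h' : β < t := not_le.1 fun h' => ht ⟨h, h'⟩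
      have e : F t = (∫ s in (0 : ℝ)..T, κ s) + ∫ s in T..t, κ s :=
        (intervalIntegral.integral_add_adjacent_intervals
          (κ.continuous.intervalIntegrable _ _) (κ.continuous.intervalIntegrable _ _)).symm
      rw [e, h0, zero_add]
      refine (intervalIntegral.integral_congr (g := fun _ => 0) fun s hs => ?_).trans (by simp)
      exact hκ2 s (lt_of_lt_of_le (lt_min (hKT hβ).2 h') hs.1)
  have hsup : tsupport F ⊆ Icc α β := closure_minimal
    (fun t ht => by_contra fun h => ht (hF0 t h)) isClosed_Icc
  refine ⟨⟨F, contDiff_infty_iff_deriv.2 ⟨fun t => (hF t).differentiableAt, ?_⟩,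
    isCompact_Icc.of_isClosed_subset (isClosed_tsupport F) hsup,
    hsup.trans (Icc_subset_Ioo (hKT hα).1 (hKT hβ).2)⟩, hFd⟩
  rw [hFd]
  exact κ.contDiff

theorem integrable_test_mul {θ : ℝ → ℝ} (hθ : Continuous θ) (hs : HasCompactSupport θ) {m : ℝ → ℝ}
    {μ : Measure ℝ} (hm : Integrable m μ) : Integrable (fun t => θ t * m t) μ := by
  obtain ⟨C, hC⟩ := hθ.bounded_above_of_compact_support hs
  exact hm.bdd_mul hθ.aestronglyMeasurable (Eventually.of_forall hC)

theorem setIntegral_Ioo_eq (hT : 0 ≤ T) (f : ℝ → ℝ) :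
    ∫ t in Ioo 0 T, f t = ∫ t in (0 : ℝ)..T, f t := by
  rw [intervalIntegral.integral_of_le hT, integral_Ioc_eq_integral_Ioo]

/-- A function on an interval whose weak derivative vanishes is constant. -/
theorem ae_eq_const_of_weak_deriv_eq_zero (hT : 0 < T) {m : ℝ → ℝ} (hm : Integrable m (volT T))
    (h : ∀ θ : 𝓓((⟨Ioo 0 T, isOpen_Ioo⟩ : Opens ℝ), ℝ), ∫ t in Ioo 0 T, deriv θ t * m t = 0) :
    ∃ c, ∀ᵐ t ∂volT T, m t = c := by
  obtain ⟨φ, hφ01, hφ1⟩ := exists_test_one_on (⟨Ioo 0 T, isOpen_Ioo⟩ : Opens ℝ)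
    (isCompact_singleton (x := T / 2)) (singleton_subset_iff.2 ⟨half_pos hT, half_lt_self hT⟩)
  have hI : 0 < ∫ t in (0 : ℝ)..T, φ t := by
    refine intervalIntegral.integral_pos hT φ.continuous.continuousOn (fun t _ => (hφ01 t).1)
      ⟨T / 2, ⟨(half_pos hT).le, (half_lt_self hT).le⟩, ?_⟩
    rw [hφ1 _ rfl]
    exact one_pos
  set I := ∫ t in (0 : ℝ)..T, φ t
  set c := (∫ t in Ioo 0 T, φ t * m t) / I with hc
  have hloc : LocallyIntegrableOn (fun t => m t - c) (Ioo 0 T) volume :=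
    IntegrableOn.locallyIntegrableOn (hm.sub (integrable_const c))
  refine ⟨c, ?_⟩
  have := isOpen_Ioo.ae_eq_zero_of_integral_contDiff_smul_eq_zero hloc fun g hg hgs hgT => ?_
  · rw [ae_restrict_iff' measurableSet_Ioo]
    filter_upwards [this] with t ht hT
    exact sub_eq_zero.1 (ht hT)
  let χ : 𝓓((⟨Ioo 0 T, isOpen_Ioo⟩ : Opens ℝ), ℝ) := ⟨g, hg, hgs, hgT⟩
  set J := ∫ t in (0 : ℝ)..T, g t with hJ
  -- Subtracting the multiple of `φ` with the same mass makes the integral zero, so the difference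
  -- is the derivative of a test function. The constant `c` is the mean of `m` weighted by `φ`.
  obtain ⟨θ, hθ⟩ := exists_test_primitive hT (χ - (J / I) • φ) (by
    change ∫ t in (0 : ℝ)..T, (g t - (J / I) * φ t) = 0
    rw [intervalIntegral.integral_sub (hg.continuous.intervalIntegrable _ _)
      ((φ.continuous.const_mul _).intervalIntegrable _ _), intervalIntegral.integral_const_mul,
      ← hJ, div_mul_cancel₀ _ hI.ne', sub_self])
  have h1 := h θ
  rw [hθ] at h1
  have hgm := integrable_test_mul hg.continuous hgs hm
  have hφm := integrable_test_mul φ.continuous φ.hasCompactSupport hm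
  have h2 : ∫ t in Ioo 0 T, ((g t - (J / I) * φ t) * m t) = 0 := h1
  have h3 : ∫ t in Ioo 0 T, g t * m t = J * c := by
    have e : ∀ t, (g t - (J / I) * φ t) * m t = g t * m t - (J / I) * (φ t * m t) := fun t => by
      ring
    simp_rw [e] at h2
    rw [integral_sub hgm (hφm.const_mul _), integral_const_mul, sub_eq_zero] at h2
    rw [h2, hc]
    ring
  have hsupp : ∀ t, t ∉ Ioo 0 T → g t • (m t - c) = 0 := fun t ht => by
    rw [show g t = 0 from image_eq_zero_of_notMem_tsupport fun h => ht (hgT h), zero_smul]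
  rw [← setIntegral_eq_integral_of_forall_compl_eq_zero hsupp]
  have hgi : Integrable g (volT T) := (hg.continuous.integrable_of_hasCompactSupport hgs).restrict
  simp_rw [smul_eq_mul, mul_sub]
  rw [integral_sub hgm (hgi.mul_const c), h3, integral_mul_const, setIntegral_Ioo_eq hT.le, sub_self]

/-- The primitive of `k` has the same weak derivative as `h`, so their difference is constant a.e.
As `k` is merely integrable, the integration by parts is the one for absolutely continuous
functions. -/
theorem exists_eq_add_integral_of_weak_deriv (hT : 0 < T) {h k : ℝ → ℝ} (hh : Integrable h (volT T))
    (hk : Integrable k (volT T))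
    (hw : ∀ θ : 𝓓((⟨Ioo 0 T, isOpen_Ioo⟩ : Opens ℝ), ℝ),
      ∫ t in Ioo 0 T, deriv θ t * h t = - ∫ t in Ioo 0 T, θ t * k t) :
    ∃ c, ∀ᵐ t ∂volT T, h t = c + ∫ s in (0 : ℝ)..t, k s := by
  have hki : IntervalIntegrable k volume 0 T :=
    (intervalIntegrable_iff_integrableOn_Ioo_of_le hT.le).2 hk
  set F : ℝ → ℝ := fun t => ∫ s in (0 : ℝ)..t, k s with hF
  have hac : AbsolutelyContinuousOnInterval F 0 T :=
    hki.absolutelyContinuousOnInterval_intervalIntegral (by simp)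
  have hFi : Integrable F (volT T) := by
    have := hac.continuousOn
    rw [uIcc_of_le hT.le] at this
    exact (this.integrableOn_compact isCompact_Icc).mono_set Ioo_subset_Icc_self
  suffices hz : ∀ θ : 𝓓((⟨Ioo 0 T, isOpen_Ioo⟩ : Opens ℝ), ℝ),
      ∫ t in Ioo 0 T, deriv θ t * (h - F) t = 0 by
    obtain ⟨c, hc⟩ := ae_eq_const_of_weak_deriv_eq_zero hT (hh.sub hFi) hz
    refine ⟨c, ?_⟩
    filter_upwards [hc] with t ht
    rw [← ht]
    exact (sub_add_cancel _ _).symm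
  intro θ
  have hθd : Continuous (deriv θ) := θ.contDiff.continuous_deriv (by simp)
  have hθs : HasCompactSupport (deriv θ) := θ.hasCompactSupport.deriv
  have hθac : AbsolutelyContinuousOnInterval θ 0 T :=
    ((θ.contDiff.of_le (by simp)).contDiffOn).absolutelyContinuousOnInterval
  have hθ0 : θ 0 = 0 := eq_zero_of_notMem fun h => lt_irrefl _ h.1
  have hθT : θ T = 0 := eq_zero_of_notMem fun h => lt_irrefl _ h.2
  have hparts := hθac.integral_mul_deriv_eq_deriv_mul hac
  rw [hθ0, hθT, zero_mul, zero_mul, sub_self, zero_sub] at hparts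
  have hcongr : ∫ t in (0 : ℝ)..T, θ t * deriv F t = ∫ t in (0 : ℝ)..T, θ t * k t := by
    refine intervalIntegral.integral_congr_ae ?_
    filter_upwards [hki.ae_hasDerivAt_integral] with t ht htT
    rw [(ht (uIoc_subset_uIcc htT) 0 (by simp)).deriv]
  rw [hcongr] at hparts
  simp only [Pi.sub_apply, mul_sub]
  rw [integral_sub (integrable_test_mul hθd hθs hh) (integrable_test_mul hθd hθs hFi), hw,
    setIntegral_Ioo_eq hT.le, setIntegral_Ioo_eq hT.le, hparts]
  ring

/-- Both sides of the a.e. identity are right-continuous and every interval to the right of `t`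
contains times where it holds, so it holds on all of `[0, T)`. -/
theorem sub_eq_integral_of_ae_eq {h k : ℝ → ℝ} {c : ℝ} (hk : Integrable k (volT T))
    (hc : ∀ t ∈ Ico 0 T, ContinuousWithinAt h (Ioi t) t)
    (hae : ∀ᵐ t ∂volT T, h t = c + ∫ s in (0 : ℝ)..t, k s) {s t : ℝ} (hs : 0 ≤ s) (hst : s ≤ t)
    (ht : t < T) : h t - h s = ∫ r in s..t, k r := by
  have hT : 0 ≤ T := hs.trans (hst.trans ht.le)
  have hki : IntervalIntegrable k volume 0 T :=
    (intervalIntegrable_iff_integrableOn_Ioo_of_le hT).2 hk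
  have hFc : ContinuousOn (fun t => ∫ s in (0 : ℝ)..t, k s) (Icc 0 T) := by
    have := (hki.absolutelyContinuousOnInterval_intervalIntegral (c := 0) (by simp)).continuousOn
    rwa [uIcc_of_le hT] at this
  have key : ∀ t ∈ Ico 0 T, h t = c + ∫ s in (0 : ℝ)..t, k s := fun t ht => by
    have hlim : Tendsto (fun t => h t - ∫ s in (0 : ℝ)..t, k s) (𝓝[>] t)
        (𝓝 (h t - ∫ s in (0 : ℝ)..t, k s)) := by
      refine (hc t ht).sub ?_
      have h1 := hFc t ⟨ht.1, ht.2.le⟩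
      have h2 : ContinuousWithinAt (fun t => ∫ s in (0 : ℝ)..t, k s) (Ioc t T) t :=
        h1.mono fun r hr => ⟨ht.1.trans hr.1.le, hr.2⟩
      exact h2.mono_of_mem_nhdsWithin (Ioc_mem_nhdsGT ht.2)
    have hfreq : ∃ᶠ r in 𝓝[>] t, (h r - ∫ s in (0 : ℝ)..r, k s) ∈ ({c} : Set ℝ) := by
      intro hev
      obtain ⟨u, hu, hsub⟩ := mem_nhdsGT_iff_exists_Ioo_subset.1 hev
      have hlt : t < min u T := lt_min hu ht.2
      have hne : NeBot (ae (volume.restrict (Ioo t (min u T)))) := by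
        rw [ae_restrict_neBot, Real.volume_Ioo]
        simpa using hlt
      have hsubset : Ioo t (min u T) ⊆ Ioo 0 T := Ioo_subset_Ioo ht.1 (min_le_right _ _)
      obtain ⟨r, hr1, hr2⟩ := ((ae_restrict_of_ae_restrict_of_subset hsubset hae).and
        (ae_restrict_mem measurableSet_Ioo)).exists
      exact hsub ⟨hr2.1, hr2.2.trans_le (min_le_left _ _)⟩ (by
        simp only [mem_singleton_iff]
        rw [hr1, add_sub_cancel_right])
    have := isClosed_singleton.mem_of_frequently_of_tendsto hfreq hlim
    linarith [mem_singleton_iff.1 this]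
  rw [key t ⟨hs.trans hst, ht⟩, key s ⟨hs, hst.trans_lt ht⟩]
  have hsub : ∀ r ∈ Icc 0 T, IntervalIntegrable k volume 0 r := fun r hr =>
    hki.mono_set (by rw [uIcc_of_le hr.1, uIcc_of_le hT]; exact Icc_subset_Icc_right hr.2)
  rw [← intervalIntegral.integral_interval_sub_left (hsub t ⟨hs.trans hst, ht.le⟩)
    (hsub s ⟨hs, hst.trans ht.le⟩)]
  ring

end duBoisReymond

/-! ### Pathwise comparison of two solutions -/

section pathwise

theorem memLp_add_sub {α E : Type*} [MeasurableSpace α] {μ : Measure α} [NormedAddCommGroup E]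
    {p : ℝ≥0∞} {f g h : α → E} (hf : MemLp f p μ) (hg : MemLp g p μ) (hh : MemLp h p μ) :
    MemLp (fun x => f x + g x - h x) p μ :=
  (hf.add hg).sub hh

variable {D : Opens (Eu d)} {p q : ℝ≥0∞} [Fact (1 ≤ p)] [Fact (1 ≤ q)] [p.HolderConjugate q]
  {T : ℝ} [IsFiniteMeasure (volD D)]

/-- The equation of the obstacle problem tested with `θ(t) ψ(x)`. -/
theorem integral_deriv_mul_inner_eq (hp2 : 2 ≤ p) {a : Eu d → ℝ → Eu d → Eu d} {f : ℝ → ℝ}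
    {A B : W0 D p → StrongDual ℝ (W0 D p)}
    (hA : ∀ u w, A u w = ∫ x in (D : Set (Eu d)), inner ℝ (a x (val u x) (grad u x)) (grad w x))
    (hB : ∀ u w, B u w = ∫ x in (D : Set (Eu d)), f (val u x) * val w x)
    {u : LpW0 D p T} (hAm : MemLp (fun t => A (u t)) q (volT T))
    (hBm : MemLp (fun t => B (u t)) q (volT T)) {m : ℝ → L2 D}
    {η G : StrongDual ℝ (SpaceW D p q T)} {ζ : LqDual D p q T} (hη : IsGivenBy η ζ)
    (hG : IsTimeDeriv G (fun t x => val (u t) x - m t x))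
    (heq : ∀ w : SpaceW D p q T, G w
      + (∫ t in Ioo 0 T, ∫ x in (D : Set (Eu d)),
          inner ℝ (a x (val (u t) x) (grad (u t) x)) (grad (w.fn t) x))
      + (∫ t in Ioo 0 T, ∫ x in (D : Set (Eu d)), f (val (u t) x) * val (w.fn t) x) = η w)
    (θ : 𝓓((⟨Ioo 0 T, isOpen_Ioo⟩ : Opens ℝ), ℝ)) (ψ : 𝓓(D, ℝ)) :
    ∫ t in Ioo 0 T, deriv θ t * inner ℝ (toL2 D hp2 (u t) - m t) (toL2 D hp2 (ofTest D p ψ))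
      = ∫ t in Ioo 0 T, θ t * (A (u t) + B (u t) - ζ t) (ofTest D p ψ) := by
  obtain ⟨w, hw⟩ := exists_spaceW (q := q) hp2 (tensorTest θ ψ)
  have hder : ∀ t x, deriv (fun s => tensorTest θ ψ (s, x)) t = deriv θ t * ψ x := fun t x =>
    ((differentiable_test θ t).hasDerivAt.mul_const (ψ x)).deriv
  have h1 : G w = - ∫ t in Ioo 0 T,
      deriv θ t * inner ℝ (toL2 D hp2 (u t) - m t) (toL2 D hp2 (ofTest D p ψ)) := by
    rw [hG _ w (isRepr_of_ae_eq_slice hw)]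
    refine congrArg Neg.neg (integral_congr_ae (Eventually.of_forall fun t => ?_))
    simp only
    rw [inner_toL2_ofTest, ← integral_const_mul]
    refine integral_congr_ae ?_
    filter_upwards [Lp.coeFn_sub (toL2 D hp2 (u t)) (m t), coeFn_toL2 hp2 (u t)] with x e1 e2
    rw [hder, e1, Pi.sub_apply, e2]
    ring
  have hslice : ∀ (F : W0 D p → StrongDual ℝ (W0 D p)), ∀ᵐ t ∂volT T,
      F (u t) (w.fn t) = θ t * F (u t) (ofTest D p ψ) := fun F => by
    filter_upwards [hw] with t ht
    rw [ht, sliceTest_tensorTest, ofTest_smul, map_smul, smul_eq_mul]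
  have h2 : ∫ t in Ioo 0 T, ∫ x in (D : Set (Eu d)),
      inner ℝ (a x (val (u t) x) (grad (u t) x)) (grad (w.fn t) x)
      = ∫ t in Ioo 0 T, θ t * A (u t) (ofTest D p ψ) := by
    simp_rw [← hA]
    exact integral_congr_ae (hslice A)
  have h3 : ∫ t in Ioo 0 T, ∫ x in (D : Set (Eu d)), f (val (u t) x) * val (w.fn t) x
      = ∫ t in Ioo 0 T, θ t * B (u t) (ofTest D p ψ) := by
    simp_rw [← hB]
    exact integral_congr_ae (hslice B)
  have h4 : η w = ∫ t in Ioo 0 T, θ t * ζ t (ofTest D p ψ) := by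
    rw [hη w]
    refine integral_congr_ae ?_
    filter_upwards [hw] with t ht
    rw [ht, sliceTest_tensorTest, ofTest_smul, map_smul, smul_eq_mul]
  have hint : ∀ {F : ℝ → StrongDual ℝ (W0 D p)}, MemLp F q (volT T) →
      Integrable (fun t => θ t * F t (ofTest D p ψ)) (volT T) := fun hF =>
    integrable_test_mul θ.continuous θ.hasCompactSupport
      ((ContinuousLinearMap.apply ℝ ℝ (ofTest D p ψ)).integrable_comp (hF.integrable Fact.out))
  have h5 := heq w
  rw [h1, h2, h3, h4] at h5
  have e : ∀ t, θ t * (A (u t) + B (u t) - ζ t) (ofTest D p ψ) = θ t * A (u t) (ofTest D p ψ)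
      + θ t * B (u t) (ofTest D p ψ) - θ t * ζ t (ofTest D p ψ) := fun t => by
    rw [_root_.sub_apply, _root_.add_apply]; ring
  simp_rw [e]
  have i1 := hint hAm
  have i2 := hint hBm
  have i12 : Integrable (fun t => θ t * A (u t) (ofTest D p ψ) + θ t * B (u t) (ofTest D p ψ))
      (volT T) := i1.add i2
  rw [integral_sub i12 (hint (Lp.memLp ζ)), integral_add i1 i2]
  linarith

/-- For a test function `ψ` this is the scalar du Bois-Reymond statement. Both sides are continuous
in `w`, the right one being the Bochner integral of `ξ` in the dual evaluated at `w`, so density of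
test functions concludes. -/
theorem inner_sub_eq_integral (hp2 : 2 ≤ p) (hT : 0 < T) {z : LpW0 D p T}
    {ξ : ℝ → StrongDual ℝ (W0 D p)} (hξ : Integrable ξ (volT T)) {y : ℝ → L2 D}
    (hy : ∀ t ∈ Ico 0 T, ContinuousWithinAt y (Ioi t) t)
    (hyz : ∀ᵐ t ∂volT T, y t = toL2 D hp2 (z t))
    (hweak : ∀ (θ : 𝓓((⟨Ioo 0 T, isOpen_Ioo⟩ : Opens ℝ), ℝ)) (ψ : 𝓓(D, ℝ)),
      ∫ t in Ioo 0 T, deriv θ t * inner ℝ (toL2 D hp2 (z t)) (toL2 D hp2 (ofTest D p ψ))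
        = - ∫ t in Ioo 0 T, θ t * ξ t (ofTest D p ψ)) {s t : ℝ} (hs : 0 ≤ s) (hst : s ≤ t)
    (ht : t < T) (w : W0 D p) :
    inner ℝ (y t - y s) (toL2 D hp2 w) = ∫ r in s..t, ξ r w := by
  have hξi : IntervalIntegrable ξ volume s t := by
    rw [intervalIntegrable_iff_integrableOn_Ioc_of_le hst]
    exact IntegrableOn.mono_set (t := Ioo 0 T) hξ fun r hr => ⟨hs.trans_lt hr.1, hr.2.trans_lt ht⟩
  have hR : ∀ w : W0 D p, ∫ r in s..t, ξ r w = (∫ r in s..t, ξ r) w := fun w =>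
    (ContinuousLinearMap.intervalIntegral_apply hξi w).symm
  rw [hR]
  refine congrFun (denseRange_ofTest.equalizer
    (g := fun w : W0 D p => inner ℝ (y t - y s) (toL2 D hp2 w))
    (h := fun w : W0 D p => (∫ r in s..t, ξ r) w)
    ((innerSL ℝ (y t - y s)).continuous.comp (toL2 D hp2).continuous)
    (∫ r in s..t, ξ r).continuous (funext fun ψ => ?_)) w
  simp only [Function.comp_apply]
  rw [← hR, inner_sub_left]
  set W := toL2 D hp2 (ofTest D p ψ)
  have hz : Integrable (fun t => inner ℝ (toL2 D hp2 (z t)) W) (volT T) := by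
    have h1 : Integrable (fun t => z t) (volT T) := (Lp.memLp z).integrable Fact.out
    have h2 := ((innerSL ℝ W).comp (toL2 D hp2)).integrable_comp h1
    refine h2.congr (Eventually.of_forall fun t => ?_)
    exact real_inner_comm (toL2 D hp2 (z t)) W
  have hk : Integrable (fun t => ξ t (ofTest D p ψ)) (volT T) :=
    (ContinuousLinearMap.apply ℝ ℝ (ofTest D p ψ)).integrable_comp hξ
  obtain ⟨c, hc⟩ := exists_eq_add_integral_of_weak_deriv hT hz hk fun θ => hweak θ ψ
  refine sub_eq_integral_of_ae_eq (h := fun t => inner ℝ (y t) W) (c := c) hk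
    (fun t ht => (hy t ht).inner continuousWithinAt_const) ?_ hs hst ht
  filter_upwards [hc, hyz] with t e1 e2
  rw [e2, e1]

/-- Pathwise comparison of two solutions of the equation with the same driving path `m`. -/
theorem exists_continuous_sub_norm_le (hp2 : 2 ≤ p) (hp : p ≠ ∞) (hq : q ≠ ∞) (hT : 0 < T)
    {a : Eu d → ℝ → Eu d → Eu d} (ha : IsLerayLions D p q a)
    (ha_indep : ∀ᵐ x ∂volD D, ∀ l₁ l₂ ξ, a x l₁ ξ = a x l₂ ξ) {f : ℝ → ℝ} {L : ℝ≥0}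
    (hf : LipschitzWith L f) (hf0 : f 0 = 0) {u v : LpW0 D p T} {m : ℝ → L2 D}
    (hm : ContinuousOn m (Icc 0 T))
    {η G ν G' : StrongDual ℝ (SpaceW D p q T)} {ζ ζ' : LqDual D p q T}
    (hη : IsGivenBy η ζ) (hν : IsGivenBy ν ζ')
    (hG : IsTimeDeriv G (fun t x => val (u t) x - m t x))
    (hG' : IsTimeDeriv G' (fun t x => val (v t) x - m t x))
    (heq : ∀ w : SpaceW D p q T, G w
      + (∫ t in Ioo 0 T, ∫ x in (D : Set (Eu d)),
          inner ℝ (a x (val (u t) x) (grad (u t) x)) (grad (w.fn t) x))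
      + (∫ t in Ioo 0 T, ∫ x in (D : Set (Eu d)), f (val (u t) x) * val (w.fn t) x) = η w)
    (heq' : ∀ w : SpaceW D p q T, G' w
      + (∫ t in Ioo 0 T, ∫ x in (D : Set (Eu d)),
          inner ℝ (a x (val (v t) x) (grad (v t) x)) (grad (w.fn t) x))
      + (∫ t in Ioo 0 T, ∫ x in (D : Set (Eu d)), f (val (v t) x) * val (w.fn t) x) = ν w)
    (hζ : ∀ᵐ t ∂volT T, ζ t (u t) = 0 ∧ 0 ≤ ζ t (v t))
    (hζ' : ∀ᵐ t ∂volT T, ζ' t (v t) = 0 ∧ 0 ≤ ζ' t (u t))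
    {u₀ v₀ : L2 D} {u' v' : ℝ → L2 D} (hu : IsRightContRepr u u₀ u')
    (hv : IsRightContRepr v v₀ v') :
    ∃ z : ℝ → L2 D, ContinuousOn z (Icc 0 T) ∧ (∀ t ∈ Ico 0 T, z t = u' t - v' t) ∧
      ∀ t ∈ Icc 0 T, ‖z t‖ ≤ Real.exp (T * L) * ‖u₀ - v₀‖ := by
  obtain ⟨A, B, hA, hB, hAm, hBm, hAB⟩ := exists_operator hp2 hp hq ha ha_indep hf hf0
  -- `S u ζ` is minus the weak time derivative of `u - m`, so that of `u - v` is `S v ζ' - S u ζ`.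
  obtain ⟨S, hSdef⟩ : ∃ S : LpW0 D p T → LqDual D p q T → ℝ → StrongDual ℝ (W0 D p),
      ∀ u ζ t, S u ζ t = A (u t) + B (u t) - ζ t := ⟨fun u ζ t => _, fun _ _ _ => rfl⟩
  have hS : ∀ u ζ, MemLp (S u ζ) q (volT T) := fun u ζ => by
    rw [funext (hSdef u ζ)]
    exact memLp_add_sub (hAm T u) (hBm T u) (Lp.memLp ζ)
  obtain ⟨z, hz⟩ : ∃ z : LpW0 D p T, ∀ᵐ t ∂volT T, z t = u t - v t := by
    refine ⟨u - v, ?_⟩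
    filter_upwards [Lp.coeFn_sub u v] with t ht
    rw [ht, Pi.sub_apply]
  obtain ⟨ξ', hξ'⟩ : ∃ ξ' : LqDual D p q T, ∀ᵐ t ∂volT T, ξ' t = S v ζ' t - S u ζ t := by
    have h1 : MemLp (S v ζ' - S u ζ) q (volT T) := (hS v ζ').sub (hS u ζ)
    refine ⟨h1.toLp _, ?_⟩
    filter_upwards [h1.coeFn_toLp] with t ht
    rw [ht, Pi.sub_apply]
  -- Extension by zero to the line, where translations act.
  let Z : ℝ → W0 D p := (Ioo 0 T).indicator z
  let ξ : ℝ → StrongDual ℝ (W0 D p) := (Ioo 0 T).indicator ξ'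
  have hZ : MemLp Z p volume := (memLp_indicator_iff_restrict measurableSet_Ioo).2 (Lp.memLp z)
  have hZ2 : MemLp Z 2 volume :=
    (memLp_indicator_iff_restrict measurableSet_Ioo).2 ((Lp.memLp z).mono_exponent hp2)
  have hξL : MemLp ξ q volume :=
    (memLp_indicator_iff_restrict measurableSet_Ioo).2 (Lp.memLp ξ')
  have hZz : ∀ᵐ t ∂volT T, Z t = z t := by
    filter_upwards [ae_restrict_mem measurableSet_Ioo] with t ht using indicator_of_mem ht _
  have hZe : ∀ᵐ t ∂volT T, Z t = u t - v t := by
    filter_upwards [hz, hZz] with t h1 h2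
    rw [h2, h1]
  have hξe : ∀ᵐ t ∂volT T, ξ t = S v ζ' t - S u ζ t := by
    filter_upwards [hξ', ae_restrict_mem measurableSet_Ioo] with t h1 h2
    rw [show ξ t = ξ' t from indicator_of_mem h2 _, h1]
  have hval : ∀ {u : LpW0 D p T} {u₀ : L2 D} {u' : ℝ → L2 D}, IsRightContRepr u u₀ u' →
      ∀ᵐ t ∂volT T, u' t = toL2 D hp2 (u t) := fun h => by
    filter_upwards [h.ae_eq] with t ht
    refine Lp.ext ?_
    filter_upwards [ht, coeFn_toL2 hp2 _] with x e1 e2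
    rw [e1, e2]
  have hyz : ∀ᵐ t ∂volT T, u' t - v' t = toL2 D hp2 (Z t) := by
    filter_upwards [hval hu, hval hv, hZe] with t h1 h2 h3
    rw [h1, h2, h3, map_sub]
  have hyz' : ∀ᵐ t ∂volT T, u' t - v' t = toL2 D hp2 (z t) := by
    filter_upwards [hyz, hZz] with t h1 h2
    rw [h1, h2]
  have hycont : ∀ t ∈ Ico 0 T, ContinuousWithinAt (fun t => u' t - v' t) (Ioi t) t := fun t ht =>
    (hu.right_continuous t ht).sub (hv.right_continuous t ht)
  have hweak : ∀ (θ : 𝓓((⟨Ioo 0 T, isOpen_Ioo⟩ : Opens ℝ), ℝ)) (ψ : 𝓓(D, ℝ)),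
      ∫ t in Ioo 0 T, deriv θ t *
        inner ℝ (toL2 D hp2 (z t)) (toL2 D hp2 (ofTest D p ψ))
        = - ∫ t in Ioo 0 T, θ t * ξ t (ofTest D p ψ) := fun θ ψ => by
    set W := toL2 D hp2 (ofTest D p ψ) with hW
    have e1 := integral_deriv_mul_inner_eq hp2 hA hB (hAm T u) (hBm T u) hη hG heq θ ψ
    have e2 := integral_deriv_mul_inner_eq hp2 hA hB (hAm T v) (hBm T v) hν hG' heq' θ ψ
    have hθd : Continuous (deriv θ) := θ.contDiff.continuous_deriv (by simp)
    have hθs : HasCompactSupport (deriv θ) := θ.hasCompactSupport.deriv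
    have hmi : Integrable (fun t => inner ℝ (m t) W) (volT T) :=
      ((ContinuousOn.inner hm continuousOn_const).integrableOn_compact isCompact_Icc).mono_set
        Ioo_subset_Icc_self
    have hui : ∀ u : LpW0 D p T, Integrable (fun t => inner ℝ (toL2 D hp2 (u t)) W) (volT T) :=
      fun u => (((innerSL ℝ W).comp (toL2 D hp2)).integrable_comp
        ((Lp.memLp u).integrable Fact.out)).congr
          (Eventually.of_forall fun t => real_inner_comm (toL2 D hp2 (u t)) W)
    have hdi : ∀ u : LpW0 D p T,
        Integrable (fun t => deriv θ t * inner ℝ (toL2 D hp2 (u t) - m t) W) (volT T) := fun u => by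
      refine integrable_test_mul hθd hθs ?_
      simp_rw [inner_sub_left]
      exact (hui u).sub hmi
    have hSi : ∀ u ζ, Integrable (fun t => θ t * S u ζ t (ofTest D p ψ)) (volT T) := fun u ζ =>
      integrable_test_mul θ.continuous θ.hasCompactSupport
        ((ContinuousLinearMap.apply ℝ ℝ (ofTest D p ψ)).integrable_comp
          ((hS u ζ).integrable Fact.out))
    -- Here the common driving path `m` cancels.
    have e3 : ∫ t in Ioo 0 T, deriv θ t * inner ℝ (toL2 D hp2 (z t)) W
        = (∫ t in Ioo 0 T, deriv θ t * inner ℝ (toL2 D hp2 (u t) - m t) W)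
          - ∫ t in Ioo 0 T, deriv θ t * inner ℝ (toL2 D hp2 (v t) - m t) W := by
      rw [← integral_sub (hdi u) (hdi v)]
      refine integral_congr_ae ?_
      filter_upwards [hz] with t ht
      rw [ht, map_sub, ← mul_sub, ← inner_sub_left, sub_sub_sub_cancel_right]
    have e4 : ∫ t in Ioo 0 T, θ t * ξ t (ofTest D p ψ)
        = (∫ t in Ioo 0 T, θ t * S v ζ' t (ofTest D p ψ))
          - ∫ t in Ioo 0 T, θ t * S u ζ t (ofTest D p ψ) := by
      rw [← integral_sub (hSi v ζ') (hSi u ζ)]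
      refine integral_congr_ae ?_
      filter_upwards [hξe] with t ht
      rw [ht, _root_.sub_apply, mul_sub]
    simp_rw [hSdef] at e4
    rw [e3, e4, e1, e2, neg_sub]
  obtain ⟨y, hy1, hy2, hy3⟩ := exists_continuous_extension_norm_le (y := fun t => u' t - v' t)
    (Z := Z) (ζ := ξ) (L := L) hp hq (toL2 D hp2) hT
    ((Lp.stronglyMeasurable z).indicator measurableSet_Ioo)
    ((Lp.stronglyMeasurable ξ').indicator measurableSet_Ioo) hZ hξL hZ2
    ((ae_restrict_iff' measurableSet_Ioo).1 hyz) hycont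
    (fun s t hs hst ht w => inner_sub_eq_integral hp2 hT (z := z)
      ((hξL.restrict (Ioo 0 T)).integrable Fact.out) hycont hyz' hweak hs hst ht w)
    L.coe_nonneg ((ae_restrict_iff' measurableSet_Ioo).1 (by
      filter_upwards [hZe, hξe, hζ, hζ'] with t h1 h2 h3 h4
      have h5 := hAB (u t) (v t)
      rw [← h1] at h5
      -- Once `ζ (u) = 0` and `ζ' (v) = 0` are inserted, the reflection terms are `-ζ (v) - ζ' (u) ≤
      -- 0`, and `hAB` bounds the rest by `L` times the squared norm.
      have h6 : ξ t (Z t) = -((A (u t) - A (v t)) (Z t) + (B (u t) - B (v t)) (Z t))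
          + ζ t (Z t) - ζ' t (Z t) := by
        rw [h2]
        simp only [hSdef, _root_.sub_apply, _root_.add_apply]
        ring
      have h7 : ζ t (Z t) = ζ t (u t) - ζ t (v t) := by rw [h1, map_sub]
      have h8 : ζ' t (Z t) = ζ' t (u t) - ζ' t (v t) := by rw [h1, map_sub]
      rw [h6, h7, h8, h3.1, h4.1]
      linarith [h3.2, h4.2]))
  refine ⟨y, hy1, hy2, fun t ht => ?_⟩
  have := hy3 t ht
  rwa [hu.initial, hv.initial] at this

end pathwise

end ObstacleProblem

end

/-! ### Assembly: almost sure application of the pathwise comparison -/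

theorem theorem2p1 {d : ℕ} (hd : 2 ≤ d)
    (D : TopologicalSpace.Opens (EuclideanSpace ℝ (Fin d)))
    (hD : ObstacleProblem.IsBoundedLipschitzDomain D)
    (T : ℝ) (hT : 0 < T)
    (p q : ℝ≥0∞) [Fact (1 ≤ p)] [Fact (1 ≤ q)] [p.HolderConjugate q] (hp : 2 ≤ p) (hp' : p ≠ ∞)
    (f : ℝ → ℝ) (L : ℝ≥0) (hf : LipschitzWith L f) (hf0 : f 0 = 0)
    (a : EuclideanSpace ℝ (Fin d) → ℝ → EuclideanSpace ℝ (Fin d) → EuclideanSpace ℝ (Fin d))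
    (ha : ObstacleProblem.IsLerayLions D p q a)
    (ha_indep : ∀ᵐ x ∂(volume.restrict (D : Set (EuclideanSpace ℝ (Fin d)))),
      ∀ l₁ l₂ ξ, a x l₁ ξ = a x l₂ ξ)
    {Ω : Type*} [mΩ : MeasurableSpace Ω] (P : Measure Ω) [IsProbabilityMeasure P]
    (ℱ : Filtration ℝ≥0 mΩ) [ℱ.IsRightContinuous]
    (hℱ : ObstacleProblem.IsCompleteFiltration P ℱ)
    (W : ℝ≥0 → ObstacleProblem.L2 D → Ω → ℝ) (hW : ObstacleProblem.IsCylindricalWiener P ℱ W)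
    (Φ : ℝ → Ω → (ObstacleProblem.L2 D →L[ℝ] ObstacleProblem.L2 D))
    (hΦ : ObstacleProblem.IsIntegrand P ℱ T Φ)
    (M : ℝ≥0 → Ω → ObstacleProblem.L2 D) (hM : ObstacleProblem.IsItoIntegral P ℱ W T Φ M)
    (u₀ v₀ : Ω → ObstacleProblem.L2 D)
    (hu₀ : ObstacleProblem.IsInitialValue P ℱ u₀) (hv₀ : ObstacleProblem.IsInitialValue P ℱ v₀)
    (u v : Ω → ObstacleProblem.LpW0 D p T)
    (η ν : Ω → StrongDual ℝ (ObstacleProblem.SpaceW D p q T))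
    (μη μν : Ω → Measure (ℝ × EuclideanSpace ℝ (Fin d)))
    (hu : ObstacleProblem.IsSolution P ℱ a f M u₀ u η μη)
    (hv : ObstacleProblem.IsSolution P ℱ a f M v₀ v ν μν)
    (hη : ∀ᵐ ω ∂P, ∃ ζ : ObstacleProblem.LqDual D p q T, ObstacleProblem.IsGivenBy (η ω) ζ)
    (hν : ∀ᵐ ω ∂P, ∃ ζ : ObstacleProblem.LqDual D p q T, ObstacleProblem.IsGivenBy (ν ω) ζ)
    (u' v' : Ω → ℝ → ObstacleProblem.L2 D)
    (hu' : ∀ᵐ ω ∂P, ObstacleProblem.IsRightContRepr (u ω) (u₀ ω) (u' ω))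
    (hv' : ∀ᵐ ω ∂P, ObstacleProblem.IsRightContRepr (v ω) (v₀ ω) (v' ω)) :
    ∀ᵐ ω ∂P, ∃ z : ℝ → ObstacleProblem.L2 D,
      ContinuousOn z (Icc 0 T) ∧ (∀ t ∈ Ico 0 T, z t = u' ω t - v' ω t) ∧
      ∀ t ∈ Icc 0 T, ‖z t‖ ≤ Real.exp (T * L) * ‖u₀ ω - v₀ ω‖ := by
  have hfinite : IsFiniteMeasure (ObstacleProblem.volD D) :=
    ⟨by rw [Measure.restrict_apply_univ]; exact hD.bounded.measure_lt_top⟩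
  have hq : q ≠ ∞ := (ENNReal.HolderConjugate.ne_top_iff_ne_one q p).2
    (lt_of_lt_of_le (by norm_num) hp).ne'
  filter_upwards [hη, hν, hu', hv', hu.equation, hv.equation, hu.nonneg, hv.nonneg,
    hu.reflection_measure, hv.reflection_measure, hu.minimality, hv.minimality,
    hM.continuous_paths] with ω hη hν hu' hv' ⟨G, hG, hGe⟩ ⟨G', hG', hGe'⟩ hu0 hv0 hμη hμν
    hminu hminv hMc
  obtain ⟨ζ, hζ, hζ1, hζ2⟩ := ObstacleProblem.exists_nonneg_vanishing hp hp' hη hμη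
    (hu.reflection_radon.finite_on_compacts ω) hu0 hminu
  obtain ⟨ζ', hζ', hζ1', hζ2'⟩ := ObstacleProblem.exists_nonneg_vanishing hp hp' hν hμν
    (hv.reflection_radon.finite_on_compacts ω) hv0 hminv
  refine ObstacleProblem.exists_continuous_sub_norm_le hp hp' hq hT ha ha_indep hf hf0
    (m := fun t => M t.toNNReal ω) ?_ hζ hζ' hG hG' hGe hGe' ?_ ?_ hu' hv'
  · refine hMc.comp continuous_real_toNNReal.continuousOn fun t ht => ?_
    change ((t.toNNReal : ℝ≥0) : ℝ) ≤ T
    rw [Real.coe_toNNReal _ ht.1]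
    exact ht.2
  -- The cross terms: each reflection is nonnegative on the other solution, because that solution is
  -- nonnegative.
  · filter_upwards [hζ1, hζ2, hv0] with t h1 h2 h3 using ⟨h2, h1 _ h3⟩
  · filter_upwards [hζ1', hζ2', hu0] with t h1 h2 h3 using ⟨h2, h1 _ h3⟩
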